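/- Manifolds are smooth, finite-dimensional, Hausdorff and second countable. A $k$-polycosymplectic structure on $M$ is a family of closed 2-forms $\omega^1,\dots,\omega^k$ and closed 1-forms $\eta^1,\dots,\eta^k$ such that at every point $\eta^1\wedge\dots\wedge\eta^k\neq0$, $\bigcap_a\ker\omega^a\cap\bigcap_a\ker\eta^a=\{0\}$ and $\dim\bigcap_a\ker\omega^a=k$. A cosymplectic structure on a $(2n+1)$-dimensional manifold is a closed 2-form $\Omega$ and a closed 1-form $\lambda$ such that $\lambda\wedge\Omega^n$ is a volume form. An action $\Phi$ of a connected Lie group $G$ is (poly)cosymplectic if $\Phi_g^*\omega^a=\omega^a$ and $i_{\xi_M}\eta^a=0$ for all $g\in G$, $\xi\in\mathfrak g$, and $J=(J^1,\dots,J^k):M\to(\mathfrak g^*)^k$ is an equivariant momentum map if $i_{\xi_M}\omega^a=d\langle J^a,\xi\rangle$ and $J^a(\Phi_g(x))=\mathrm{Ad}^*_{g^{-1}}J^a(x)$. Let $G_\mu$ be the isotropy group of $\mu\in(\mathfrak g^*)^k$ under the $k$-fold coadjoint action, and $j_\mu:J^{-1}(\mu)\to M$, $\pi_\mu:J^{-1}(\mu)\to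 M_\mu=J^{-1}(\mu)/G_\mu$ the inclusion and the projection. A reduced space at $\mu$ consists of manifold structures on $J^{-1}(\mu)$ and on $M_\mu$, inducing the subspace and the quotient topology, for which $j_\mu$ is an embedding and $\pi_\mu$ a submersion, together with forms $\omega^a_\mu,\eta^a_\mu$ on $M_\mu$ with $\pi_\mu^*\omega^a_\mu=j_\mu^*\omega^a$ and $\pi_\mu^*\eta^a_\mu=j_\mu^*\eta^a$. **Proposition.** For $a=1,\dots,k$ let $(M_a,\Omega^a,\lambda^a)$ be a cosymplectic manifold with a smooth, free and proper cosymplectic action of a connected Lie group $G_a$, with equivariant momentum map $J^a:M_a\to\mathfrak g_a^*$, and let $\nu_a\in\mathfrak g_a^*$ be a regular value of $J^a$. On $M=M_1\times\dots\times M_k$ let $\omega^a=\mathrm{pr}_a^*\Omega^a$, $\eta^a=\mathrm{pr}_a^*\lambda^a$, let $G=G_1\times\dots\times G_k$ act componentwise, let $\mathbb J^a(x)=(0,\dots,J^a(x_a),\dots,0)\in\mathfrak g^*=\mathfrak g_1^*\times\dots\times\mathfrak g_k^*$, and let $\mu=(\mu_1,\dots,\mu_k)$ with $\mu_a=(0,\dots,\nu_a,\dots,0)$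 (entries in position $a$). Then: 1. $(M,\omega^a,\eta^a)$ is a $k$-polycosymplectic manifold, $G$ is a Lie group, and its action on $M$ is smooth, free, proper and polycosymplectic with equivariant momentum map $\mathbb J=(\mathbb J^1,\dots,\mathbb J^k)$. 2. Each $M_a$ has a reduced space $(\overline M_a,\overline\Omega^a,\overline\lambda^a)$ at $\nu_a$, every such reduced space is a cosymplectic manifold, and $\overline M=\overline M_1\times\dots\times\overline M_k$ with $\overline\omega^a=\overline{\mathrm{pr}}_a^*\overline\Omega^a$, $\overline\eta^a=\overline{\mathrm{pr}}_a^*\overline\lambda^a$ is a $k$-polycosymplectic manifold. 3. $M$ has a reduced space $(M_\mu,\omega^a_\mu,\eta^a_\mu)$ at $\mu$, and every such reduced space is a $k$-polycosymplectic manifold. 4. For all such reduced spaces there is a diffeomorphism $\varphi:M_\mu\to\overline M_1\times\dots\times\overline M_k$ such that $\varphi(\pi_\mu(x))=(\pi_1(x_1),\dots,\pi_k(x_k))$ for all $x\in\mathbb J^{-1}(\mu)$, where $\pi_a:(J^a)^{-1}(\nu_a)\to\overline M_a$ is the projection, and $\varphi^*\overline\omega^a=\omega^a_\mu$, $\varphi^*\overline\eta^a=\eta^a_\mu$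 for every $a$. -/

import Mathlib

open scoped Manifold ContDiff

noncomputable section

namespace Polycosymplectic

/-! ### Differential forms on manifolds -/

section Forms

variable {E : Type*} [NormedAddCommGroup E] [NormedSpace ℝ E] {H : Type*} [TopologicalSpace H]
  {E' : Type*} [NormedAddCommGroup E'] [NormedSpace ℝ E'] {H' : Type*} [TopologicalSpace H']

/-- A (not necessarily smooth) differential form of degree `n` on `M`. -/
abbrev Form (I : ModelWithCorners ℝ E H) (M : Type*) [TopologicalSpace M] [ChartedSpace H M]
    (n : ℕ) : Type _ :=
  ∀ x : M, TangentSpace I x [⋀^Fin n]→L[ℝ] ℝ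

variable {I : ModelWithCorners ℝ E H} {M : Type*} [TopologicalSpace M] [ChartedSpace H M]
  {I' : ModelWithCorners ℝ E' H'} {N : Type*} [TopologicalSpace N] [ChartedSpace H' N] {n : ℕ}

/-- The pullback `f^* α` of a form along a map `f : N → M`. -/
def Form.pullback (f : N → M) (α : Form I M n) : Form I' N n :=
  fun x => (α (f x)).compContinuousLinearMap (mfderiv I' I f x)

/-- The coordinate expression of a form in the preferred chart at `x₀`: its pullback along the
inverse of the chart, a form on the model vector space. -/
def Form.inChart (α : Form I M n) (x₀ : M) : E → E [⋀^Fin n]→L[ℝ] ℝ :=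
  fun y => (α ((extChartAt I x₀).symm y)).compContinuousLinearMap
    (mfderivWithin 𝓘(ℝ, E) I (extChartAt I x₀).symm (Set.range I) y)

/-- A form is smooth if all its coordinate expressions are smooth. -/
def Form.IsSmooth (α : Form I M n) : Prop :=
  ∀ x₀ : M, ContDiffOn ℝ ∞ (α.inChart x₀) (extChartAt I x₀).target

/-- A form is closed if the exterior derivative of all its coordinate expressions vanishes. -/
def Form.IsClosed (α : Form I M n) : Prop :=
  ∀ x₀ : M, ∀ y ∈ (extChartAt I x₀).target,
    extDerivWithin (α.inChart x₀) (Set.range I) y = 0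

end Forms

/-! ### Linear algebra -/

section LinearAlgebra

variable {V : Type*} [AddCommGroup V] [Module ℝ V] [TopologicalSpace V]

/-- The kernel `{v | i_v α = 0}` of an alternating form of positive degree. -/
def formKer {n : ℕ} (α : V [⋀^Fin (n + 1)]→L[ℝ] ℝ) : Submodule ℝ V :=
  LinearMap.ker α.toAlternatingMap.curryLeft

/-- The value `(η¹ ∧ ⋯ ∧ ηᵏ)(v₁, …, v_k) = det (ηᵃ(v_b))` of a wedge product of covectors. -/
def wedgeOneForms {k : ℕ} (η : Fin k → V [⋀^Fin 1]→L[ℝ] ℝ) (v : Fin k → V) : ℝ :=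
  Matrix.det (Matrix.of fun a b : Fin k => η a ![v b])

/-- The value on `(v₀, …, v_{2n})` of the form `l ∧ Ω ∧ ⋯ ∧ Ω` of degree `2 n + 1`
(with `n` factors `Ω`). -/
def wedgePow (l : V [⋀^Fin 1]→L[ℝ] ℝ) (Ω : V [⋀^Fin 2]→L[ℝ] ℝ) (n : ℕ)
    (v : Fin (2 * n + 1) → V) : ℝ :=
  (1 / 2 ^ n) * ∑ σ : Equiv.Perm (Fin (2 * n + 1)), ((Equiv.Perm.sign σ : ℤ) : ℝ) *
    (l ![v (σ 0)] * ∏ i : Fin n,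
      Ω ![v (σ ⟨2 * i.1 + 1, by omega⟩), v (σ ⟨2 * i.1 + 2, by omega⟩)])

end LinearAlgebra

/-! ### Cosymplectic and polycosymplectic structures -/

section Structures

variable {E : Type*} [NormedAddCommGroup E] [NormedSpace ℝ E] {H : Type*} [TopologicalSpace H]
  {I : ModelWithCorners ℝ E H} {M : Type*} [TopologicalSpace M] [ChartedSpace H M]

/-- `(Ω, l)` is a cosymplectic structure on `M`: both forms are closed, `M` has odd dimension
`2 n + 1`, and `l ∧ Ωⁿ` is a volume form. -/
structure IsCosymplectic (Ω : Form I M 2) (l : Form I M 1) : Prop where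
  smooth_two : Ω.IsSmooth
  smooth_one : l.IsSmooth
  closed_two : Ω.IsClosed
  closed_one : l.IsClosed
  volume : ∀ x : M, ∃ n : ℕ, Module.finrank ℝ (TangentSpace I x) = 2 * n + 1 ∧
    ∃ v : Fin (2 * n + 1) → TangentSpace I x, wedgePow (l x) (Ω x) n v ≠ 0

/-- `(ω¹, …, ωᵏ, η¹, …, ηᵏ)` is a `k`-polycosymplectic structure on `M`. -/
structure IsPolycosymplectic {k : ℕ} (w : Fin k → Form I M 2) (η : Fin k → Form I M 1) :
    Prop where
  smooth_two : ∀ a, (w a).IsSmooth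
  smooth_one : ∀ a, (η a).IsSmooth
  closed_two : ∀ a, (w a).IsClosed
  closed_one : ∀ a, (η a).IsClosed
  wedge_ne_zero : ∀ x : M, ∃ v : Fin k → TangentSpace I x, wedgeOneForms (fun a => η a x) v ≠ 0
  ker_inf_ker : ∀ x : M, (⨅ a, formKer (w a x)) ⊓ (⨅ a, formKer (η a x)) = ⊥
  finrank_ker : ∀ x : M,
    Module.finrank ℝ (⨅ a, formKer (w a x) : Submodule ℝ (TangentSpace I x)) = k

end Structures

/-! ### Lie group actions and momentum maps

The Lie algebra of a Lie group `G` modelled on the vector space `EG` is the tangent space at `1`,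
which as a vector space is `EG`; its dual is `EG →L[ℝ] ℝ`. -/

section Actions

variable {EG : Type*} [NormedAddCommGroup EG] [NormedSpace ℝ EG]
  {HG : Type*} [TopologicalSpace HG] (IG : ModelWithCorners ℝ EG HG)
  {G : Type*} [TopologicalSpace G] [ChartedSpace HG G] [Group G]
  {E : Type*} [NormedAddCommGroup E] [NormedSpace ℝ E] {H : Type*} [TopologicalSpace H]
  (I : ModelWithCorners ℝ E H) {M : Type*} [TopologicalSpace M] [ChartedSpace H M]
  [MulAction G M]

/-- The adjoint map `Ad_g`, the derivative at `1` of `h ↦ g h g⁻¹`. -/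
def Ad (g : G) : EG →L[ℝ] EG :=
  mfderiv IG IG (fun h : G => g * h * g⁻¹) 1

/-- The coadjoint action `Ad^*_{g⁻¹} ν = ν ∘ Ad_{g⁻¹}`. -/
def coAd (g : G) (ν : EG →L[ℝ] ℝ) : EG →L[ℝ] ℝ :=
  ν.comp (Ad IG g⁻¹)

variable (G) in
/-- The value at `x` of the infinitesimal generator `ξ_M`, the derivative at `1` of the orbit map
`g ↦ g • x` applied to `ξ`. -/
def generator (ξ : EG) (x : M) : TangentSpace I x :=
  (mfderiv IG I (fun g : G => g • x) 1 : EG →L[ℝ] E) ξ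

variable {I}
variable (G)

/-- A polycosymplectic action: `Φ_g^* ωᵃ = ωᵃ` and `i_{ξ_M} ηᵃ = 0`. -/
structure IsPolycosymplecticAction {k : ℕ} (w : Fin k → Form I M 2) (η : Fin k → Form I M 1) :
    Prop where
  pullback_eq : ∀ (g : G) (a : Fin k), (w a).pullback (I' := I) (fun x : M => g • x) = w a
  generator_eq_zero : ∀ (ξ : EG) (a : Fin k) (x : M), η a x ![generator IG G I ξ x] = 0

/-- A (smooth) momentum map `J = (J¹, …, Jᵏ) : M → 𝔤^* × ⋯ × 𝔤^*`: one has
`i_{ξ_M} ωᵃ = d⟨Jᵃ, ξ⟩`. -/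
structure IsMomentumMap {k : ℕ} (w : Fin k → Form I M 2) (J : Fin k → M → (EG →L[ℝ] ℝ)) :
    Prop where
  contMDiff : ∀ a, ContMDiff I 𝓘(ℝ, EG →L[ℝ] ℝ) ∞ (J a)
  contract : ∀ (a : Fin k) (ξ : EG) (x : M) (v : TangentSpace I x),
    w a x ![generator IG G I ξ x, v] = mfderiv I 𝓘(ℝ, ℝ) (fun y : M => J a y ξ) x v

/-- A smooth, free and proper polycosymplectic action of `G` with momentum map `J` which is
equivariant for the `k`-coadjoint action. -/
structure IsHamiltonianAction {k : ℕ} (w : Fin k → Form I M 2) (η : Fin k → Form I M 1)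
    (J : Fin k → M → (EG →L[ℝ] ℝ)) : Prop where
  smooth : ContMDiffSMul IG I ∞ G M
  free : ∀ (g : G) (x : M), g • x = x → g = 1
  proper : ProperSMul G M
  action : IsPolycosymplecticAction IG G w η
  momentum : IsMomentumMap IG G w J
  equivariant : ∀ (g : G) (a : Fin k) (x : M), J a (g • x) = coAd IG g (J a x)

end Actions

/-- `y` is a regular value of `f`. -/
def IsRegularValue {E : Type*} [NormedAddCommGroup E] [NormedSpace ℝ E]
    {H : Type*} [TopologicalSpace H] (I : ModelWithCorners ℝ E H)
    {M : Type*} [TopologicalSpace M] [ChartedSpace H M]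
    {F : Type*} [NormedAddCommGroup F] [NormedSpace ℝ F] (f : M → F) (y : F) : Prop :=
  ∀ x : M, f x = y → Function.Surjective (mfderiv I 𝓘(ℝ, F) f x)

/-! ### Reduced spaces -/

section Reduction

variable {EG : Type*} [NormedAddCommGroup EG] [NormedSpace ℝ EG]
  {HG : Type*} [TopologicalSpace HG] (IG : ModelWithCorners ℝ EG HG)
  (G : Type*) [TopologicalSpace G] [ChartedSpace HG G] [Group G]
  {E : Type*} [NormedAddCommGroup E] [NormedSpace ℝ E] {H : Type*} [TopologicalSpace H]
  {I : ModelWithCorners ℝ E H} {M : Type*} [TopologicalSpace M] [ChartedSpace H M]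
  [MulAction G M] {k : ℕ}

/-- The level set `J⁻¹(μ)`, with the subspace topology. -/
abbrev LevelSet {F M : Type*} {k : ℕ} (J : Fin k → M → F) (μ : Fin k → F) : Type _ :=
  {x : M // ∀ a, J a x = μ a}

/-- The isotropy group `G_μ` of `μ` for the `k`-coadjoint action (as a subset of `G`). -/
def isotropy (μ : Fin k → (EG →L[ℝ] ℝ)) : Set G :=
  {g | ∀ a, coAd IG g (μ a) = μ a}

/-- Two points of `J⁻¹(μ)` are related if they lie in the same `G_μ`-orbit. -/
def orbitRel (J : Fin k → M → (EG →L[ℝ] ℝ)) (μ : Fin k → (EG →L[ℝ] ℝ)) (x y : LevelSet J μ) :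
    Prop :=
  ∃ g ∈ isotropy IG G μ, g • x.1 = y.1

/-- The topological space `M_μ = J⁻¹(μ) / G_μ`, with the quotient topology. -/
abbrev OrbitSpace (J : Fin k → M → (EG →L[ℝ] ℝ)) (μ : Fin k → (EG →L[ℝ] ℝ)) : Type _ :=
  Quot (orbitRel IG G J μ)

/-- The data of a reduction at `μ`: smooth (finite-dimensional, Hausdorff, second countable)
manifold structures on `J⁻¹(μ)` and on `M_μ = J⁻¹(μ) / G_μ`, compatible with their topologies, such
that the inclusion `j_μ : J⁻¹(μ) → M` is an embedding and the projection `π_μ : J⁻¹(μ) → M_μ` is a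
submersion, and forms on `M_μ` with `π_μ^* ω_μ = j_μ^* ω` and `π_μ^* η_μ = j_μ^* η`. -/
structure ReducedSpace (w : Fin k → Form I M 2) (η : Fin k → Form I M 1)
    (J : Fin k → M → (EG →L[ℝ] ℝ)) (μ : Fin k → (EG →L[ℝ] ℝ)) where
  dimLevel : ℕ
  dim : ℕ
  [chartedLevel : ChartedSpace (EuclideanSpace ℝ (Fin dimLevel)) (LevelSet J μ)]
  [isManifoldLevel : IsManifold 𝓘(ℝ, EuclideanSpace ℝ (Fin dimLevel)) ∞ (LevelSet J μ)]
  [charted : ChartedSpace (EuclideanSpace ℝ (Fin dim)) (OrbitSpace IG G J μ)]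
  [isManifold : IsManifold 𝓘(ℝ, EuclideanSpace ℝ (Fin dim)) ∞ (OrbitSpace IG G J μ)]
  [t2Space : T2Space (OrbitSpace IG G J μ)]
  [secondCountable : SecondCountableTopology (OrbitSpace IG G J μ)]
  embedding : Manifold.IsSmoothEmbedding 𝓘(ℝ, EuclideanSpace ℝ (Fin dimLevel)) I ∞
    (Subtype.val : LevelSet J μ → M)
  submersion : Manifold.IsSubmersion 𝓘(ℝ, EuclideanSpace ℝ (Fin dimLevel))
    𝓘(ℝ, EuclideanSpace ℝ (Fin dim)) ∞ (Quot.mk (orbitRel IG G J μ))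
  twoForm : Fin k → Form 𝓘(ℝ, EuclideanSpace ℝ (Fin dim)) (OrbitSpace IG G J μ) 2
  oneForm : Fin k → Form 𝓘(ℝ, EuclideanSpace ℝ (Fin dim)) (OrbitSpace IG G J μ) 1
  pullback_twoForm : ∀ a,
    (twoForm a).pullback (I' := 𝓘(ℝ, EuclideanSpace ℝ (Fin dimLevel)))
        (Quot.mk (orbitRel IG G J μ)) =
      (w a).pullback (Subtype.val : LevelSet J μ → M)
  pullback_oneForm : ∀ a,
    (oneForm a).pullback (I' := 𝓘(ℝ, EuclideanSpace ℝ (Fin dimLevel)))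
        (Quot.mk (orbitRel IG G J μ)) =
      (η a).pullback (Subtype.val : LevelSet J μ → M)

namespace ReducedSpace

variable {IG G} {w : Fin k → Form I M 2} {η : Fin k → Form I M 1}
  {J : Fin k → M → (EG →L[ℝ] ℝ)} {μ : Fin k → (EG →L[ℝ] ℝ)}

/-- The space `M_μ` with the manifold structure given by `R`. -/
def Carrier (_R : ReducedSpace IG G w η J μ) : Type _ :=
  OrbitSpace IG G J μ

instance (R : ReducedSpace IG G w η J μ) : TopologicalSpace R.Carrier :=
  inferInstanceAs (TopologicalSpace (OrbitSpace IG G J μ))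

instance (R : ReducedSpace IG G w η J μ) :
    ChartedSpace (EuclideanSpace ℝ (Fin R.dim)) R.Carrier :=
  R.charted

/-- The model of the manifold `M_μ`. -/
abbrev model (R : ReducedSpace IG G w η J μ) :
    ModelWithCorners ℝ (EuclideanSpace ℝ (Fin R.dim)) (EuclideanSpace ℝ (Fin R.dim)) :=
  𝓘(ℝ, EuclideanSpace ℝ (Fin R.dim))

/-- The projection `π_μ : J⁻¹(μ) → M_μ`. -/
def proj (R : ReducedSpace IG G w η J μ) (x : LevelSet J μ) : R.Carrier :=
  Quot.mk (orbitRel IG G J μ) x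

/-- The reduced two-forms `ω_μ`. -/
def omega (R : ReducedSpace IG G w η J μ) (a : Fin k) : Form R.model R.Carrier 2 :=
  R.twoForm a

/-- The reduced one-forms `η_μ`. -/
def eta (R : ReducedSpace IG G w η J μ) (a : Fin k) : Form R.model R.Carrier 1 :=
  R.oneForm a

end ReducedSpace

end Reduction

/-! ### Products -/

section Products

variable {k : ℕ} {E : Fin k → Type*} [∀ a, NormedAddCommGroup (E a)] [∀ a, NormedSpace ℝ (E a)]
  {H : Fin k → Type*} [∀ a, TopologicalSpace (H a)] {I : ∀ a, ModelWithCorners ℝ (E a) (H a)}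
  {M : Fin k → Type*} [∀ a, TopologicalSpace (M a)] [∀ a, ChartedSpace (H a) (M a)]
  {F : Fin k → Type*} [∀ a, NormedAddCommGroup (F a)] [∀ a, NormedSpace ℝ (F a)]

/-- The form `pr_a^* αᵃ` on the product `M₁ × ⋯ × M_k`. -/
def prodForm {n : ℕ} (α : ∀ a, Form (I a) (M a) n) (a : Fin k) :
    Form (ModelWithCorners.pi I) (∀ b, M b) n :=
  (α a).pullback (fun x : ∀ b, M b => x a)

/-- The element `(0, …, ν_a, …, 0)` of `𝔤^* = 𝔤₁^* × ⋯ × 𝔤_k^*`, with `ν_a` in position `a`,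
i.e. the covector `(ξ₁, …, ξ_k) ↦ ⟨ν_a, ξ_a⟩`. -/
def prodCovector (ν : ∀ a, F a →L[ℝ] ℝ) (a : Fin k) : (∀ b, F b) →L[ℝ] ℝ :=
  (ν a).comp (ContinuousLinearMap.proj a)

/-- The momentum map of the product, `x ↦ (0, …, Jᵃ(x_a), …, 0)` in its `a`-th component. -/
def prodMomentum (J : ∀ a, M a → (F a →L[ℝ] ℝ)) (a : Fin k) (x : ∀ b, M b) :
    (∀ b, F b) →L[ℝ] ℝ :=
  prodCovector (fun b => J b (x b)) a

/-- The point of `(J¹)⁻¹(ν₁) × ⋯ × (Jᵏ)⁻¹(ν_k)` given by a point in the level set of the product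
momentum map. -/
def LevelSet.component {J : ∀ a, M a → (F a →L[ℝ] ℝ)} {ν : ∀ a, F a →L[ℝ] ℝ}
    (x : LevelSet (prodMomentum J) (prodCovector ν)) (a : Fin k) :
    LevelSet (fun _ : Fin 1 => J a) (fun _ => ν a) :=
  ⟨x.1 a, fun _ => by
    ext ξ
    have h := congrArg (fun l : (∀ b, F b) →L[ℝ] ℝ => l (Pi.single a ξ)) (x.2 a)
    simpa [prodMomentum, prodCovector] using h⟩

end Products

end Polycosymplectic

end

noncomputable section

namespace Polycosymplectic

open Set Filter Topology

/-! ### Finite products of manifolds -/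

section PiManifold

variable {ι : Type*} [Fintype ι] {E : ι → Type*} [∀ a, NormedAddCommGroup (E a)]
  [∀ a, NormedSpace ℝ (E a)] {H : ι → Type*} [∀ a, TopologicalSpace (H a)]
  {I : ∀ a, ModelWithCorners ℝ (E a) (H a)}
  {M : ι → Type*} [∀ a, TopologicalSpace (M a)] [∀ a, ChartedSpace (H a) (M a)]
  {E' : Type*} [NormedAddCommGroup E'] [NormedSpace ℝ E'] {H' : Type*} [TopologicalSpace H']
  {I' : ModelWithCorners ℝ E' H'} {N : Type*} [TopologicalSpace N] [ChartedSpace H' N]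
  {n : ℕ∞ω}

/-! The statement is Marsden–Weinstein reduction for one cosymplectic factor, together with the
remark that everything attached to the product splits: the level set of the product momentum map is
the product of the level sets, orbits in it are products of orbits, and the `a`-th forms see only
the `a`-th component.

One factor. The identity `i_ξ Ω = d⟨J, ξ⟩` makes `dJ` the transpose of the infinitesimal action, so
the latter is injective over a regular value (`injective_orbitDeriv`). The level set is a
submanifold with tangent space `ker dJ` (`exists_manifold_levelSet`, `range_mfderiv_levelSet`). The
isotropy group is never made into a Lie group. By equivariance, points of the level set in one
`G`-orbit already lie in one orbit of the isotropy group (`orbitRel_iff`), so a slice for the free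
and proper action of all of `G` (`exists_slice`) can be restricted to the level set. The restriction
has constant rank, because its kernels have the dimension of the infinitesimal isotropy of `ν`
(`finrank_orbitTangent`). The constant rank theorem (`exists_factorization_of_constant_rank`) then
yields submersions whose fibres are locally the orbits (`exists_levelSet_slice`), and these are the
charts of the orbit space (`exists_manifold_orbitSpace`).

Reduced forms. `Ω` descends since it is invariant and its contraction with orbit directions vanishes
on `ker dJ`. The one-form is only assumed to vanish on generators; being closed, it is invariant
because `G` is connected (`Form.pullback_smul_eq`). Smoothness and closedness descend through local
sections of the projection (`Form.SmoothClosedAt.of_pullback`). Pointwise, the volume condition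
amounts to `ker Ω ∩ ker λ = 0` together with a Reeb vector, by way of symplectic bases
(`exists_reeb`, `exists_wedgePow_ne_zero`). The Reeb vector is tangent to the level set, and a
double orthogonal argument (`mem_of_orthogonal_orthogonal`) excludes a common kernel after reduction
(`isCosymplectic_reduced`).

Products. The Reeb vectors of the factors form a basis of the common kernel of the two-forms, dual
to the one-forms (`isPolycosymplectic_prodForm`). The orbit space of the product is homeomorphic to
the product of the orbit spaces (`exists_orbitSpaceHomeomorph`). Transport along this homeomorphism
constructs one reduced space. For arbitrary reduced spaces it is a diffeomorphism matching the forms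
(`exists_reducedSpaceDiffeomorph`), since embeddings determine the structures on level sets and
submersions those on quotients. Hence no separate polycosymplectic reduction theorem is needed: the
structure on the reduced product is pulled back from the product of the reduced factors. -/

theorem range_modelPi (I : ∀ a, ModelWithCorners ℝ (E a) (H a)) :
    range (ModelWithCorners.pi I) = univ.pi fun a => range (I a) := by
  have : (ModelWithCorners.pi I : ModelPi H → ∀ a, E a) = Pi.map fun a => I a := rfl
  rw [this]
  exact Set.range_piMap _

instance boundaryless_pi [∀ a, (I a).Boundaryless] : (ModelWithCorners.pi I).Boundaryless :=
  ⟨by rw [range_modelPi]; simp [ModelWithCorners.range_eq_univ]⟩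

/-- Both directions agree by definition and only the sources need an argument. This is what reduces
questions about maps into a product to components. -/
theorem extChartAt_pi (x : ∀ a, M a) :
    extChartAt (ModelWithCorners.pi I) x = PartialEquiv.pi fun a => extChartAt (I a) (x a) := by
  refine PartialEquiv.ext (fun y => rfl) (fun y => rfl) ?_
  ext y
  simp only [extChartAt_source, piChartedSpace_chartAt]
  simp [PartialEquiv.pi, OpenPartialHomeomorph.pi]

theorem contMDiffWithinAt_pi {f : N → ∀ a, M a} {s : Set N} {x : N} :
    ContMDiffWithinAt I' (ModelWithCorners.pi I) n f s x ↔
      ∀ a, ContMDiffWithinAt I' (I a) n (fun y => f y a) s x := by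
  simp only [contMDiffWithinAt_iff, continuousWithinAt_pi, forall_and]
  refine and_congr Iff.rfl ?_
  rw [contDiffWithinAt_pi]
  simp only [extChartAt_pi]
  rfl

theorem contMDiffAt_pi {f : N → ∀ a, M a} {x : N} :
    ContMDiffAt I' (ModelWithCorners.pi I) n f x ↔
      ∀ a, ContMDiffAt I' (I a) n (fun y => f y a) x :=
  contMDiffWithinAt_pi

theorem contMDiff_pi {f : N → ∀ a, M a} :
    ContMDiff I' (ModelWithCorners.pi I) n f ↔ ∀ a, ContMDiff I' (I a) n (fun y => f y a) :=
  ⟨fun h a x => contMDiffAt_pi.1 (h x) a, fun h x => contMDiffAt_pi.2 fun a => h a x⟩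

theorem contMDiff_apply (a : ι) :
    ContMDiff (ModelWithCorners.pi I) (I a) n (fun x : ∀ b, M b => x a) := by
  intro x
  have h := contMDiffAt_id (I := ModelWithCorners.pi I) (n := n) (x := x)
  exact contMDiffAt_pi.1 h a

/-- In product charts the projection is the linear projection on the chart target, where the chart
and its inverse cancel. -/
theorem hasMFDerivAt_apply (a : ι) (x : ∀ b, M b) :
    HasMFDerivAt (ModelWithCorners.pi I) (I a) (fun x : ∀ b, M b => x a) x
      (ContinuousLinearMap.proj a : (∀ b, E b) →L[ℝ] E a) := by
  refine ⟨(continuous_apply a).continuousAt, ?_⟩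
  have h : HasFDerivWithinAt (fun y : ∀ b, E b => y a)
      (ContinuousLinearMap.proj a : (∀ b, E b) →L[ℝ] E a) (range (ModelWithCorners.pi I))
      (extChartAt (ModelWithCorners.pi I) x x) :=
    (ContinuousLinearMap.proj (R := ℝ) (φ := E) a).hasFDerivAt.hasFDerivWithinAt
  have hmem : (extChartAt (ModelWithCorners.pi I) x).target ∈
      𝓝[range (ModelWithCorners.pi I)] (extChartAt (ModelWithCorners.pi I) x x) :=
    extChartAt_target_mem_nhdsWithin x
  refine h.congr_of_eventuallyEq ?_ ?_
  · filter_upwards [hmem] with y hy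
    rw [extChartAt_pi] at hy
    have hy' : y a ∈ (extChartAt (I a) (x a)).target := by
      have : y ∈ univ.pi fun b => (extChartAt (I b) (x b)).target := hy
      exact this a (mem_univ a)
    exact (extChartAt (I a) (x a)).right_inv hy'
  · have : (extChartAt (I a) (x a)).symm (extChartAt (I a) (x a) (x a)) = x a :=
      (extChartAt (I a) (x a)).left_inv (mem_extChartAt_source (x a))
    change extChartAt (I a) (x a) ((extChartAt (I a) (x a)).symm (extChartAt (I a) (x a) (x a)))
      = extChartAt (I a) (x a) (x a)
    rw [this]

theorem mfderiv_apply (a : ι) (x : ∀ b, M b) :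
    mfderiv (ModelWithCorners.pi I) (I a) (fun x : ∀ b, M b => x a) x =
      (ContinuousLinearMap.proj a : (∀ b, E b) →L[ℝ] E a) :=
  (hasMFDerivAt_apply a x).mfderiv

theorem mdifferentiableAt_pi {f : N → ∀ a, M a} {x : N} :
    MDifferentiableAt I' (ModelWithCorners.pi I) f x ↔
      ∀ a, MDifferentiableAt I' (I a) (fun y => f y a) x := by
  simp only [mdifferentiableAt_iff, continuousAt_pi, forall_and]
  refine and_congr Iff.rfl ?_
  rw [← differentiableWithinAt_pi]
  simp only [writtenInExtChartAt, extChartAt_pi]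
  rfl

/-- The components of the derivative of a map into a product. -/
theorem mfderiv_pi_apply {f : N → ∀ a, M a} {x : N}
    (hf : MDifferentiableAt I' (ModelWithCorners.pi I) f x) (v : TangentSpace I' x) (a : ι) :
    (mfderiv I' (ModelWithCorners.pi I) f x v : ∀ a, E a) a =
      mfderiv I' (I a) (fun y => f y a) x v := by
  have h : mfderiv I' (I a) (fun y => f y a) x =
      (mfderiv (ModelWithCorners.pi I) (I a) (fun x : ∀ b, M b => x a) (f x)).comp
        (mfderiv I' (ModelWithCorners.pi I) f x) :=
    mfderiv_comp x (hasMFDerivAt_apply a (f x)).mdifferentiableAt hf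
  rw [h, mfderiv_apply]
  rfl

/-- Charts in the atlas are families of charts, so each component of a transition map is a
transition map of one factor composed with a linear projection. -/
instance isManifold_pi [∀ a, IsManifold (I a) n (M a)] :
    IsManifold (ModelWithCorners.pi I) n (∀ a, M a) := by
  refine isManifold_of_contDiffOn _ _ _ ?_
  rintro _ _ ⟨c, hc, rfl⟩ ⟨d, hd, rfl⟩
  rw [contDiffOn_pi]
  intro a
  have h := (contDiffGroupoid n (I a)).compatible (hc a (mem_univ a)) (hd a (mem_univ a))
  rw [contDiffGroupoid, mem_groupoid_of_pregroupoid] at h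
  have hp : ContDiffOn ℝ n (I a ∘ ((c a).symm ≫ₕ d a) ∘ (I a).symm)
      ((I a).symm ⁻¹' ((c a).symm ≫ₕ d a).source ∩ range (I a)) := h.1
  refine hp.comp (t := _) (f := fun y : ∀ b, E b => y a)
    (ContinuousLinearMap.proj (R := ℝ) (φ := E) a).contDiff.contDiffOn ?_
  rintro y ⟨hy1, hy2⟩
  rw [range_modelPi] at hy2
  refine ⟨?_, hy2 a (mem_univ a)⟩
  have h1 : (ModelWithCorners.pi I).symm y ∈ univ.pi fun b => (c b).target := hy1.1
  have h2 : (OpenPartialHomeomorph.pi c).symm ((ModelWithCorners.pi I).symm y) ∈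
    univ.pi fun b => (d b).source := hy1.2
  exact ⟨h1 a (mem_univ a), h2 a (mem_univ a)⟩

theorem lieGroup_pi {G : ι → Type*} [∀ a, TopologicalSpace (G a)] [∀ a, ChartedSpace (H a) (G a)]
    [∀ a, Group (G a)] [∀ a, LieGroup (I a) n (G a)] :
    LieGroup (ModelWithCorners.pi I) n (∀ a, G a) where
  contMDiff_mul := contMDiff_pi.2 fun a =>
    (contMDiff_mul (I a) n (G := G a)).comp
      (((contMDiff_apply a).comp contMDiff_fst).prodMk ((contMDiff_apply a).comp contMDiff_snd))
  contMDiff_inv := contMDiff_pi.2 fun a => (contMDiff_inv (I a) n).comp (contMDiff_apply a)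

variable {EG : ι → Type*} [∀ a, NormedAddCommGroup (EG a)]
  [∀ a, NormedSpace ℝ (EG a)] {HG : ι → Type*} [∀ a, TopologicalSpace (HG a)]
  {IG : ∀ a, ModelWithCorners ℝ (EG a) (HG a)}
  {G : ι → Type*} [∀ a, TopologicalSpace (G a)] [∀ a, ChartedSpace (HG a) (G a)]
  [∀ a, Group (G a)] [∀ a, MulAction (G a) (M a)]

theorem contMDiffSMul_pi (h : ∀ a, ContMDiffSMul (IG a) (I a) n (G a) (M a)) :
    ContMDiffSMul (ModelWithCorners.pi IG) (ModelWithCorners.pi I) n (∀ a, G a) (∀ a, M a) where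
  contMDiff_smul := contMDiff_pi.2 fun a =>
    (h a).contMDiff_smul.comp
      (((contMDiff_apply a).comp contMDiff_fst).prodMk ((contMDiff_apply a).comp contMDiff_snd))

omit [Fintype ι] in
-- Up to reordering coordinates, `(g, x) ↦ (g • x, x)` on the product is the product of the
-- corresponding proper maps.
theorem properSMul_pi (h : ∀ a, ProperSMul (G a) (M a)) : ProperSMul (∀ a, G a) (∀ a, M a) where
  isProperMap_smul_pair := by
    have h1 := IsProperMap.pi_map fun a => (h a).isProperMap_smul_pair
    let e : ((∀ a, G a) × (∀ a, M a)) ≃ₜ ∀ a, G a × M a :=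
      { toFun := fun p a => (p.1 a, p.2 a)
        invFun := fun p => (fun a => (p a).1, fun a => (p a).2)
        left_inv := fun p => rfl
        right_inv := fun p => rfl
        continuous_toFun := by fun_prop
        continuous_invFun := by fun_prop }
    let e' : ((∀ a, M a) × (∀ a, M a)) ≃ₜ ∀ a, M a × M a :=
      { toFun := fun p a => (p.1 a, p.2 a)
        invFun := fun p => (fun a => (p a).1, fun a => (p a).2)
        left_inv := fun p => rfl
        right_inv := fun p => rfl
        continuous_toFun := by fun_prop
        continuous_invFun := by fun_prop }
    exact e'.symm.isProperMap.comp (h1.comp e.isProperMap)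

end PiManifold

/-! ### Pullback of smooth closed forms -/

section CompContinuousLinearMap

variable {E F : Type*} [NormedAddCommGroup E] [NormedSpace ℝ E] [NormedAddCommGroup F]
  [NormedSpace ℝ F] {n : ℕ}

/-- Alternatization, as a continuous linear map. -/
def alternatizationCLM (E : Type*) [NormedAddCommGroup E] [NormedSpace ℝ E] (n : ℕ) :
    ContinuousMultilinearMap ℝ (fun _ : Fin n => E) ℝ →L[ℝ] E [⋀^Fin n]→L[ℝ] ℝ :=
  LinearMap.mkContinuous
    { toFun := ContinuousMultilinearMap.alternatization
      map_add' := fun f g => map_add _ f g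
      map_smul' := fun c f => by
        ext v
        simp only [ContinuousMultilinearMap.alternatization_apply_apply,
          smul_apply, ContinuousAlternatingMap.smul_apply,
          RingHom.id_apply, Finset.smul_sum]
        exact Finset.sum_congr rfl fun σ _ => smul_comm _ _ _ } (Fintype.card (Equiv.Perm (Fin n)))
    fun f => by
      refine ContinuousAlternatingMap.opNorm_le_bound _ (by positivity) fun v => ?_
      simp only [LinearMap.coe_mk, AddHom.coe_mk,
        ContinuousMultilinearMap.alternatization_apply_apply]
      refine (norm_sum_le _ _).trans ?_
      have : ∀ σ ∈ (Finset.univ : Finset (Equiv.Perm (Fin n))),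
          ‖Equiv.Perm.sign σ • f (v ∘ σ)‖ ≤ ‖f‖ * ∏ i, ‖v i‖ := by
        intro σ _
        have h1 : ‖Equiv.Perm.sign σ • f (v ∘ σ)‖ = ‖f (v ∘ σ)‖ := by
          rcases Int.units_eq_one_or (Equiv.Perm.sign σ) with h | h <;> simp [h]
        rw [h1]
        refine (f.le_opNorm _).trans (le_of_eq ?_)
        congr 1
        exact Equiv.prod_comp σ fun i => ‖v i‖
      refine (Finset.sum_le_card_nsmul _ _ _ this).trans (le_of_eq ?_)
      simp [nsmul_eq_mul, mul_assoc]

theorem alternatizationCLM_coe (f : E [⋀^Fin n]→L[ℝ] ℝ) :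
    alternatizationCLM E n f.toContinuousMultilinearMap = (n.factorial : ℝ) • f := by
  ext v
  have := congrArg (fun g => g v) (AlternatingMap.coe_alternatization f.toAlternatingMap)
  simp only [Fintype.card_fin, AlternatingMap.smul_apply] at this
  rw [ContinuousAlternatingMap.smul_apply, smul_eq_mul, ← nsmul_eq_mul]
  refine Eq.trans ?_ this
  change ContinuousMultilinearMap.alternatization f.toContinuousMultilinearMap v = _
  rw [ContinuousMultilinearMap.alternatization_apply_apply, MultilinearMap.alternatization_apply]
  rfl

/-- For multilinear maps the composition is itself continuous multilinear in the linear maps, hence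
smooth. The alternating case follows by alternatizing and dividing by `n!`, since alternatization
multiplies an alternating map by `n!`. -/
theorem contDiff_compContinuousLinearMap :
    ContDiff ℝ ∞ fun p : (F [⋀^Fin n]→L[ℝ] ℝ) × (E →L[ℝ] F) =>
      p.1.compContinuousLinearMap p.2 := by
  have h1 : ContDiff ℝ ∞ fun p : (F [⋀^Fin n]→L[ℝ] ℝ) × (E →L[ℝ] F) =>
      ContinuousMultilinearMap.compContinuousLinearMapContinuousMultilinear ℝ
        (fun _ : Fin n => E) (fun _ => F) ℝ (fun _ => p.2)
        (ContinuousAlternatingMap.toContinuousMultilinearMapCLM ℝ p.1) := by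
    refine ContDiff.clm_apply ?_ ?_
    · exact (ContinuousMultilinearMap.contDiff _).comp (contDiff_pi.2 fun _ => contDiff_snd)
    · exact (ContinuousLinearMap.contDiff _).comp contDiff_fst
  have h2 := ((alternatizationCLM E n).contDiff.comp h1).const_smul ((n.factorial : ℝ)⁻¹)
  convert h2 using 1
  funext p
  have h3 := alternatizationCLM_coe (p.1.compContinuousLinearMap p.2)
  have h4 : (n.factorial : ℝ) ≠ 0 := by positivity
  calc p.1.compContinuousLinearMap p.2
      = (n.factorial : ℝ)⁻¹ • alternatizationCLM E n
          (p.1.compContinuousLinearMap p.2).toContinuousMultilinearMap := by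
        rw [h3, smul_smul, inv_mul_cancel₀ h4, one_smul]
    _ = _ := rfl

end CompContinuousLinearMap

section FormPullback

variable {E : Type*} [NormedAddCommGroup E] [NormedSpace ℝ E] {H : Type*} [TopologicalSpace H]
  {I : ModelWithCorners ℝ E H} {M : Type*} [TopologicalSpace M] [ChartedSpace H M]
  {E' : Type*} [NormedAddCommGroup E'] [NormedSpace ℝ E'] {H' : Type*} [TopologicalSpace H']
  {I' : ModelWithCorners ℝ E' H'} {N : Type*} [TopologicalSpace N] [ChartedSpace H' N]
  {E'' : Type*} [NormedAddCommGroup E''] [NormedSpace ℝ E'']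
  {H'' : Type*} [TopologicalSpace H'']
  {I'' : ModelWithCorners ℝ E'' H''} {P : Type*} [TopologicalSpace P] [ChartedSpace H'' P]
  {n : ℕ}

theorem Form.pullback_apply (f : N → M) (α : Form I M n) (x : N) (v : Fin n → TangentSpace I' x) :
    (α.pullback (I' := I') f) x v = α (f x) (fun i => mfderiv I' I f x (v i)) :=
  rfl

theorem Form.pullback_comp_apply (α : Form I M n) {f : N → M} {g : P → N} {x : P}
    (hf : MDifferentiableAt I' I f (g x)) (hg : MDifferentiableAt I'' I' g x) :
    (α.pullback (I' := I') f).pullback (I' := I'') g x = α.pullback (f ∘ g) x := by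
  ext v
  simp only [Form.pullback_apply, Function.comp_apply]
  rw [mfderiv_comp x hf hg]
  rfl

theorem Form.pullback_comp (α : Form I M n) {f : N → M} {g : P → N}
    (hf : MDifferentiable I' I f) (hg : MDifferentiable I'' I' g) :
    (α.pullback (I' := I') f).pullback (I' := I'') g = α.pullback (f ∘ g) :=
  funext fun x => α.pullback_comp_apply (hf (g x)) (hg x)

theorem Form.pullback_congr (α : Form I M n) {f g : N → M} {x : N} (h : f =ᶠ[𝓝 x] g) :
    α.pullback (I' := I') f x = α.pullback (I' := I') g x := by
  have hx := h.self_of_nhds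
  have hd : (mfderiv I' I f x : E' →L[ℝ] E) = mfderiv I' I g x := h.mfderiv_eq
  ext v
  change (α (f x) : E [⋀^Fin n]→L[ℝ] ℝ) (fun i => (mfderiv I' I f x : E' →L[ℝ] E) (v i)) =
    (α (g x) : E [⋀^Fin n]→L[ℝ] ℝ) (fun i => (mfderiv I' I g x : E' →L[ℝ] E) (v i))
  rw [hd, hx]

theorem Form.pullback_id (α : Form I M n) : α.pullback (I' := I) (fun x => x) = α := by
  funext x
  ext v
  have : mfderiv I I (fun x : M => x) x = ContinuousLinearMap.id ℝ (TangentSpace I x) := mfderiv_id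
  rw [Form.pullback_apply, this]
  rfl

/-- All coordinate expressions of the form are smooth and closed at the point `z`. -/
def Form.SmoothClosedAt (α : Form I M n) (z : M) : Prop :=
  ∀ x₀ : M, z ∈ (extChartAt I x₀).source →
    ContDiffAt ℝ ∞ (α.inChart x₀) (extChartAt I x₀ z) ∧
      extDeriv (α.inChart x₀) (extChartAt I x₀ z) = 0

variable [I.Boundaryless] [I'.Boundaryless]

/-- Without boundary the chart targets are open, so derivatives within the range of the model are
ordinary derivatives. -/
theorem Form.smoothClosedAt_of_isSmooth_of_isClosed {α : Form I M n} (h : α.IsSmooth)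
    (h' : α.IsClosed) (z : M) : α.SmoothClosedAt z := by
  intro x₀ hz
  have ht : extChartAt I x₀ z ∈ (extChartAt I x₀).target := (extChartAt I x₀).map_source hz
  refine ⟨(h x₀).contDiffAt ((isOpen_extChartAt_target x₀).mem_nhds ht), ?_⟩
  have := h' x₀ _ ht
  rwa [I.range_eq_univ, extDerivWithin_univ] at this

omit [I.Boundaryless] [I'.Boundaryless] in
theorem Form.isSmooth_of_smoothClosedAt {α : Form I M n} (h : ∀ z, α.SmoothClosedAt z) :
    α.IsSmooth := by
  intro x₀ y hy
  have := (h _ x₀ ((extChartAt I x₀).map_target hy)).1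
  rw [(extChartAt I x₀).right_inv hy] at this
  exact this.contDiffWithinAt

theorem Form.isClosed_of_smoothClosedAt {α : Form I M n} (h : ∀ z, α.SmoothClosedAt z) :
    α.IsClosed := by
  intro x₀ y hy
  have := (h _ x₀ ((extChartAt I x₀).map_target hy)).2
  rw [(extChartAt I x₀).right_inv hy] at this
  rwa [I.range_eq_univ, extDerivWithin_univ]

omit [I.Boundaryless] [I'.Boundaryless] in
theorem Form.SmoothClosedAt.congr {α β : Form I M n} {z : M} (h : α.SmoothClosedAt z)
    (hαβ : ∀ᶠ w in 𝓝 z, β w = α w) : β.SmoothClosedAt z := by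
  intro x₀ hz
  have ht : extChartAt I x₀ z ∈ (extChartAt I x₀).target := (extChartAt I x₀).map_source hz
  have hc : ContinuousAt (extChartAt I x₀).symm (extChartAt I x₀ z) :=
    continuousAt_extChartAt_symm'' ht
  have hev : ∀ᶠ y in 𝓝 (extChartAt I x₀ z), β.inChart x₀ y = α.inChart x₀ y := by
    have hh : ∀ᶠ w in 𝓝 ((extChartAt I x₀).symm (extChartAt I x₀ z)), β w = α w := by
      rwa [(extChartAt I x₀).left_inv hz]
    filter_upwards [hc.eventually hh] with y hy
    simp only [Form.inChart, hy]
  exact ⟨(h x₀ hz).1.congr_of_eventuallyEq hev,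
    (Filter.EventuallyEq.extDeriv_eq hev).trans (h x₀ hz).2⟩

variable [IsManifold I ∞ M] [IsManifold I' ∞ N]

/-- Near the point, `ψ.symm ∘ F` and `f ∘ φ.symm` are the same map, with `F` the coordinate
expression of `f`. Comparing the two chain rules identifies the pulled back forms. -/
theorem Form.inChart_pullback (α : Form I M n) {f : N → M} {z : N}
    (hf : ∀ᶠ y in 𝓝 z, ContMDiffAt I' I ∞ f y) {x₀ : N} (hz : z ∈ (extChartAt I' x₀).source) :
    ∀ᶠ y in 𝓝 (extChartAt I' x₀ z), (α.pullback (I' := I') f).inChart x₀ y =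
      (α.inChart (f z) ((extChartAt I (f z) ∘ f ∘ (extChartAt I' x₀).symm) y)).compContinuousLinearMap
        (fderiv ℝ (extChartAt I (f z) ∘ f ∘ (extChartAt I' x₀).symm) y) := by
  have ht : extChartAt I' x₀ z ∈ (extChartAt I' x₀).target := (extChartAt I' x₀).map_source hz
  have hc : ContinuousAt (extChartAt I' x₀).symm (extChartAt I' x₀ z) :=
    continuousAt_extChartAt_symm'' ht
  have hsrc : ∀ᶠ w in 𝓝 z, f w ∈ (extChartAt I (f z)).source :=
    hf.self_of_nhds.continuousAt.eventually (extChartAt_source_mem_nhds (f z))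
  have hev : ∀ᶠ w in 𝓝 ((extChartAt I' x₀).symm (extChartAt I' x₀ z)),
      ContMDiffAt I' I ∞ f w ∧ f w ∈ (extChartAt I (f z)).source := by
    rw [(extChartAt I' x₀).left_inv hz]
    exact hf.and hsrc
  filter_upwards [hc.eventually hev, (isOpen_extChartAt_target x₀).mem_nhds ht,
    eventually_eventually_nhds.2 (hc.eventually hev)] with y hy hyt hyev
  obtain ⟨hfy, hsy⟩ := hy
  set F := extChartAt I (f z) ∘ f ∘ (extChartAt I' x₀).symm with hF
  set ψ := extChartAt I (f z)
  set φ := extChartAt I' x₀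
  have hφd : MDifferentiableAt 𝓘(ℝ, E') I' φ.symm y :=
    ((contMDiffOn_extChartAt_symm x₀ (n := ∞)).contMDiffAt
      ((isOpen_extChartAt_target x₀).mem_nhds hyt)).mdifferentiableAt (by simp)
  have hfd : MDifferentiableAt I' I f (φ.symm y) := hfy.mdifferentiableAt (by simp)
  have hFt : F y ∈ ψ.target := ψ.map_source hsy
  have hψd : MDifferentiableAt 𝓘(ℝ, E) I ψ.symm (F y) :=
    ((contMDiffOn_extChartAt_symm (f z) (n := ∞)).contMDiffAt
      ((isOpen_extChartAt_target (f z)).mem_nhds hFt)).mdifferentiableAt (by simp)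
  have hψs : MDifferentiableAt I 𝓘(ℝ, E) ψ (f (φ.symm y)) :=
    (contMDiffAt_extChartAt' (n := ∞) (by simpa [ψ] using hsy)).mdifferentiableAt (by simp)
  have hFd : MDifferentiableAt 𝓘(ℝ, E') 𝓘(ℝ, E) F y := hψs.comp y (hfd.comp y hφd)
  have heq : ψ.symm ∘ F =ᶠ[𝓝 y] f ∘ φ.symm := by
    filter_upwards [hyev] with w hw
    exact ψ.left_inv hw.2
  have hpt : ψ.symm (F y) = f (φ.symm y) := ψ.left_inv hsy
  have hder : (mfderiv 𝓘(ℝ, E) I ψ.symm (F y) : E →L[ℝ] E).comp (fderiv ℝ F y) =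
      (mfderiv I' I f (φ.symm y) : E' →L[ℝ] E).comp (mfderiv 𝓘(ℝ, E') I' φ.symm y : E' →L[ℝ] E') := by
    have h1 := mfderiv_comp y hψd hFd
    have h2 := mfderiv_comp y hfd hφd
    have h3 : (mfderiv 𝓘(ℝ, E') I (ψ.symm ∘ F) y : E' →L[ℝ] E) =
      mfderiv 𝓘(ℝ, E') I (f ∘ φ.symm) y := heq.mfderiv_eq
    rw [mfderiv_eq_fderiv] at h1
    exact (h1.symm.trans h3).trans h2
  ext v
  have e1 : (α.pullback (I' := I') f).inChart x₀ y v =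
      (α (f (φ.symm y)) : E [⋀^Fin n]→L[ℝ] ℝ) (fun i => ((mfderiv I' I f (φ.symm y) : E' →L[ℝ] E).comp
        (mfderiv 𝓘(ℝ, E') I' φ.symm y : E' →L[ℝ] E')) (v i)) := by
    simp only [Form.inChart, I'.range_eq_univ, mfderivWithin_univ]
    rfl
  have e2 : (α.inChart (f z) (F y)).compContinuousLinearMap (fderiv ℝ F y) v =
      (α (ψ.symm (F y)) : E [⋀^Fin n]→L[ℝ] ℝ) (fun i =>
        ((mfderiv 𝓘(ℝ, E) I ψ.symm (F y) : E →L[ℝ] E).comp (fderiv ℝ F y)) (v i)) := by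
    simp only [Form.inChart, I.range_eq_univ, mfderivWithin_univ]
    rfl
  rw [e1, e2, hder, hpt]
  rfl

/-- Pullbacks of smooth closed forms along smooth maps are smooth and closed. -/
theorem Form.SmoothClosedAt.pullback {α : Form I M n} {f : N → M} {z : N}
    (hf : ∀ᶠ y in 𝓝 z, ContMDiffAt I' I ∞ f y) (hα : α.SmoothClosedAt (f z)) :
    (α.pullback (I' := I') f).SmoothClosedAt z := by
  intro x₀ hz
  have hev := α.inChart_pullback hf hz
  have ht : extChartAt I' x₀ z ∈ (extChartAt I' x₀).target := (extChartAt I' x₀).map_source hz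
  set F := extChartAt I (f z) ∘ f ∘ (extChartAt I' x₀).symm with hF
  have hφ : ContMDiffAt 𝓘(ℝ, E') I' ∞ (extChartAt I' x₀).symm (extChartAt I' x₀ z) :=
    (contMDiffOn_extChartAt_symm x₀).contMDiffAt ((isOpen_extChartAt_target x₀).mem_nhds ht)
  have hpt : (extChartAt I' x₀).symm (extChartAt I' x₀ z) = z := (extChartAt I' x₀).left_inv hz
  have hFs : ContDiffAt ℝ ∞ F (extChartAt I' x₀ z) := by
    rw [← contMDiffAt_iff_contDiffAt]
    refine ContMDiffAt.comp _ (I' := I) ?_ (ContMDiffAt.comp _ (I' := I') ?_ hφ)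
    · simp only [Function.comp_apply, hpt]
      exact contMDiffAt_extChartAt
    · rw [hpt]
      exact hf.self_of_nhds
  have hFz : F (extChartAt I' x₀ z) = extChartAt I (f z) (f z) := by
    simp only [hF, Function.comp_apply, hpt]
  obtain ⟨h1, h2⟩ := hα (f z) (mem_extChartAt_source (f z))
  rw [← hFz] at h1 h2
  constructor
  · refine ContDiffAt.congr_of_eventuallyEq ?_ hev
    have hd : ContDiffAt ℝ ∞ (fderiv ℝ F) (extChartAt I' x₀ z) :=
      hFs.fderiv_right (m := ∞) (by simp)
    exact contDiff_compContinuousLinearMap.comp_contDiffAt _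
      (ContDiffAt.prodMk (h1.comp _ hFs) hd)
  -- In coordinates the exterior derivative commutes with pullback along `F`.
  · rw [Filter.EventuallyEq.extDeriv_eq hev,
      extDeriv_pullback (r := ∞) (h1.differentiableAt (by simp)) hFs
        (by rw [minSmoothness_of_isRCLikeNormedField]; exact WithTop.coe_le_coe.2 le_top), h2]
    rfl

end FormPullback

/-! ### Linear algebra of cosymplectic forms -/

section SymplecticBasis

variable {W : Type*} [AddCommGroup W] [Module ℝ W]

/-- A nondegenerate alternating bilinear form has a symplectic basis. -/
theorem exists_symplectic_family (d : ℕ) : ∀ {W : Type*} [AddCommGroup W] [Module ℝ W]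
    [FiniteDimensional ℝ W] (B : W →ₗ[ℝ] W →ₗ[ℝ] ℝ), (∀ x, B x x = 0) →
    (∀ x, (∀ y, B x y = 0) → x = 0) → Module.finrank ℝ W = d →
    ∃ n, d = 2 * n ∧ ∃ e : Fin n × Bool → W, ∀ p q, B (e p) (e q) =
      if p.1 = q.1 ∧ p.2 ≠ q.2 then (if p.2 then -1 else 1) else 0 := by
  induction d using Nat.strong_induction_on with
  | _ d ih =>
  intro W _ _ _ B halt hnd hd
  have hskew : ∀ x y, B y x = - B x y := fun x y => by
    have := halt (x + y)
    simp only [map_add, LinearMap.add_apply, halt, zero_add, add_zero] at this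
    linarith
  rcases Nat.eq_zero_or_pos d with rfl | hpos
  · exact ⟨0, rfl, fun p => p.1.elim0, fun p => p.1.elim0⟩
  have : Nontrivial W := Module.nontrivial_of_finrank_pos (R := ℝ) (hd ▸ hpos)
  -- Split off a hyperbolic plane spanned by `u` and `w` with `B u w = 1`; `W'` is its orthogonal.
  obtain ⟨u, hu⟩ := exists_ne (0 : W)
  obtain ⟨w₀, hw₀⟩ : ∃ y, B u y ≠ 0 := by
    by_contra! h
    exact hu (hnd u h)
  obtain ⟨w, hw⟩ : ∃ w, B u w = 1 := ⟨(B u w₀)⁻¹ • w₀, by simp [hw₀]⟩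
  have hwu : B w u = -1 := by rw [hskew u w, hw]
  let T : W →ₗ[ℝ] ℝ × ℝ := (B u).prod (B w)
  have hT : Function.Surjective T := fun p => ⟨p.1 • w - p.2 • u, by
    ext <;> simp [T, hw, hwu, halt]⟩
  let W' := LinearMap.ker T
  have hmem : ∀ x, x ∈ W' ↔ B u x = 0 ∧ B w x = 0 := fun x => by
    simp [W', T]
  have hfr : Module.finrank ℝ W' + 2 = d := by
    have := T.finrank_range_add_finrank_ker
    rw [LinearMap.range_eq_top.2 hT, finrank_top, Module.finrank_prod, Module.finrank_self,
      hd] at this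
    change 1 + 1 + Module.finrank ℝ W' = d at this
    omega
  -- This is the projection along the plane. It shows that an element of `W'` orthogonal to `W'` is
  -- orthogonal to everything, so nondegeneracy passes to `W'`.
  have hproj : ∀ x, x - B x w • u + B x u • w ∈ W' := fun x => by
    rw [hmem]
    have h1 := hskew u x
    have h2 := hskew w x
    constructor
    · simp [hw, halt]; linarith
    · simp [hwu, halt]; linarith
  obtain ⟨n, hn, e, he⟩ := ih (Module.finrank ℝ W') (by omega)
    (B.compl₁₂ W'.subtype W'.subtype) (fun x => halt x) (fun x hx => by
      have hx' := (hmem x).1 x.2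
      refine Subtype.ext (hnd x fun y => ?_)
      have h1 : B x (y - B y w • u + B y u • w) = 0 := hx ⟨_, hproj y⟩
      have h2 := hskew u x
      have h3 := hskew w x
      simp only [map_add, map_sub, map_smul, smul_eq_mul] at h1
      rw [h2, h3, hx'.1, hx'.2] at h1
      linarith) rfl
  -- The new pair gets index `0`, with `false` for `u` and `true` for `w`, in accordance with `B u w
  -- = 1`.
  refine ⟨n + 1, by omega, fun p => Fin.cases (if p.2 then w else u) (fun i => e (i, p.2)) p.1, ?_⟩
  have he' : ∀ p, B u (e p) = 0 ∧ B w (e p) = 0 := fun p => (hmem _).1 (e p).2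
  rintro ⟨i, b⟩ ⟨j, c⟩
  refine Fin.cases ?_ (fun i => ?_) i <;> refine Fin.cases ?_ (fun j => ?_) j
  · cases b <;> cases c <;> simp [hw, hwu, halt]
  · have h : (0 : Fin (n + 1)) ≠ j.succ := (Fin.succ_ne_zero j).symm
    cases b <;> simp [he', h]
  · have h1 := hskew u (e (i, b))
    have h2 := hskew w (e (i, b))
    have h3 := he' (i, b)
    have h : i.succ ≠ (0 : Fin (n + 1)) := Fin.succ_ne_zero i
    cases c <;> simp [h1, h2, h3, h]
  · simpa using he (i, b) (j, c)

end SymplecticBasis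

section Wedge

variable {V : Type*} [AddCommGroup V] [Module ℝ V] {n : ℕ}

/-- The multilinear map `l ⊗ B ⊗ ⋯ ⊗ B`. -/
def tensorPow (l : V →ₗ[ℝ] ℝ) (B : V →ₗ[ℝ] V →ₗ[ℝ] ℝ) (n : ℕ) :
    MultilinearMap ℝ (fun _ : Option (Fin n × Bool) => V) ℝ where
  toFun v := l (v none) * ∏ i, B (v (some (i, false))) (v (some (i, true)))
  map_update_add' := by
    intro _ v j x y
    rcases j with _ | ⟨i, b⟩
    · simp [add_mul]
    -- Only the factor with index `i` depends on the slot `(i, b)`.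
    · simp only [← Finset.mul_prod_erase _ _ (Finset.mem_univ i)]
      have hp : ∀ z, ∏ j ∈ Finset.univ.erase i,
          B (Function.update v (some (i, b)) z (some (j, false)))
            (Function.update v (some (i, b)) z (some (j, true))) =
          ∏ j ∈ Finset.univ.erase i, B (v (some (j, false))) (v (some (j, true))) := by
        intro z
        refine Finset.prod_congr rfl fun j hj => ?_
        have : j ≠ i := Finset.ne_of_mem_erase hj
        simp [Function.update_of_ne, this]
      simp only [hp]
      cases b <;> simp <;> ring
  map_update_smul' := by
    intro _ v j c x
    rcases j with _ | ⟨i, b⟩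
    · simp [mul_assoc]
    · simp only [← Finset.mul_prod_erase _ _ (Finset.mem_univ i)]
      have hp : ∀ z, ∏ j ∈ Finset.univ.erase i,
          B (Function.update v (some (i, b)) z (some (j, false)))
            (Function.update v (some (i, b)) z (some (j, true))) =
          ∏ j ∈ Finset.univ.erase i, B (v (some (j, false))) (v (some (j, true))) := by
        intro z
        refine Finset.prod_congr rfl fun j hj => ?_
        have : j ≠ i := Finset.ne_of_mem_erase hj
        simp [Function.update_of_ne, this]
      simp only [hp]
      cases b <;> simp <;> ring

/-- The alternating map `l ∧ B ∧ ⋯ ∧ B`, up to a factor. -/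
def altPow (l : V →ₗ[ℝ] ℝ) (B : V →ₗ[ℝ] V →ₗ[ℝ] ℝ) (n : ℕ) :
    V [⋀^Option (Fin n × Bool)]→ₗ[ℝ] ℝ :=
  MultilinearMap.alternatization (tensorPow l B n)

theorem altPow_apply (l : V →ₗ[ℝ] ℝ) (B : V →ₗ[ℝ] V →ₗ[ℝ] ℝ) (v : Option (Fin n × Bool) → V) :
    altPow l B n v = ∑ σ : Equiv.Perm (Option (Fin n × Bool)), ((Equiv.Perm.sign σ : ℤ) : ℝ) *
      (l (v (σ none)) * ∏ i, B (v (σ (some (i, false)))) (v (σ (some (i, true))))) := by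
  rw [altPow, MultilinearMap.alternatization_apply]
  refine Finset.sum_congr rfl fun σ _ => ?_
  rw [Units.smul_def, zsmul_eq_mul]
  rfl

/-- Whatever the permutation, `u` is fed either to `l` or to one of the factors `B`, so every
summand vanishes. -/
theorem altPow_eq_zero_of_mem {l : V →ₗ[ℝ] ℝ} {B : V →ₗ[ℝ] V →ₗ[ℝ] ℝ} (hB : ∀ x, B x x = 0)
    {u : V} (hu : ∀ y, B u y = 0) (hl : l u = 0) (v : Option (Fin n × Bool) → V)
    {j : Option (Fin n × Bool)} (hj : v j = u) : altPow l B n v = 0 := by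
  have hu' : ∀ y, B y u = 0 := fun y => by
    have := hB (u + y)
    simpa [hB, hu] using this
  rw [altPow_apply]
  refine Finset.sum_eq_zero fun σ _ => ?_
  obtain ⟨i, rfl⟩ := σ.surjective j
  rcases i with _ | ⟨i, b⟩
  · rw [hj, hl]; simp
  · have : ∏ i, B (v (σ (some (i, false)))) (v (σ (some (i, true)))) = 0 := by
      refine Finset.prod_eq_zero (Finset.mem_univ i) ?_
      cases b <;> simp [hj, hu, hu']
    rw [this]; simp

/-- The wedge product vanishes on all tuples of the right length if there is a common kernel. -/
theorem altPow_eq_zero_of_ker [FiniteDimensional ℝ V] {l : V →ₗ[ℝ] ℝ} {B : V →ₗ[ℝ] V →ₗ[ℝ] ℝ}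
    (hB : ∀ x, B x x = 0) {u : V} (hu0 : u ≠ 0) (hu : ∀ y, B u y = 0) (hl : l u = 0)
    (hd : Module.finrank ℝ V = 2 * n + 1) (v : Option (Fin n × Bool) → V) :
    altPow l B n v = 0 := by
  classical
  by_contra hne
  -- A nonzero value makes `v` independent, hence a basis by counting. Replacing by `u` a basis
  -- vector on which `u` has coefficient `c j ≠ 0` multiplies the value by `c j`, yet the result is
  -- zero.
  have hli : LinearIndependent ℝ v := by
    by_contra h
    exact hne (AlternatingMap.map_linearDependent _ v h)
  have hcard : Fintype.card (Option (Fin n × Bool)) = Module.finrank ℝ V := by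
    simp [hd, mul_comm]
  have hspan := hli.span_eq_top_of_card_eq_finrank' hcard
  obtain ⟨c, hc⟩ : ∃ c : Option (Fin n × Bool) → ℝ, ∑ i, c i • v i = u :=
    (Submodule.mem_span_range_iff_exists_fun ℝ).1 (hspan ▸ Submodule.mem_top)
  obtain ⟨j, hj⟩ : ∃ j, c j ≠ 0 := by
    by_contra! h
    exact hu0 (by rw [← hc]; simp [h])
  have h1 : altPow l B n (Function.update v j u) = 0 :=
    altPow_eq_zero_of_mem hB hu hl _ (Function.update_self j u v)
  have h2 : altPow l B n (Function.update v j u) = c j * altPow l B n v := by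
    rw [← hc, AlternatingMap.map_update_sum, Finset.sum_eq_single j]
    · rw [AlternatingMap.map_update_smul, Function.update_eq_self, smul_eq_mul]
    · intro i _ hij
      rw [AlternatingMap.map_update_smul, AlternatingMap.map_update_self _ _ hij.symm, smul_zero]
    · simp
  rw [h1] at h2
  exact mul_ne_zero hj hne h2.symm

/-- The wedge product is positive on a symplectic basis. -/
theorem altPow_pos {l : V →ₗ[ℝ] ℝ} {B : V →ₗ[ℝ] V →ₗ[ℝ] ℝ} {R : V} (hR : l R = 1)
    (hRB : ∀ y, B R y = 0) (hRB' : ∀ y, B y R = 0) {e : Fin n × Bool → V} (hl : ∀ p, l (e p) = 0)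
    (he : ∀ p q, B (e p) (e q) = if p.1 = q.1 ∧ p.2 ≠ q.2 then (if p.2 then -1 else 1) else 0) :
    0 < altPow l B n (fun j => j.elim R e) := by
  rw [altPow_apply]
  -- The identity contributes `1`; every other permutation contributes `0` or `1`.
  refine Finset.sum_pos' (fun σ _ => ?_) ⟨1, Finset.mem_univ _, by simp [hR, he]⟩
  set v : Option (Fin n × Bool) → V := fun j => j.elim R e with hv
  by_cases hz : l (v (σ none)) * ∏ i, B (v (σ (some (i, false)))) (v (σ (some (i, true)))) = 0
  · rw [hz, mul_zero]
  have hl0 : l (v (σ none)) ≠ 0 := left_ne_zero_of_mul hz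
  have hp0 : ∀ i, B (v (σ (some (i, false)))) (v (σ (some (i, true)))) ≠ 0 := fun i =>
    Finset.prod_ne_zero_iff.1 (right_ne_zero_of_mul hz) i (Finset.mem_univ i)
  have hnone : σ none = none := by
    cases h : σ none with
    | none => rfl
    | some p => rw [h] at hl0; exact absurd (hl p) hl0
  -- A nonzero summand forces each pair of slots to be sent to a pair of slots, possibly flipped.
  have hex : ∀ i, ∃ p : Fin n × Bool, σ (some (i, false)) = some p ∧
      σ (some (i, true)) = some (p.1, !p.2) := by
    intro i
    have h := hp0 i
    cases h1 : σ (some (i, false)) with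
    | none => rw [h1] at h; exact absurd (hRB _) h
    | some p =>
      cases h2 : σ (some (i, true)) with
      | none => rw [h2] at h; exact absurd (hRB' _) h
      | some q =>
        rw [h1, h2] at h
        change B (e p) (e q) ≠ 0 at h
        rw [he] at h
        have hpq : p.1 = q.1 ∧ p.2 ≠ q.2 := by
          by_contra hc
          rw [if_neg hc] at h
          exact h rfl
        refine ⟨p, rfl, congrArg some (Prod.ext hpq.1.symm ?_)⟩
        have := hpq.2
        cases hb : p.2 <;> cases hc : q.2 <;> simp_all
  choose p hp1 hp2 using hex
  have hinj : Function.Injective fun i => (p i).1 := by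
    intro i j hij
    by_contra hne
    change (p i).1 = (p j).1 at hij
    by_cases hb : (p i).2 = (p j).2
    · have : σ (some (i, false)) = σ (some (j, false)) := by
        rw [hp1, hp1, Prod.ext hij hb]
      have := σ.injective this
      simp_all
    · have hb' : (p i).2 = !(p j).2 := by
        cases h1 : (p i).2 <;> cases h2 : (p j).2 <;> simp_all
      have : σ (some (i, false)) = σ (some (j, true)) := by
        rw [hp1, hp2, ← hij, ← hb']
      have := σ.injective this
      simp_all
  -- So `σ` fixes `none`, flips inside the pairs by `s` and then permutes the pairs by `ρ`. As `ρ`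
  -- acts on both members of each pair, its sign occurs squared. Each flip changes both the sign of
  -- `σ` and the value of one factor `B`, so the summand is a square.
  let ρ : Equiv.Perm (Fin n) := Equiv.ofBijective _ (Finite.injective_iff_bijective.1 hinj)
  let s : Fin n → Equiv.Perm Bool := fun i => if (p i).2 then Equiv.swap false true else 1
  let τ : Equiv.Perm (Fin n × Bool) :=
    (Equiv.prodCongrLeft fun _ : Bool => ρ) * Equiv.prodCongrRight s
  have hσ : σ = Equiv.optionCongr τ := by
    ext1 j
    rcases j with _ | ⟨i, b⟩
    · simpa using hnone
    · have hτ : τ (i, b) = ((p i).1, s i b) := rfl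
      simp only [Equiv.optionCongr_apply, Option.map_some, hτ]
      cases b
      · rw [hp1]
        cases h : (p i).2 <;> simp [s, h, Prod.ext_iff]
      · rw [hp2]
        cases h : (p i).2 <;> simp [s, h]
  have hsign : Equiv.Perm.sign σ = ∏ i, Equiv.Perm.sign (s i) := by
    rw [hσ, Equiv.optionCongr_sign, Equiv.Perm.sign_mul, Equiv.Perm.sign_prodCongrRight,
      Equiv.Perm.sign_prodCongrLeft]
    simp
  have hval : ∀ i, B (v (σ (some (i, false)))) (v (σ (some (i, true)))) =
      ((Equiv.Perm.sign (s i) : ℤ) : ℝ) := by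
    intro i
    rw [hp1, hp2]
    change B (e _) (e _) = _
    rw [he]
    cases h : (p i).2 <;> simp [s, h]
  have hsq : ((Equiv.Perm.sign σ : ℤ) : ℝ) * ((Equiv.Perm.sign σ : ℤ) : ℝ) = 1 := by
    rcases Int.units_eq_one_or (Equiv.Perm.sign σ) with h | h <;> simp [h]
  have hprod : ∏ i, B (v (σ (some (i, false)))) (v (σ (some (i, true)))) =
      ((Equiv.Perm.sign σ : ℤ) : ℝ) := by
    rw [hsign, Finset.prod_congr rfl fun i _ => hval i]
    simp
  have hlR : l (v (σ none)) = 1 := by rw [hnone]; exact hR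
  rw [hprod, hlR, one_mul, hsq]
  exact zero_le_one

end Wedge

section Cosymplectic

variable {V : Type*} [AddCommGroup V] [Module ℝ V] [TopologicalSpace V] {n : ℕ}

/-- A covector as a linear map. -/
def formLin (l : V [⋀^Fin 1]→L[ℝ] ℝ) : V →ₗ[ℝ] ℝ where
  toFun v := l ![v]
  map_add' x y := l.toAlternatingMap.map_vecCons_add ![] x y
  map_smul' c x := l.toAlternatingMap.map_vecCons_smul ![] c x

theorem formLin_apply (l : V [⋀^Fin 1]→L[ℝ] ℝ) (v : V) : formLin l v = l ![v] := rfl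

theorem twoForm_swap (w : V [⋀^Fin 2]→L[ℝ] ℝ) (u v : V) : w ![u, v] = -w ![v, u] := by
  have h := w.toAlternatingMap.map_swap ![v, u] (i := 0) (j := 1) (by simp)
  have h2 : ![v, u] ∘ Equiv.swap (0 : Fin 2) 1 = ![u, v] := by
    funext i
    fin_cases i <;> simp
  rw [h2] at h
  exact h

theorem twoForm_self (w : V [⋀^Fin 2]→L[ℝ] ℝ) (u : V) : w ![u, u] = 0 := by
  have := twoForm_swap w u u
  linarith

/-- An alternating two-form as a bilinear map. -/
def formBilin (w : V [⋀^Fin 2]→L[ℝ] ℝ) : V →ₗ[ℝ] V →ₗ[ℝ] ℝ :=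
  LinearMap.mk₂ ℝ (fun u v => w ![u, v])
    (fun x y v => w.toAlternatingMap.map_vecCons_add ![v] x y)
    (fun c x v => w.toAlternatingMap.map_vecCons_smul ![v] c x)
    (fun u x y => by
      have := w.toAlternatingMap.map_vecCons_add ![u] x y
      rw [twoForm_swap w u, twoForm_swap w u x, twoForm_swap w u y]
      change w ![x + y, u] = w ![x, u] + w ![y, u] at this
      rw [this]
      ring)
    (fun c u x => by
      have := w.toAlternatingMap.map_vecCons_smul ![u] c x
      rw [twoForm_swap w u, twoForm_swap w u x]
      change w ![c • x, u] = c • w ![x, u] at this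
      rw [this, smul_neg])

theorem formBilin_apply (w : V [⋀^Fin 2]→L[ℝ] ℝ) (u v : V) : formBilin w u v = w ![u, v] := rfl

theorem mem_formKer_two {w : V [⋀^Fin 2]→L[ℝ] ℝ} {u : V} :
    u ∈ formKer w ↔ ∀ v, w ![u, v] = 0 := by
  rw [formKer, LinearMap.mem_ker]
  constructor
  · intro h v
    exact congrArg (fun f : V [⋀^Fin 1]→ₗ[ℝ] ℝ => f ![v]) h
  · intro h
    ext v
    have hv : v = ![v 0] := by
      funext i
      fin_cases i
      rfl
    rw [hv]
    exact h (v 0)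

theorem mem_formKer_one {l : V [⋀^Fin 1]→L[ℝ] ℝ} {u : V} : u ∈ formKer l ↔ l ![u] = 0 := by
  rw [formKer, LinearMap.mem_ker]
  constructor
  · intro h
    exact congrArg (fun f : V [⋀^Fin 0]→ₗ[ℝ] ℝ => f ![]) h
  · intro h
    ext v
    have hv : v = ![] := by
      funext i
      exact i.elim0
    rw [hv]
    exact h

/-- The bijection `none ↦ 0`, `(i, false) ↦ 2 i + 1`, `(i, true) ↦ 2 i + 2`. -/
def pairEquiv (n : ℕ) : Option (Fin n × Bool) ≃ Fin (2 * n + 1) :=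
  Equiv.ofBijective
    (fun j => j.elim 0 fun p => if p.2 then ⟨2 * p.1.1 + 2, by omega⟩ else ⟨2 * p.1.1 + 1, by omega⟩)
    (by
      rw [Fintype.bijective_iff_injective_and_card]
      refine ⟨?_, by simp [mul_comm]⟩
      rintro (_ | ⟨i, b⟩) (_ | ⟨j, c⟩) h
      · rfl
      · cases c <;> simp [Fin.ext_iff] at h
      · cases b <;> simp [Fin.ext_iff] at h
      · cases b <;> cases c <;> simp [Fin.ext_iff] at h ⊢ <;> omega)

/-- Conjugation by `pairEquiv n` is a bijection of the two permutation groups that preserves signs.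
-/
theorem wedgePow_eq_altPow (l : V [⋀^Fin 1]→L[ℝ] ℝ) (w : V [⋀^Fin 2]→L[ℝ] ℝ)
    (v : Fin (2 * n + 1) → V) :
    wedgePow l w n v = 1 / 2 ^ n * altPow (formLin l) (formBilin w) n (v ∘ pairEquiv n) := by
  rw [wedgePow, altPow_apply]
  congr 1
  refine (Equiv.sum_comp (pairEquiv n).permCongr _).symm.trans ?_
  refine Finset.sum_congr rfl fun σ _ => ?_
  rw [Equiv.Perm.sign_permCongr]
  have h0 : (pairEquiv n).symm 0 = none := by
    rw [Equiv.symm_apply_eq]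
    rfl
  have h1 : ∀ i : Fin n, (pairEquiv n).symm ⟨2 * i.1 + 1, by omega⟩ = some (i, false) := fun i => by
    rw [Equiv.symm_apply_eq]
    rfl
  have h2 : ∀ i : Fin n, (pairEquiv n).symm ⟨2 * i.1 + 2, by omega⟩ = some (i, true) := fun i => by
    rw [Equiv.symm_apply_eq]
    rfl
  simp only [Equiv.permCongr_apply, h0, h1, h2]
  rfl

variable [FiniteDimensional ℝ V]

/-- A nonzero vector in both kernels would make the wedge product vanish on all tuples of length
equal to the dimension. -/
theorem formKer_inf_formKer_eq_bot {l : V [⋀^Fin 1]→L[ℝ] ℝ} {w : V [⋀^Fin 2]→L[ℝ] ℝ}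
    (hd : Module.finrank ℝ V = 2 * n + 1) {v : Fin (2 * n + 1) → V} (hv : wedgePow l w n v ≠ 0) :
    formKer w ⊓ formKer l = ⊥ := by
  rw [eq_bot_iff]
  rintro u ⟨hu1, hu2⟩
  by_contra hu0
  rw [SetLike.mem_coe, mem_formKer_two] at hu1
  rw [SetLike.mem_coe, mem_formKer_one] at hu2
  rw [wedgePow_eq_altPow, altPow_eq_zero_of_ker (twoForm_self w) hu0 hu1 hu2 hd, mul_zero] at hv
  exact hv rfl

/-- The Reeb vector of a cosymplectic pair. -/
theorem exists_reeb {l : V [⋀^Fin 1]→L[ℝ] ℝ} {w : V [⋀^Fin 2]→L[ℝ] ℝ}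
    (hd : Module.finrank ℝ V = 2 * n + 1) (h : formKer w ⊓ formKer l = ⊥) :
    ∃ R ∈ formKer w, l ![R] = 1 := by
  -- A nondegenerate two-form would force even dimension.
  obtain ⟨u, hu, hu0⟩ : ∃ u ∈ formKer w, u ≠ 0 := by
    by_contra! hc
    obtain ⟨m, hm, -⟩ := exists_symplectic_family _ (formBilin w) (twoForm_self w)
      (fun x hx => hc x (mem_formKer_two.2 hx)) hd
    omega
  have hlu : l ![u] ≠ 0 := fun hl => hu0 <| by
    have : u ∈ formKer w ⊓ formKer l := ⟨hu, mem_formKer_one.2 hl⟩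
    rwa [h, Submodule.mem_bot] at this
  refine ⟨(l ![u])⁻¹ • u, Submodule.smul_mem _ _ hu, ?_⟩
  change formLin l ((l ![u])⁻¹ • u) = 1
  rw [map_smul, formLin_apply, smul_eq_mul, inv_mul_cancel₀ hlu]

/-- The hyperplane `ker l` is complementary to `R`, and `w` is nondegenerate on it: a vector
orthogonal to `ker l` is also orthogonal to `R`. A symplectic basis of `ker l` completed by `R`
gives a positive value. -/
theorem exists_wedgePow_ne_zero {l : V [⋀^Fin 1]→L[ℝ] ℝ} {w : V [⋀^Fin 2]→L[ℝ] ℝ}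
    (h : formKer w ⊓ formKer l = ⊥) {R : V} (hR : R ∈ formKer w) (hlR : l ![R] = 1) :
    ∃ n : ℕ, Module.finrank ℝ V = 2 * n + 1 ∧ ∃ v : Fin (2 * n + 1) → V, wedgePow l w n v ≠ 0 := by
  rw [mem_formKer_two] at hR
  let W := LinearMap.ker (formLin l)
  have hfr : Module.finrank ℝ V = Module.finrank ℝ W + 1 := by
    have h1 := (formLin l).finrank_range_add_finrank_ker
    have h2 : LinearMap.range (formLin l) = ⊤ := LinearMap.range_eq_top.2 fun c =>
      ⟨c • R, by rw [map_smul, formLin_apply, hlR, smul_eq_mul, mul_one]⟩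
    rw [h2, finrank_top, Module.finrank_self] at h1
    change 1 + Module.finrank ℝ W = _ at h1
    omega
  obtain ⟨n, hn, e, he⟩ := exists_symplectic_family _
    ((formBilin w).compl₁₂ W.subtype W.subtype) (fun x => twoForm_self w x) (fun x hx => by
      refine Subtype.ext ?_
      have : (x : V) ∈ formKer w ⊓ formKer l := by
        refine ⟨mem_formKer_two.2 fun y => ?_, mem_formKer_one.2 x.2⟩
        have hy : y - l ![y] • R ∈ W := by
          rw [LinearMap.mem_ker, map_sub, map_smul, formLin_apply, formLin_apply, hlR]
          simp
        have h1 : formBilin w x (y - l ![y] • R) = 0 := hx ⟨_, hy⟩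
        rw [map_sub, map_smul, formBilin_apply, formBilin_apply, twoForm_swap w _ R, hR] at h1
        simpa using h1
      rwa [h, Submodule.mem_bot] at this) rfl
  refine ⟨n, by omega, (fun j : Option (Fin n × Bool) => j.elim R fun p => (e p : V)) ∘
    (pairEquiv n).symm, ?_⟩
  rw [wedgePow_eq_altPow]
  have hpos : 0 < altPow (formLin l) (formBilin w) n fun j => j.elim R fun p => (e p : V) :=
    altPow_pos hlR hR (fun y => by rw [formBilin_apply, twoForm_swap, hR, neg_zero])
      (fun p => (e p).2) he
  rw [Function.comp_assoc, Equiv.symm_comp_self, Function.comp_id]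
  positivity

/-- If `w` and `l` have no common kernel and `l` vanishes on `O`, then an element of the `w`-orthogonal
`O^w` which is in `ker l` and `w`-orthogonal to `O^w` is in `O`. -/
theorem mem_of_orthogonal_orthogonal {l : V [⋀^Fin 1]→L[ℝ] ℝ} {w : V [⋀^Fin 2]→L[ℝ] ℝ}
    (h : formKer w ⊓ formKer l = ⊥) (O : Submodule ℝ V) (hO : ∀ o ∈ O, l ![o] = 0) {u : V}
    (hu : ∀ v, (∀ o ∈ O, w ![o, v] = 0) → w ![u, v] = 0) (hl : l ![u] = 0) : u ∈ O := by
  -- Adding `l ⊗ l` makes `w` injective into the dual, and changes nothing on vectors killed by `l`,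
  -- such as `u` and the elements of `O`.
  let β : V →ₗ[ℝ] Module.Dual ℝ V := formBilin w + (formLin l).smulRight (formLin l)
  have hβ : ∀ x y, β x y = w ![x, y] + l ![x] * l ![y] := fun x y => rfl
  have hinj : Function.Injective β := by
    rw [injective_iff_map_eq_zero]
    intro x hx
    have h1 : l ![x] = 0 := by
      have := hβ x x
      rw [hx, twoForm_self, LinearMap.zero_apply, zero_add] at this
      exact mul_self_eq_zero.1 this.symm
    have : x ∈ formKer w ⊓ formKer l := by
      refine ⟨mem_formKer_two.2 fun y => ?_, mem_formKer_one.2 h1⟩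
      have := hβ x y
      rw [hx, h1, LinearMap.zero_apply, zero_mul, add_zero] at this
      exact this.symm
    rwa [h, Submodule.mem_bot] at this
  -- In finite dimension the double annihilator of `β(O)` is `β(O)` itself, and injectivity of `β`
  -- then gives `u ∈ O`.
  have hmem : β u ∈ (O.map β).dualCoannihilator.dualAnnihilator := by
    rw [Submodule.mem_dualAnnihilator]
    intro v hv
    rw [Submodule.mem_dualCoannihilator] at hv
    rw [hβ, hl, zero_mul, add_zero]
    refine hu v fun o ho => ?_
    have := hv (β o) (Submodule.mem_map_of_mem ho)
    rwa [hβ, hO o ho, zero_mul, add_zero] at this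
  rw [Subspace.dualCoannihilator_dualAnnihilator_eq] at hmem
  obtain ⟨o, ho, hou⟩ := hmem
  rwa [← hinj hou]

end Cosymplectic

/-! ### The inverse function theorem on manifolds -/

section Linear

variable {E F G : Type*} [NormedAddCommGroup E] [NormedSpace ℝ E] [FiniteDimensional ℝ E]
  [NormedAddCommGroup F] [NormedSpace ℝ F] [FiniteDimensional ℝ F]
  [NormedAddCommGroup G] [NormedSpace ℝ G] [FiniteDimensional ℝ G]

/-- A surjective linear map can be completed to an isomorphism. -/
theorem exists_bijective_prod {T : E →L[ℝ] F} (hT : Function.Surjective T)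
    (hd : Module.finrank ℝ G + Module.finrank ℝ F = Module.finrank ℝ E) :
    ∃ Q : E →L[ℝ] G, Function.Bijective (T.prod Q) := by
  have hr := T.toLinearMap.finrank_range_add_finrank_ker
  rw [LinearMap.range_eq_top.2 hT, finrank_top] at hr
  have hK : Module.finrank ℝ (LinearMap.ker T.toLinearMap) = Module.finrank ℝ G := by omega
  -- `q` is a projection onto `ker T`, which is identified with `G` by dimension; `T` and `q`
  -- together separate vectors.
  obtain ⟨q, hq⟩ := LinearMap.exists_leftInverse_of_injective
    (LinearMap.ker T.toLinearMap).subtype (Submodule.ker_subtype _)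
  let e := LinearEquiv.ofFinrankEq _ _ hK
  have hinj : Function.Injective (T.prod (e.toLinearMap.comp q).toContinuousLinearMap) := by
    rw [injective_iff_map_eq_zero]
    intro v hv
    have h1 : T v = 0 := congrArg Prod.fst hv
    have h2 : e (q v) = 0 := congrArg Prod.snd hv
    have h3 : q v = ⟨v, h1⟩ := LinearMap.congr_fun hq ⟨v, h1⟩
    rw [LinearEquiv.map_eq_zero_iff, h3] at h2
    exact congrArg Subtype.val h2
  refine ⟨_, hinj, ?_⟩
  have hd' : Module.finrank ℝ E = Module.finrank ℝ (F × G) := by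
    rw [Module.finrank_prod]
    omega
  exact (LinearMap.injective_iff_surjective_of_finrank_eq_finrank hd'
    (f := (T.prod (e.toLinearMap.comp q).toContinuousLinearMap).toLinearMap)).1 hinj

/-- An injective linear map can be completed to an isomorphism. -/
theorem exists_bijective_coprod {T : E →L[ℝ] F} (hT : Function.Injective T)
    (hd : Module.finrank ℝ E + Module.finrank ℝ G = Module.finrank ℝ F) :
    ∃ Q : G →L[ℝ] F, Function.Bijective (T.coprod Q) := by
  obtain ⟨C, hC⟩ := Submodule.exists_isCompl (LinearMap.range T.toLinearMap)
  have h1 := Submodule.finrank_add_eq_of_isCompl hC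
  have h2 : Module.finrank ℝ (LinearMap.range T.toLinearMap) = Module.finrank ℝ E :=
    LinearMap.finrank_range_of_inj hT
  have hK : Module.finrank ℝ G = Module.finrank ℝ C := by omega
  let e := LinearEquiv.ofFinrankEq _ _ hK
  have hinj : Function.Injective (T.coprod (C.subtype.comp e.toLinearMap).toContinuousLinearMap) := by
    rw [injective_iff_map_eq_zero]
    rintro ⟨u, c⟩ hv
    have hv' : T u + (e c : F) = 0 := hv
    have hm : (e c : F) ∈ LinearMap.range T.toLinearMap :=
      ⟨-u, by
        change T (-u) = _
        rw [map_neg]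
        exact neg_eq_of_add_eq_zero_right hv'⟩
    have h0 : (e c : F) = 0 := by
      have := Submodule.mem_inf.2 ⟨hm, (e c).2⟩
      rwa [hC.inf_eq_bot, Submodule.mem_bot] at this
    have hc : c = 0 := by
      have : e c = 0 := Subtype.ext h0
      exact (LinearEquiv.map_eq_zero_iff e).1 this
    rw [h0, add_zero] at hv'
    have hu : u = 0 := hT (hv'.trans (map_zero T).symm)
    rw [hu, hc]
    rfl
  refine ⟨_, hinj, ?_⟩
  have hd' : Module.finrank ℝ (E × G) = Module.finrank ℝ F := by
    rw [Module.finrank_prod]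
    omega
  exact (LinearMap.injective_iff_surjective_of_finrank_eq_finrank hd'
    (f := (T.coprod (C.subtype.comp e.toLinearMap).toContinuousLinearMap).toLinearMap)).1 hinj

end Linear

section InverseFunction

variable {E : Type*} [NormedAddCommGroup E] [NormedSpace ℝ E] [FiniteDimensional ℝ E]
  {H : Type*} [TopologicalSpace H] {I : ModelWithCorners ℝ E H} [I.Boundaryless]
  {M : Type*} [TopologicalSpace M] [ChartedSpace H M] [IsManifold I ∞ M]
  {F : Type*} [NormedAddCommGroup F] [NormedSpace ℝ F] [FiniteDimensional ℝ F]

variable (I) in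
/-- The extended chart of a manifold without boundary, as a partial homeomorphism. -/
def modelChart (x : M) : OpenPartialHomeomorph M E :=
  (chartAt H x).trans I.toHomeomorph.toOpenPartialHomeomorph

omit [FiniteDimensional ℝ E] [IsManifold I ∞ M] in
theorem modelChart_source (x : M) : (modelChart I x).source = (extChartAt I x).source := by
  simp [modelChart]

omit [FiniteDimensional ℝ E] [IsManifold I ∞ M] in
theorem modelChart_target (x : M) : (modelChart I x).target = (extChartAt I x).target := by
  simp only [modelChart, extChartAt_target, I.range_eq_univ, inter_univ]
  rw [OpenPartialHomeomorph.trans_target]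
  simp
  rfl

omit [FiniteDimensional ℝ E] in
theorem contMDiffOn_modelChart (x : M) :
    ContMDiffOn I 𝓘(ℝ, E) ∞ (modelChart I x) (modelChart I x).source := by
  rw [modelChart_source, extChartAt_source]
  exact contMDiffOn_extChartAt

omit [FiniteDimensional ℝ E] in
theorem contMDiffOn_modelChart_symm (x : M) :
    ContMDiffOn 𝓘(ℝ, E) I ∞ (modelChart I x).symm (modelChart I x).target := by
  rw [modelChart_target]
  exact contMDiffOn_extChartAt_symm x

omit [FiniteDimensional ℝ F] in
/-- The inverse function theorem. -/
theorem exists_localDiffeo {f : M → F} {x : M} (hf : ∀ᶠ y in 𝓝 x, ContMDiffAt I 𝓘(ℝ, F) ∞ f y)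
    (hb : Function.Bijective (mfderiv I 𝓘(ℝ, F) f x)) :
    ∃ e : OpenPartialHomeomorph M F, x ∈ e.source ∧ EqOn e f e.source ∧
      ContMDiffOn I 𝓘(ℝ, F) ∞ e e.source ∧ ContMDiffOn 𝓘(ℝ, F) I ∞ e.symm e.target := by
  set c := modelChart I x with hc
  have hxs : x ∈ c.source := by rw [modelChart_source]; exact mem_extChartAt_source x
  have hxt : c x ∈ c.target := c.map_source hxs
  set g : E → F := f ∘ c.symm with hg
  have hgs : ∀ᶠ y in 𝓝 (c x), ContDiffAt ℝ ∞ g y := by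
    have h1 : ∀ᶠ y in 𝓝 (c x), ContMDiffAt I 𝓘(ℝ, F) ∞ f (c.symm y) := by
      refine (c.continuousAt_symm hxt).eventually ?_
      rwa [c.left_inv hxs]
    filter_upwards [h1, c.open_target.mem_nhds hxt] with y hy hyt
    rw [← contMDiffAt_iff_contDiffAt]
    exact hy.comp y ((contMDiffOn_modelChart_symm x).contMDiffAt (c.open_target.mem_nhds hyt))
  have hgd : ContDiffAt ℝ ∞ g (c x) := hgs.self_of_nhds
  have hder : (mfderiv I 𝓘(ℝ, F) f x : E →L[ℝ] F) = fderiv ℝ g (c x) := by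
    rw [hf.self_of_nhds.mdifferentiableAt (by simp) |>.mfderiv]
    simp only [writtenInExtChartAt, I.range_eq_univ, fderivWithin_univ, extChartAt_model_space_eq_id,
      PartialEquiv.refl_coe, Function.id_comp]
    rfl
  have hb' : Function.Bijective (fderiv ℝ g (c x)) := by
    rw [← hder]
    exact hb
  let A : E ≃L[ℝ] F := (LinearEquiv.ofBijective (fderiv ℝ g (c x)).toLinearMap hb').toContinuousLinearEquiv
  have hA : (A : E →L[ℝ] F) = fderiv ℝ g (c x) := by ext v; rfl
  have hAd : HasFDerivAt g (A : E →L[ℝ] F) (c x) := by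
    rw [hA]
    exact (hgd.differentiableAt (by simp)).hasFDerivAt
  -- Invertibility of the derivative is an open condition. On the smaller set `U` it makes the
  -- inverse smooth on the whole target and not just at one point.
  have hinv : ∀ᶠ y in 𝓝 (c x), ∃ B : E ≃L[ℝ] F, (B : E →L[ℝ] F) = fderiv ℝ g y := by
    have h1 : ContinuousAt (fderiv ℝ g) (c x) := (hgd.fderiv_right (m := ∞) (by simp)).continuousAt
    have h2 := ContinuousLinearEquiv.nhds A
    rw [hA] at h2
    exact h1.eventually h2
  obtain ⟨U, hU, hUo, hxU⟩ := eventually_nhds_iff.1 (hgs.and hinv)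
  let e₁ := (hgd.toOpenPartialHomeomorph g hAd (by simp)).restrOpen U hUo
  have he₁ : (e₁ : E → F) = g := rfl
  have he₁s : e₁.source ⊆ U := fun y hy => by
    rw [OpenPartialHomeomorph.restrOpen_source] at hy
    exact hy.2
  have hx₁ : c x ∈ e₁.source := by
    rw [OpenPartialHomeomorph.restrOpen_source]
    exact ⟨hgd.mem_toOpenPartialHomeomorph_source hAd (by simp), hxU⟩
  have hs₁ : ContMDiffOn 𝓘(ℝ, E) 𝓘(ℝ, F) ∞ e₁ e₁.source := fun y hy =>
    ((hU y (he₁s hy)).1.contMDiffAt).contMDiffWithinAt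
  have ht₁ : ContMDiffOn 𝓘(ℝ, F) 𝓘(ℝ, E) ∞ e₁.symm e₁.target := fun y hy => by
    obtain ⟨h1, B, hB⟩ := hU _ (he₁s (e₁.map_target hy))
    refine (ContDiffAt.contMDiffAt ?_).contMDiffWithinAt
    refine e₁.contDiffAt_symm hy (f₀' := B) ?_ h1
    rw [hB]
    exact (h1.differentiableAt (by simp)).hasFDerivAt
  refine ⟨c.trans e₁, ?_, ?_, ?_, ?_⟩
  · rw [OpenPartialHomeomorph.trans_source]
    exact ⟨hxs, hx₁⟩
  · intro y hy
    rw [OpenPartialHomeomorph.trans_source] at hy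
    change f (c.symm (c y)) = f y
    rw [c.left_inv hy.1]
  · rw [OpenPartialHomeomorph.trans_source]
    exact hs₁.comp ((contMDiffOn_modelChart x).mono inter_subset_left) fun y hy => hy.2
  · rw [OpenPartialHomeomorph.trans_target]
    exact (contMDiffOn_modelChart_symm x).comp (ht₁.mono inter_subset_left) fun y hy => hy.2

end InverseFunction

/-! ### Local normal forms of submersions, immersions and maps of constant rank. -/

section Criteria

variable {E : Type*} [NormedAddCommGroup E] [NormedSpace ℝ E] [FiniteDimensional ℝ E]
  {H : Type*} [TopologicalSpace H] {I : ModelWithCorners ℝ E H} [I.Boundaryless]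
  {M : Type*} [TopologicalSpace M] [ChartedSpace H M] [IsManifold I ∞ M]
  {E' : Type*} [NormedAddCommGroup E'] [NormedSpace ℝ E'] [FiniteDimensional ℝ E']
  {H' : Type*} [TopologicalSpace H'] {J : ModelWithCorners ℝ E' H'} [J.Boundaryless]
  {N : Type*} [TopologicalSpace N] [ChartedSpace H' N] [IsManifold J ∞ N]
  {F : Type*} [NormedAddCommGroup F] [NormedSpace ℝ F] [FiniteDimensional ℝ F]

omit [FiniteDimensional ℝ E] in
theorem contMDiff_model_symm : ContMDiff 𝓘(ℝ, E) I ∞ (I.symm : E → H) := by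
  rw [← contMDiffOn_univ, ← I.range_eq_univ]
  exact I.contMDiffOn_symm

variable (I) in
/-- A partial homeomorphism to the model vector space, as a chart with values in the model space. -/
def toChart (e : OpenPartialHomeomorph M E) : OpenPartialHomeomorph M H :=
  e.trans I.toHomeomorph.symm.toOpenPartialHomeomorph

omit [FiniteDimensional ℝ E] [ChartedSpace H M] [IsManifold I ∞ M] in
theorem toChart_source (e : OpenPartialHomeomorph M E) : (toChart I e).source = e.source := by
  simp [toChart]

omit [FiniteDimensional ℝ E] [ChartedSpace H M] [IsManifold I ∞ M] in
theorem toChart_extend_coe (e : OpenPartialHomeomorph M E) (y : M) :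
    (toChart I e).extend I y = e y :=
  I.toHomeomorph.apply_symm_apply (e y)

omit [FiniteDimensional ℝ E] [ChartedSpace H M] [IsManifold I ∞ M] in
theorem toChart_extend_symm_coe (e : OpenPartialHomeomorph M E) (y : E) :
    ((toChart I e).extend I).symm y = e.symm y := by
  change e.symm (I.toHomeomorph (I.toHomeomorph.symm y)) = e.symm y
  rw [Homeomorph.apply_symm_apply]

omit [FiniteDimensional ℝ E] [ChartedSpace H M] [IsManifold I ∞ M] in
theorem toChart_extend_target (e : OpenPartialHomeomorph M E) :
    ((toChart I e).extend I).target = e.target := by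
  ext y
  rw [OpenPartialHomeomorph.extend_target, I.range_eq_univ, inter_univ]
  change I.symm y ∈ (toChart I e).target ↔ _
  rw [toChart, OpenPartialHomeomorph.trans_target]
  change True ∧ I.toHomeomorph (I.toHomeomorph.symm y) ∈ e.target ↔ _
  rw [Homeomorph.apply_symm_apply, true_and]

omit [FiniteDimensional ℝ E] in
-- Submersions and immersions are defined through charts with values in `H`, while the inverse
-- function theorem produces maps to `E`. Without boundary, `I` is a diffeomorphism between the two.
theorem toChart_mem_maximalAtlas {e : OpenPartialHomeomorph M E}
    (he : ContMDiffOn I 𝓘(ℝ, E) ∞ e e.source) (he' : ContMDiffOn 𝓘(ℝ, E) I ∞ e.symm e.target) :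
    toChart I e ∈ IsManifold.maximalAtlas I ∞ M := by
  refine OpenPartialHomeomorph.mem_maximalAtlas_of_contMDiffOn _ ?_ ?_
  · rw [toChart_source]
    exact contMDiff_model_symm.comp_contMDiffOn he
  · have h : ContMDiffOn I I ∞ (e.symm ∘ I) (toChart I e).target := by
      refine he'.comp I.contMDiff.contMDiffOn ?_
      intro y hy
      rw [toChart, OpenPartialHomeomorph.trans_target] at hy
      exact hy.2
    exact h

omit [FiniteDimensional ℝ E] [I.Boundaryless] [IsManifold I ∞ M] [FiniteDimensional ℝ E']
  [FiniteDimensional ℝ F] in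
theorem hasMFDerivAt_prodMk_space {f : M → E'} {g : M → F} {x : M} {f' : E →L[ℝ] E'}
    {g' : E →L[ℝ] F} (hf : HasMFDerivAt I 𝓘(ℝ, E') f x f') (hg : HasMFDerivAt I 𝓘(ℝ, F) g x g') :
    HasMFDerivAt I 𝓘(ℝ, E' × F) (fun y => (f y, g y)) x (f'.prod g') :=
  ⟨hf.1.prodMk hg.1, hf.2.prodMk hg.2⟩

/-- A map with surjective derivative is a submersion. -/
theorem isSubmersionAtOfComplement_of_surjective {f : M → N} {x : M}
    (hf : ∀ᶠ y in 𝓝 x, ContMDiffAt I J ∞ f y) (hs : Function.Surjective (mfderiv I J f x))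
    (hd : Module.finrank ℝ F + Module.finrank ℝ E' = Module.finrank ℝ E) :
    Manifold.IsSubmersionAtOfComplement F I J ∞ f x := by
  have hfx := hf.self_of_nhds
  set ψ := modelChart J (f x)
  have hψs : f x ∈ ψ.source := by rw [modelChart_source]; exact mem_extChartAt_source _
  obtain ⟨Q, hQ⟩ := exists_bijective_prod (E := E) (F := E') (G := F) (T := (mfderiv I J f x : E →L[ℝ] E')) hs hd
  -- Preferred charts have identity derivative at their base point, so the derivative of `h` at `x`
  -- is the pair of `df` and `Q`, which is bijective. In the chart obtained from `h`, `f` is the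
  -- first projection.
  let h : M → E' × F := fun y => (ψ (f y), Q (extChartAt I x y))
  have hsm : ∀ᶠ y in 𝓝 x, ContMDiffAt I 𝓘(ℝ, E' × F) ∞ h y := by
    filter_upwards [hf, hfx.continuousAt.eventually (ψ.open_source.mem_nhds hψs),
      extChartAt_source_mem_nhds (I := I) x] with y hy hy' hy''
    refine ContMDiffAt.prodMk_space ?_ ?_
    · exact ((contMDiffOn_modelChart (f x)).contMDiffAt (ψ.open_source.mem_nhds hy')).comp y hy
    · exact Q.contDiff.contMDiff.contMDiffAt.comp y
        (contMDiffAt_extChartAt' (by rwa [extChartAt_source] at hy''))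
  have hder : (mfderiv I 𝓘(ℝ, E' × F) h x : E →L[ℝ] E' × F) =
      (mfderiv I J f x : E →L[ℝ] E').prod Q := by
    have h1 : HasMFDerivAt I 𝓘(ℝ, E') (fun y => ψ (f y)) x (mfderiv I J f x : E →L[ℝ] E') := by
      have h2 : HasMFDerivAt J 𝓘(ℝ, E') ψ (f x) (ContinuousLinearMap.id ℝ E') := by
        have := (mdifferentiableAt_extChartAt (I := J) (mem_chart_source H' (f x))).hasMFDerivAt
        rw [mfderiv_extChartAt_self] at this
        exact this
      exact h2.comp x (hfx.mdifferentiableAt (by simp)).hasMFDerivAt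
    have h3 : HasMFDerivAt I 𝓘(ℝ, F) (fun y => Q (extChartAt I x y)) x Q := by
      have h2 : HasMFDerivAt I 𝓘(ℝ, E) (extChartAt I x) x (ContinuousLinearMap.id ℝ E) := by
        have := (mdifferentiableAt_extChartAt (I := I) (mem_chart_source H x)).hasMFDerivAt
        rw [mfderiv_extChartAt_self] at this
        exact this
      exact (Q.hasMFDerivAt (x := extChartAt I x x)).comp x h2
    exact (hasMFDerivAt_prodMk_space h1 h3).mfderiv
  have hb : Function.Bijective (mfderiv I 𝓘(ℝ, E' × F) h x : E →L[ℝ] E' × F) := by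
    rw [hder]
    exact hQ
  obtain ⟨e, hxe, heq, hes, het⟩ := exists_localDiffeo hsm hb
  have hfr : Module.finrank ℝ E = Module.finrank ℝ (E' × F) := by
    rw [Module.finrank_prod]; omega
  let B : E ≃L[ℝ] E' × F := ContinuousLinearEquiv.ofFinrankEq hfr
  let e' : OpenPartialHomeomorph M E := e.trans B.symm.toHomeomorph.toOpenPartialHomeomorph
  have he's : e'.source = e.source := by simp [e']
  have he't : e'.target = B ⁻¹' e.target := by
    simp only [e', OpenPartialHomeomorph.trans_target]
    ext y
    simp
  refine Manifold.IsSubmersionAtOfComplement.mk_of_continuousAt hfx.continuousAt B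
    (toChart I e') (chartAt H' (f x)) ?_ (mem_chart_source H' (f x)) ?_
    (IsManifold.chart_mem_maximalAtlas _) ?_
  · rw [toChart_source, he's]
    exact hxe
  · refine toChart_mem_maximalAtlas ?_ ?_
    · rw [he's]
      exact B.symm.contDiff.contMDiff.comp_contMDiffOn hes
    · rw [he't]
      exact het.comp B.contDiff.contMDiff.contMDiffOn fun y hy => hy
  · intro y hy
    rw [toChart_extend_target, he't] at hy
    simp only [Function.comp_apply, toChart_extend_symm_coe]
    change ψ (f (e.symm (B y))) = (B y).1
    have h1 := heq (e.map_target hy)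
    rw [e.right_inv hy] at h1
    exact (congrArg Prod.fst h1).symm

/-- A map with injective derivative is an immersion. -/
theorem isImmersionAtOfComplement_of_injective {f : M → N} {x : M}
    (hf : ∀ᶠ y in 𝓝 x, ContMDiffAt I J ∞ f y) (hs : Function.Injective (mfderiv I J f x))
    (hd : Module.finrank ℝ E + Module.finrank ℝ F = Module.finrank ℝ E') :
    Manifold.IsImmersionAtOfComplement F I J ∞ f x := by
  have hfx := hf.self_of_nhds
  set ψ := modelChart J (f x)
  set φ := modelChart I x with hφ
  have hψs : f x ∈ ψ.source := by rw [modelChart_source]; exact mem_extChartAt_source _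
  have hφs : x ∈ φ.source := by rw [modelChart_source]; exact mem_extChartAt_source _
  have hφt : φ x ∈ φ.target := φ.map_source hφs
  obtain ⟨Q, hQ⟩ := exists_bijective_coprod (E := E) (F := E') (G := F) (T := (mfderiv I J f x : E →L[ℝ] E')) hs hd
  let g : E → E' := ψ ∘ f ∘ φ.symm
  have hgs : ∀ᶠ y in 𝓝 (φ x), ContDiffAt ℝ ∞ g y := by
    have h1 : ∀ᶠ y in 𝓝 (φ x), ContMDiffAt I J ∞ f (φ.symm y) ∧ f (φ.symm y) ∈ ψ.source := by
      have h2 : ∀ᶠ y in 𝓝 (φ.symm (φ x)), ContMDiffAt I J ∞ f y ∧ f y ∈ ψ.source := by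
        rw [φ.left_inv hφs]
        exact hf.and (hfx.continuousAt.eventually (ψ.open_source.mem_nhds hψs))
      exact (φ.continuousAt_symm hφt).eventually h2
    filter_upwards [h1, φ.open_target.mem_nhds hφt] with y hy hyt
    rw [← contMDiffAt_iff_contDiffAt]
    exact ((contMDiffOn_modelChart (f x)).contMDiffAt (ψ.open_source.mem_nhds hy.2)).comp y
      (hy.1.comp y ((contMDiffOn_modelChart_symm x).contMDiffAt (φ.open_target.mem_nhds hyt)))
  have hder : (mfderiv I J f x : E →L[ℝ] E') = fderiv ℝ g (φ x) := by
    rw [(hfx.mdifferentiableAt (by simp)).mfderiv]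
    simp only [writtenInExtChartAt, I.range_eq_univ, fderivWithin_univ]
    rfl
  -- Thickening the image in the complementary directions gives a local diffeomorphism. Using its
  -- inverse as codomain chart turns `f` into `u ↦ (u, 0)`.
  let h : E × F → E' := fun p => g p.1 + Q p.2
  have hsm : ∀ᶠ p in 𝓝 ((φ x, 0) : E × F), ContMDiffAt 𝓘(ℝ, E × F) 𝓘(ℝ, E') ∞ h p := by
    filter_upwards [continuous_fst.continuousAt.eventually hgs] with p hp
    exact ((hp.comp p contDiffAt_fst).add (Q.contDiff.contDiffAt.comp p contDiffAt_snd)).contMDiffAt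
  have hb : Function.Bijective (mfderiv 𝓘(ℝ, E × F) 𝓘(ℝ, E') h (φ x, 0) : E × F →L[ℝ] E') := by
    have h2 : HasFDerivAt g (fderiv ℝ g (φ x)) ((φ x, (0 : F)).1) :=
      (hgs.self_of_nhds.differentiableAt (by simp)).hasFDerivAt
    have h3 : HasFDerivAt h _ (φ x, (0 : F)) := (h2.comp (φ x, (0 : F)) hasFDerivAt_fst).add
      (Q.hasFDerivAt.comp (φ x, (0 : F)) hasFDerivAt_snd)
    rw [mfderiv_eq_fderiv, h3.fderiv, ← hder]
    exact hQ
  obtain ⟨e, hxe, heq, hes, het⟩ := exists_localDiffeo hsm hb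
  have hfr : Module.finrank ℝ (E × F) = Module.finrank ℝ E' := by
    rw [Module.finrank_prod]; omega
  let B : (E × F) ≃L[ℝ] E' := ContinuousLinearEquiv.ofFinrankEq (E := E × F) (F := E') hfr
  let e' : OpenPartialHomeomorph N E' :=
    ψ.trans (e.symm.trans B.toHomeomorph.toOpenPartialHomeomorph)
  have he's : e'.source = ψ.source ∩ ψ ⁻¹' e.target := by simp [e']
  have hex : e (φ x, 0) = ψ (f x) := by
    rw [heq hxe]
    change ψ (f (φ.symm (φ x))) + Q 0 = _
    rw [φ.left_inv hφs, map_zero, add_zero]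
  let U : Set E := φ.target ∩ {u | f (φ.symm u) ∈ ψ.source ∧ (u, (0 : F)) ∈ e.source}
  have hUn : ∀ᶠ y in 𝓝 x, y ∈ φ.source ∧ (φ y, (0 : F)) ∈ e.source := by
    refine (show ∀ᶠ y in 𝓝 x, y ∈ φ.source from φ.open_source.mem_nhds hφs).and ?_
    have : ContinuousAt (fun y => (φ y, (0 : F))) x :=
      (φ.continuousAt hφs).prodMk continuousAt_const
    exact this.eventually (e.open_source.mem_nhds hxe)
  -- The domain chart is shrunk so that `(φ y, 0)` stays where the local diffeomorphism is defined.
  obtain ⟨V, hV, hVo, hxV⟩ := eventually_nhds_iff.1 hUn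
  refine Manifold.IsImmersionAtOfComplement.mk_of_continuousAt hfx.continuousAt B
    ((chartAt H x).restrOpen V hVo) (toChart J e') ?_ ?_ ?_ ?_ ?_
  · exact ⟨mem_chart_source H x, hxV⟩
  · rw [toChart_source, he's]
    exact ⟨hψs, by rw [mem_preimage, ← hex]; exact e.map_source hxe⟩
  · have := restr_mem_maximalAtlas (contDiffGroupoid ∞ I)
      (IsManifold.chart_mem_maximalAtlas (I := I) (n := ∞) x) hVo
    rw [OpenPartialHomeomorph.restr] at this
    convert! this using 2
    exact hVo.interior_eq.symm
  · refine toChart_mem_maximalAtlas ?_ ?_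
    · rw [he's]
      refine B.contDiff.contMDiff.comp_contMDiffOn ?_
      exact het.comp ((contMDiffOn_modelChart (f x)).mono inter_subset_left) fun y hy => hy.2
    · have he't : e'.target ⊆ {y | B.symm y ∈ e.source ∧ e (B.symm y) ∈ ψ.target} := by
        intro y hy
        simpa [e', OpenPartialHomeomorph.trans_target] using hy
      have h1 : ContMDiffOn 𝓘(ℝ, E') J ∞ (fun y => ψ.symm (e (B.symm y)))
          {y | B.symm y ∈ e.source ∧ e (B.symm y) ∈ ψ.target} := by
        refine (contMDiffOn_modelChart_symm (f x)).comp
          (hes.comp B.symm.contDiff.contMDiff.contMDiffOn fun y hy => hy.1) fun y hy => hy.2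
      exact h1.mono he't
  · intro u hu
    have hu1 : (chartAt H x).symm (I.symm u) ∈ V ∧ u ∈ φ.target := by
      rw [OpenPartialHomeomorph.extend_target] at hu
      have h2 := ((chartAt H x).restrOpen V hVo).map_target hu.1
      refine ⟨h2.2, ?_⟩
      rw [hφ, modelChart_target, extChartAt_target]
      refine ⟨?_, hu.2⟩
      change I.symm u ∈ (chartAt H x).target
      rw [← ((chartAt H x).restrOpen V hVo).right_inv hu.1]
      exact (chartAt H x).map_source h2.1
    have hu2 := (hV _ hu1.1).2
    change (φ (φ.symm u), (0 : F)) ∈ e.source at hu2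
    rw [φ.right_inv hu1.2] at hu2
    simp only [Function.comp_apply, toChart_extend_coe]
    change B (e.symm (ψ (f (φ.symm u)))) = B (u, 0)
    have h4 : ψ (f (φ.symm u)) = e (u, 0) := by
      rw [heq hu2]
      change _ = ψ (f (φ.symm u)) + Q 0
      rw [map_zero, add_zero]
    rw [h4, e.left_inv hu2]

omit [FiniteDimensional ℝ E] [FiniteDimensional ℝ E'] [IsManifold I ∞ M] [J.Boundaryless]
  [IsManifold J ∞ N] in
/-- A submersion has smooth local sections. -/
theorem exists_localSection {f : M → N} {x : M} (hf : Manifold.IsSubmersionAt I J ∞ f x) :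
    ∃ σ : N → M, σ (f x) = x ∧
      ∀ᶠ q in 𝓝 (f x), f (σ q) = q ∧ ContMDiffAt J I ∞ σ q := by
  set c := hf.domChart
  set d := hf.codChart
  set B := hf.equiv
  have hxc : x ∈ c.source := hf.mem_domChart_source
  have hxd : f x ∈ d.source := hf.mem_codChart_source
  have hw := hf.writtenInCharts
  -- The section keeps the fibre coordinate equal to that of `x`.
  let τ : N → E := fun q => B.symm (d.extend J q, (B (c.extend I x)).2)
  have hτx : τ (f x) = c.extend I x := by
    have h1 := hw ((c.extend I).map_source (by rwa [OpenPartialHomeomorph.extend_source]))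
    simp only [Function.comp_apply] at h1
    rw [(c.extend I).left_inv (by rwa [OpenPartialHomeomorph.extend_source])] at h1
    change B.symm (d.extend J (f x), (B (c.extend I x)).2) = c.extend I x
    rw [h1, Prod.mk.eta, B.symm_apply_apply]
  have hτs : ∀ q ∈ d.source, ContMDiffAt J 𝓘(ℝ, E) ∞ τ q := fun q hq => by
    have h1 : ContMDiffAt J 𝓘(ℝ, E') ∞ (d.extend J) q :=
      (OpenPartialHomeomorph.contMDiffOn_extend hf.codChart_mem_maximalAtlas).contMDiffAt
        (d.open_source.mem_nhds hq)
    exact B.symm.contDiff.contMDiff.contMDiffAt.comp q (h1.prodMk_space contMDiffAt_const)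
  have hto : IsOpen (c.extend I).target := c.isOpen_extend_target
  refine ⟨fun q => (c.extend I).symm (τ q), ?_, ?_⟩
  · change (c.extend I).symm (τ (f x)) = x
    rw [hτx]
    exact (c.extend I).left_inv (by rwa [OpenPartialHomeomorph.extend_source])
  · have hxt : τ (f x) ∈ (c.extend I).target := by
      rw [hτx]
      exact (c.extend I).map_source (by rwa [OpenPartialHomeomorph.extend_source])
    filter_upwards [d.open_source.mem_nhds hxd,
      (hτs _ hxd).continuousAt.eventually (hto.mem_nhds hxt)] with q hq hqt
    constructor
    · have h1 := hw hqt
      simp only [Function.comp_apply] at h1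
      have h2 : (B (τ q)).1 = d.extend J q := by
        change (B (B.symm _)).1 = _
        rw [B.apply_symm_apply]
      have h3 : f ((c.extend I).symm (τ q)) ∈ d.source := by
        refine hf.source_subset_preimage_source ?_
        have := (c.extend I).map_target hqt
        rwa [OpenPartialHomeomorph.extend_source] at this
      refine (d.extend J).injOn (by rwa [OpenPartialHomeomorph.extend_source])
        (by rwa [OpenPartialHomeomorph.extend_source]) ?_
      exact h1.trans h2
    · have h1 : ContMDiffAt 𝓘(ℝ, E) I ∞ (c.extend I).symm (τ q) := by
        have h2 := contMDiffOn_extend_symm (I := I) (n := ∞) hf.domChart_mem_maximalAtlas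
        refine h2.contMDiffAt ?_
        rw [I.image_eq, ← OpenPartialHomeomorph.extend_target]
        exact hto.mem_nhds hqt
      exact h1.comp q (hτs q hq)

omit [FiniteDimensional ℝ E] [FiniteDimensional ℝ E'] [J.Boundaryless] [IsManifold I ∞ M]
  [IsManifold J ∞ N] in
/-- An immersion has smooth local left inverses. -/
theorem exists_localRetraction {f : M → N} {x : M} (hf : Manifold.IsImmersionAt I J ∞ f x) :
    ∃ ρ : N → M, ContMDiffAt J I ∞ ρ (f x) ∧ ∀ᶠ y in 𝓝 x, ρ (f y) = y := by
  set c := hf.domChart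
  set d := hf.codChart
  set B := hf.equiv
  have hxc : x ∈ c.source := hf.mem_domChart_source
  have hxd : f x ∈ d.source := hf.mem_codChart_source
  have hw := hf.writtenInCharts
  have hle : ∀ y ∈ c.source, (B.symm (d.extend J (f y))).1 = c.extend I y := fun y hy => by
    have hy' : y ∈ (c.extend I).source := by rwa [OpenPartialHomeomorph.extend_source]
    have h1 := hw ((c.extend I).map_source hy')
    simp only [Function.comp_apply] at h1
    rw [(c.extend I).left_inv hy'] at h1
    rw [h1, B.symm_apply_apply]
  refine ⟨fun q => (c.extend I).symm (B.symm (d.extend J q)).1, ?_, ?_⟩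
  · have h1 : ContMDiffAt J 𝓘(ℝ, E') ∞ (d.extend J) (f x) :=
      (OpenPartialHomeomorph.contMDiffOn_extend hf.codChart_mem_maximalAtlas).contMDiffAt
        (d.open_source.mem_nhds hxd)
    have h2 : ContMDiffAt J 𝓘(ℝ, E) ∞ (fun q => (B.symm (d.extend J q)).1) (f x) :=
      (contDiff_fst.comp B.symm.contDiff).contMDiff.contMDiffAt.comp (f x) h1
    have h3 : ContMDiffAt 𝓘(ℝ, E) I ∞ (c.extend I).symm (B.symm (d.extend J (f x))).1 := by
      have h2 := contMDiffOn_extend_symm (I := I) (n := ∞) hf.domChart_mem_maximalAtlas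
      refine h2.contMDiffAt ?_
      rw [I.image_eq, ← OpenPartialHomeomorph.extend_target, hle x hxc]
      exact c.isOpen_extend_target.mem_nhds
        ((c.extend I).map_source (by rwa [OpenPartialHomeomorph.extend_source]))
    exact h3.comp (f x) h2
  · filter_upwards [c.open_source.mem_nhds hxc] with y hy
    rw [hle y hy]
    exact (c.extend I).left_inv (by rwa [OpenPartialHomeomorph.extend_source])

/-- The constant rank theorem: locally, a map of constant rank `d` is a function of `d` linear
combinations of its components, which form a submersion. -/
theorem exists_factorization_of_constant_rank {f : M → F} {x : M} {d : ℕ}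
    (hf : ∀ᶠ y in 𝓝 x, ContMDiffAt I 𝓘(ℝ, F) ∞ f y)
    (hr : ∀ᶠ y in 𝓝 x, Module.finrank ℝ (LinearMap.range
      (mfderiv I 𝓘(ℝ, F) f y : E →L[ℝ] F).toLinearMap) = d) :
    ∃ (P : F →L[ℝ] EuclideanSpace ℝ (Fin d)) (h : EuclideanSpace ℝ (Fin d) → F),
      Function.Surjective (P ∘L (mfderiv I 𝓘(ℝ, F) f x : E →L[ℝ] F)) ∧
      ContDiffAt ℝ ∞ h (P (f x)) ∧ ∀ᶠ y in 𝓝 x, f y = h (P (f y)) := by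
  set A : E →L[ℝ] F := mfderiv I 𝓘(ℝ, F) f x with hA
  let R : Submodule ℝ F := LinearMap.range A.toLinearMap
  -- `P` projects onto the range of the derivative at `x` and takes coordinates there, so that `P ∘
  -- f` is a submersion at `x`.
  obtain ⟨p, hp⟩ := LinearMap.exists_leftInverse_of_injective R.subtype (Submodule.ker_subtype _)
  have hd : Module.finrank ℝ R = d := hr.self_of_nhds
  let L : R ≃ₗ[ℝ] EuclideanSpace ℝ (Fin d) := LinearEquiv.ofFinrankEq _ _
    (by rw [finrank_euclideanSpace_fin]; exact hd)
  let P : F →L[ℝ] EuclideanSpace ℝ (Fin d) := (L.toLinearMap.comp p).toContinuousLinearMap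
  have hPA : Function.Surjective (P ∘L A) := fun z => by
    obtain ⟨v, hv⟩ := (L.symm z).2
    refine ⟨v, ?_⟩
    change L (p (A v)) = z
    have h1 : p (L.symm z).1 = L.symm z := LinearMap.congr_fun hp (L.symm z)
    have h2 : A v = (L.symm z).1 := hv
    rw [h2, h1, L.apply_symm_apply]
  have hPAd := (P ∘L A).toLinearMap.finrank_range_add_finrank_ker
  rw [LinearMap.range_eq_top.2 hPA, finrank_top] at hPAd
  obtain ⟨Q, hQ⟩ := exists_bijective_prod (G := LinearMap.ker (P ∘L A).toLinearMap) hPA (by omega)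
  let K := LinearMap.ker (P ∘L A).toLinearMap
  let k : M → EuclideanSpace ℝ (Fin d) × K := fun y => (P (f y), Q (extChartAt I x y))
  have hsm : ∀ᶠ y in 𝓝 x, ContMDiffAt I 𝓘(ℝ, EuclideanSpace ℝ (Fin d) × K) ∞ k y := by
    filter_upwards [hf, extChartAt_source_mem_nhds (I := I) x] with y hy hy'
    refine ContMDiffAt.prodMk_space ?_ ?_
    · exact P.contDiff.contMDiff.contMDiffAt.comp y hy
    · exact Q.contDiff.contMDiff.contMDiffAt.comp y
        (contMDiffAt_extChartAt' (by rwa [extChartAt_source] at hy'))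
  have hder : (mfderiv I 𝓘(ℝ, EuclideanSpace ℝ (Fin d) × K) k x :
      E →L[ℝ] EuclideanSpace ℝ (Fin d) × K) = (P ∘L A).prod Q := by
    have h1 : HasMFDerivAt I 𝓘(ℝ, EuclideanSpace ℝ (Fin d)) (fun y => P (f y)) x (P ∘L A) :=
      (P.hasMFDerivAt (x := f x)).comp x (hf.self_of_nhds.mdifferentiableAt (by simp)).hasMFDerivAt
    have h3 : HasMFDerivAt I 𝓘(ℝ, K) (fun y => Q (extChartAt I x y)) x Q := by
      have h2 : HasMFDerivAt I 𝓘(ℝ, E) (extChartAt I x) x (ContinuousLinearMap.id ℝ E) := by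
        have := (mdifferentiableAt_extChartAt (I := I) (mem_chart_source H x)).hasMFDerivAt
        rw [mfderiv_extChartAt_self] at this
        exact this
      exact (Q.hasMFDerivAt (x := extChartAt I x x)).comp x h2
    exact (hasMFDerivAt_prodMk_space h1 h3).mfderiv
  have hb : Function.Bijective (mfderiv I 𝓘(ℝ, EuclideanSpace ℝ (Fin d) × K) k x :
      E →L[ℝ] EuclideanSpace ℝ (Fin d) × K) := by
    rw [hder]
    exact hQ
  obtain ⟨e, hxe, heq, hes, het⟩ := exists_localDiffeo hsm hb
  have hext : e x ∈ e.target := e.map_source hxe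
  have hev : ∀ᶠ p in 𝓝 (e x), p ∈ e.target ∧ ContMDiffAt I 𝓘(ℝ, F) ∞ f (e.symm p) ∧
      Module.finrank ℝ (LinearMap.range
        (mfderiv I 𝓘(ℝ, F) f (e.symm p) : E →L[ℝ] F).toLinearMap) = d := by
    have h1 : ∀ᶠ y in 𝓝 (e.symm (e x)), ContMDiffAt I 𝓘(ℝ, F) ∞ f y ∧
        Module.finrank ℝ (LinearMap.range
          (mfderiv I 𝓘(ℝ, F) f y : E →L[ℝ] F).toLinearMap) = d := by
      rw [e.left_inv hxe]
      exact hf.and hr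
    exact (show ∀ᶠ p in 𝓝 (e x), p ∈ e.target from e.open_target.mem_nhds hext).and
      ((e.continuousAt_symm hext).eventually h1)
  obtain ⟨r, hr0, hball⟩ := Metric.eventually_nhds_iff_ball.1 hev
  let g : EuclideanSpace ℝ (Fin d) × K → F := fun p => f (e.symm p)
  have hPg : ∀ p ∈ e.target, P (g p) = p.1 := fun p hp => by
    have h1 := heq (e.map_target hp)
    rw [e.right_inv hp] at h1
    exact (congrArg Prod.fst h1).symm
  have hgs : ∀ p ∈ Metric.ball (e x) r, ContDiffAt ℝ ∞ g p := fun p hp => by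
    rw [← contMDiffAt_iff_contDiffAt]
    exact (hball p hp).2.1.comp p
      (het.contMDiffAt (e.open_target.mem_nhds (hball p hp).1))
  -- `P` maps the range of `D`, of dimension `d`, onto a space of dimension `d`, hence injectively.
  -- The derivative of `g` along `K` lies in this range, and `P` kills it because `P ∘ g` is the
  -- first coordinate.
  have hg0 : ∀ p ∈ Metric.ball (e x) r, ∀ w : K, fderiv ℝ g p (0, w) = 0 := fun p hp w => by
    obtain ⟨hpt, hfp, hrk⟩ := hball p hp
    set D : E →L[ℝ] F := mfderiv I 𝓘(ℝ, F) f (e.symm p)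
    have hchain : fderiv ℝ g p = D ∘L (mfderiv 𝓘(ℝ, EuclideanSpace ℝ (Fin d) × K) I e.symm p :
        EuclideanSpace ℝ (Fin d) × K →L[ℝ] E) := by
      rw [← mfderiv_eq_fderiv]
      exact mfderiv_comp p (hfp.mdifferentiableAt (by simp))
        ((het.contMDiffAt (e.open_target.mem_nhds hpt)).mdifferentiableAt (by simp))
    have hPd : P ∘L fderiv ℝ g p = ContinuousLinearMap.fst ℝ (EuclideanSpace ℝ (Fin d)) K := by
      have h1 : HasFDerivAt (fun q => P (g q)) (P ∘L fderiv ℝ g p) p :=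
        P.hasFDerivAt.comp p ((hgs p hp).differentiableAt (by simp)).hasFDerivAt
      have h2 : HasFDerivAt (fun q => P (g q))
          (ContinuousLinearMap.fst ℝ (EuclideanSpace ℝ (Fin d)) K) p :=
        hasFDerivAt_fst.congr_of_eventuallyEq
          (eventually_of_mem (e.open_target.mem_nhds hpt) hPg)
      exact h1.unique h2
    have hPsurj : Function.Surjective (P.toLinearMap.domRestrict (LinearMap.range D.toLinearMap)) := by
      intro z
      refine ⟨⟨fderiv ℝ g p (z, 0), ?_⟩, ?_⟩
      · rw [hchain]
        exact ⟨_, rfl⟩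
      · have := congrArg (fun T : EuclideanSpace ℝ (Fin d) × K →L[ℝ] EuclideanSpace ℝ (Fin d) =>
          T (z, 0)) hPd
        exact this
    have hPinj : Function.Injective (P.toLinearMap.domRestrict (LinearMap.range D.toLinearMap)) :=
      (LinearMap.injective_iff_surjective_of_finrank_eq_finrank
        (by rw [finrank_euclideanSpace_fin]; exact hrk)).2 hPsurj
    have h1 : P (fderiv ℝ g p (0, w)) = 0 :=
      congrArg (fun T : EuclideanSpace ℝ (Fin d) × K →L[ℝ] EuclideanSpace ℝ (Fin d) => T (0, w)) hPd
    have h2 : fderiv ℝ g p (0, w) ∈ LinearMap.range D.toLinearMap := by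
      rw [hchain]
      exact ⟨_, rfl⟩
    have h3 : (⟨_, h2⟩ : LinearMap.range D.toLinearMap) = 0 := hPinj (h1.trans (map_zero _).symm)
    exact congrArg Subtype.val h3
  -- A ball of the product norm is a product of balls, so for a fixed first coordinate the second
  -- one runs over a convex set on which `g` has zero derivative.
  have hconst : ∀ p ∈ Metric.ball (e x) r, g p = g (p.1, (e x).2) := fun p hp => by
    have hp' : p.1 ∈ Metric.ball (e x).1 r ∧ p.2 ∈ Metric.ball (e x).2 r := by
      rw [← ball_prod_same] at hp
      exact hp
    have hmem : ∀ w ∈ Metric.ball (e x).2 r, (p.1, w) ∈ Metric.ball (e x) r := fun w hw => by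
      rw [← ball_prod_same]
      exact ⟨hp'.1, hw⟩
    have hd : ∀ w ∈ Metric.ball (e x).2 r, HasFDerivAt (fun w => g (p.1, w)) (0 : K →L[ℝ] F) w := by
      intro w hw
      have h1 := ((hgs _ (hmem w hw)).differentiableAt (by simp)).hasFDerivAt.comp w
        (hasFDerivAt_prodMk_right (𝕜 := ℝ) p.1 w)
      have h2 : (fderiv ℝ g (p.1, w)) ∘L (ContinuousLinearMap.inr ℝ (EuclideanSpace ℝ (Fin d)) K) = 0 := by
        ext1 v
        exact hg0 _ (hmem w hw) v
      rw [h2] at h1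
      exact h1
    exact (convex_ball (e x).2 r).is_const_of_fderivWithin_eq_zero (𝕜 := ℝ) (f := fun w => g (p.1, w))
      (fun w hw => (hd w hw).differentiableAt.differentiableWithinAt)
      (fun w hw => by
        rw [fderivWithin_of_isOpen Metric.isOpen_ball hw]
        exact (hd w hw).fderiv) hp'.2 (Metric.mem_ball_self hr0)
  have hex1 : (e x).1 = P (f x) := congrArg Prod.fst (heq hxe)
  refine ⟨P, fun a => g (a, (e x).2), hPA, ?_, ?_⟩
  · have h1 : ContDiffAt ℝ ∞ g (P (f x), (e x).2) := by
      rw [← hex1]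
      exact hgs _ (Metric.mem_ball_self hr0)
    exact ContDiffAt.comp (g := g) (P (f x)) h1 (contDiffAt_id.prodMk contDiffAt_const)
  · filter_upwards [e.open_source.mem_nhds hxe,
      (e.continuousAt hxe).eventually (Metric.ball_mem_nhds (e x) hr0)] with y hy hyb
    have h1 := hconst _ hyb
    change f (e.symm (e y)) = _ at h1
    rw [e.left_inv hy] at h1
    have h2 : (e y).1 = P (f y) := congrArg Prod.fst (heq hy)
    rw [h2] at h1
    exact h1

end Criteria

/-! ### Derivatives of submersions and immersions. -/

section SubmersionImmersion

variable {E : Type*} [NormedAddCommGroup E] [NormedSpace ℝ E]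
  {H : Type*} [TopologicalSpace H] {I : ModelWithCorners ℝ E H}
  {M : Type*} [TopologicalSpace M] [ChartedSpace H M]
  {E' : Type*} [NormedAddCommGroup E'] [NormedSpace ℝ E']
  {H' : Type*} [TopologicalSpace H'] {J : ModelWithCorners ℝ E' H'}
  {N : Type*} [TopologicalSpace N] [ChartedSpace H' N]

/-- The derivative of a right inverse is a right inverse of the derivative. -/
theorem mfderiv_apply_of_rightInverse {f : M → N} {σ : N → M} {q : N}
    (hf : MDifferentiableAt I J f (σ q)) (hσ : MDifferentiableAt J I σ q)
    (h : ∀ᶠ p in 𝓝 q, f (σ p) = p) (v : E') :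
    (mfderiv I J f (σ q) : E →L[ℝ] E') ((mfderiv J I σ q : E' →L[ℝ] E) v) = v := by
  have h1 : HasMFDerivAt J J (f ∘ σ) q
      ((mfderiv I J f (σ q) : E →L[ℝ] E').comp (mfderiv J I σ q : E' →L[ℝ] E)) :=
    hf.hasMFDerivAt.comp q hσ.hasMFDerivAt
  have h2 : HasMFDerivAt J J (f ∘ σ) q (ContinuousLinearMap.id ℝ E') :=
    (hasMFDerivAt_id q).congr_of_eventuallyEq h
  have h3 := hasMFDerivAt_unique h1 h2
  exact congrArg (fun T : E' →L[ℝ] E' => T v) h3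

/-- A smooth local section through `x` differentiates to a right inverse. -/
theorem surjective_mfderiv_of_isSubmersionAt [I.Boundaryless] {f : M → N} {x : M}
    (hf : Manifold.IsSubmersionAt I J ∞ f x) (hd : MDifferentiableAt I J f x) :
    Function.Surjective (mfderiv I J f x) := by
  obtain ⟨σ, hσx, hσ⟩ := exists_localSection hf
  intro v
  have h := mfderiv_apply_of_rightInverse (I := I) (J := J) (f := f) (q := f x) (by rwa [hσx])
    (hσ.self_of_nhds.2.mdifferentiableAt (by simp)) (hσ.mono fun p hp => hp.1) v
  rw [hσx] at h
  exact ⟨_, h⟩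

theorem injective_mfderiv_of_isImmersionAt [I.Boundaryless] {f : M → N} {x : M}
    (hf : Manifold.IsImmersionAt I J ∞ f x) (hd : MDifferentiableAt I J f x) :
    Function.Injective (mfderiv I J f x) := by
  obtain ⟨ρ, hρs, hρ⟩ := exists_localRetraction hf
  exact Function.LeftInverse.injective (g := mfderiv J I ρ (f x)) fun v =>
    mfderiv_apply_of_rightInverse (I := J) (J := I) (f := ρ) (σ := f)
      (hρs.mdifferentiableAt (by simp)) hd hρ v

/-- If `f` is locally constant along the fibres of a submersion `r`, then its derivative vanishes
along the fibres of `r`. -/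
theorem mfderiv_eq_zero_of_fiber {E'' : Type*} [NormedAddCommGroup E''] [NormedSpace ℝ E'']
    {H'' : Type*} [TopologicalSpace H''] {K : ModelWithCorners ℝ E'' H''}
    {P : Type*} [TopologicalSpace P] [ChartedSpace H'' P] [I.Boundaryless]
    {f : M → P} {r : M → N} {x : M}
    (hr : Manifold.IsSubmersionAt I J ∞ r x) (hrd : MDifferentiableAt I J r x)
    (hf : MDifferentiableAt I K f x)
    (h : ∀ᶠ p in 𝓝 (x, x), r p.1 = r p.2 → f p.1 = f p.2) {v : E}
    (hv : (mfderiv I J r x : E →L[ℝ] E') v = 0) : (mfderiv I K f x : E →L[ℝ] E'') v = 0 := by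
  obtain ⟨σ, hσx, hσ⟩ := exists_localSection hr
  have hσd : MDifferentiableAt J I σ (r x) := hσ.self_of_nhds.2.mdifferentiableAt (by simp)
  have hc : ContinuousAt (fun y => (y, σ (r y))) x :=
    continuousAt_id.prodMk (ContinuousAt.comp (f := r) hσd.continuousAt hrd.continuousAt)
  -- Near `x`, the points `y` and `σ (r y)` lie in one fibre of `r`, so `f` factors through `r`.
  have he : f =ᶠ[𝓝 x] (f ∘ σ) ∘ r := by
    have h1 : ∀ᶠ p in 𝓝 (x, σ (r x)), r p.1 = r p.2 → f p.1 = f p.2 := by rwa [hσx]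
    filter_upwards [hc.eventually h1, hrd.continuousAt.eventually hσ] with y hy hy'
    exact hy hy'.1.symm
  have h1 : HasMFDerivAt J K (f ∘ σ) (r x) ((mfderiv I K f (σ (r x)) : E →L[ℝ] E'').comp
      (mfderiv J I σ (r x) : E' →L[ℝ] E)) := by
    refine HasMFDerivAt.comp (r x) ?_ hσd.hasMFDerivAt
    rw [hσx]
    exact hf.hasMFDerivAt
  have h2 := (h1.comp x hrd.hasMFDerivAt).congr_of_eventuallyEq he
  rw [h2.mfderiv]
  change ((mfderiv I K f (σ (r x)) : E →L[ℝ] E'').comp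
      (mfderiv J I σ (r x) : E' →L[ℝ] E)) ((mfderiv I J r x : E →L[ℝ] E') v) = 0
  rw [hv, map_zero]

end SubmersionImmersion

/-! ### Manifold structures from families of charts. -/

section Charts

variable {X : Type*} [TopologicalSpace X] {E : Type*} [NormedAddCommGroup E] [NormedSpace ℝ E]

/-- A family of pairwise compatible local charts defines a manifold structure. -/
theorem exists_chartedSpace_of_charts (Good : OpenPartialHomeomorph X E → Prop)
    (hx : ∀ x, ∃ c, Good c ∧ x ∈ c.source)
    (hg : ∀ c c', Good c → Good c' → ∀ u ∈ c.target, c.symm u ∈ c'.source →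
      ContDiffAt ℝ ∞ (fun u => c' (c.symm u)) u) :
    ∃ (_ : ChartedSpace E X) (_ : IsManifold 𝓘(ℝ, E) ∞ X), ∀ c, Good c →
      ContMDiffOn 𝓘(ℝ, E) 𝓘(ℝ, E) ∞ c c.source ∧
      ContMDiffOn 𝓘(ℝ, E) 𝓘(ℝ, E) ∞ c.symm c.target := by
  choose ch hch using hx
  let C : ChartedSpace E X :=
    { atlas := {c | Good c}
      chartAt := ch
      mem_chart_source := fun x => (hch x).2
      chart_mem_atlas := fun x => (hch x).1 }
  have hM : IsManifold 𝓘(ℝ, E) ∞ X := by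
    refine isManifold_of_contDiffOn _ _ _ fun c c' hc hc' => ?_
    intro u hu
    have hu1 : u ∈ c.target ∧ c.symm u ∈ c'.source := by
      have := hu.1
      rwa [mem_preimage, OpenPartialHomeomorph.trans_source] at this
    exact (hg c c' hc hc' u hu1.1 hu1.2).contDiffWithinAt
  exact ⟨C, hM, fun c hc =>
    have h := IsManifold.subset_maximalAtlas (I := 𝓘(ℝ, E)) (n := ∞) (M := X) hc
    ⟨contMDiffOn_of_mem_maximalAtlas h, contMDiffOn_symm_of_mem_maximalAtlas h⟩⟩

/-- Transport of a manifold structure along a homeomorphism. -/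
theorem exists_chartedSpace_of_homeomorph {E' : Type*} [NormedAddCommGroup E'] [NormedSpace ℝ E']
    [FiniteDimensional ℝ E'] [FiniteDimensional ℝ E]
    {H : Type*} [TopologicalSpace H] {I : ModelWithCorners ℝ E' H} [I.Boundaryless]
    {Y : Type*} [TopologicalSpace Y] [ChartedSpace H Y] [IsManifold I ∞ Y] (h : X ≃ₜ Y)
    (hd : Module.finrank ℝ E' = Module.finrank ℝ E) :
    ∃ (_ : ChartedSpace E X) (_ : IsManifold 𝓘(ℝ, E) ∞ X),
      ContMDiff 𝓘(ℝ, E) I ∞ h ∧ ContMDiff I 𝓘(ℝ, E) ∞ h.symm := by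
  let L : E' ≃L[ℝ] E := ContinuousLinearEquiv.ofFinrankEq hd
  -- A chart is admitted if it becomes smooth in both directions after transport to `Y`;
  -- compatibility is then composition in `Y`.
  let Good : OpenPartialHomeomorph X E → Prop := fun c =>
    ContMDiffOn I 𝓘(ℝ, E) ∞ (fun y => c (h.symm y)) (h.symm ⁻¹' c.source) ∧
    ContMDiffOn 𝓘(ℝ, E) I ∞ (fun u => h (c.symm u)) c.target
  have ho : ∀ c : OpenPartialHomeomorph X E, IsOpen (h.symm ⁻¹' c.source) := fun c =>
    c.open_source.preimage h.symm.continuous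
  have hx : ∀ x, ∃ c, Good c ∧ x ∈ c.source := fun x => by
    let ψ := modelChart I (h x)
    refine ⟨h.toOpenPartialHomeomorph.trans
      (ψ.trans L.toHomeomorph.toOpenPartialHomeomorph), ⟨?_, ?_⟩, ?_⟩
    · have h1 : ContMDiffOn I 𝓘(ℝ, E) ∞ (fun y => L (ψ y)) ψ.source :=
        L.contDiff.contMDiff.comp_contMDiffOn (contMDiffOn_modelChart (h x))
      have h2 : ∀ y ∈ (h.symm ⁻¹' (h.toOpenPartialHomeomorph.trans
          (ψ.trans L.toHomeomorph.toOpenPartialHomeomorph)).source), y ∈ ψ.source := by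
        intro y hy
        simpa using hy
      refine (h1.mono h2).congr fun y hy => ?_
      change L (ψ (h (h.symm y))) = _
      rw [h.apply_symm_apply]
    · have h1 : ContMDiffOn 𝓘(ℝ, E) I ∞ (fun y => ψ.symm (L.symm y)) (L.symm ⁻¹' ψ.target) :=
        (contMDiffOn_modelChart_symm (h x)).comp L.symm.contDiff.contMDiff.contMDiffOn
          fun y hy => hy
      have h2 : ∀ y ∈ (h.toOpenPartialHomeomorph.trans
          (ψ.trans L.toHomeomorph.toOpenPartialHomeomorph)).target, L.symm y ∈ ψ.target := by
        intro y hy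
        simpa using hy
      refine (h1.mono h2).congr fun y hy => ?_
      change h (h.symm (ψ.symm (L.symm y))) = _
      rw [h.apply_symm_apply]
    · have h2 : h x ∈ ψ.source := by rw [modelChart_source]; exact mem_extChartAt_source _
      simpa using h2
  obtain ⟨C, hM, hC⟩ := exists_chartedSpace_of_charts Good hx fun c c' hc hc' u hu hu' => by
    rw [← contMDiffAt_iff_contDiffAt]
    have h1 := hc.2.contMDiffAt (c.open_target.mem_nhds hu)
    have hu2 : h (c.symm u) ∈ h.symm ⁻¹' c'.source := by
      rwa [mem_preimage, h.symm_apply_apply]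
    have h2 := hc'.1.contMDiffAt ((ho c').mem_nhds hu2)
    have h3 := h2.comp u h1
    refine h3.congr_of_eventuallyEq (Eventually.of_forall fun w => ?_)
    change _ = c' (h.symm (h (c.symm w)))
    rw [h.symm_apply_apply]
  refine ⟨C, hM, fun x => ?_, fun y => ?_⟩
  · obtain ⟨c, hc, hxc⟩ := hx x
    have h1 := (hC c hc).1.contMDiffAt (c.open_source.mem_nhds hxc)
    have h2 := (hc.2.contMDiffAt (c.open_target.mem_nhds (c.map_source hxc))).comp x h1
    refine h2.congr_of_eventuallyEq ?_
    filter_upwards [c.open_source.mem_nhds hxc] with w hw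
    change h w = h (c.symm (c w))
    rw [c.left_inv hw]
  · obtain ⟨c, hc, hxc⟩ := hx (h.symm y)
    have h1 := hc.1.contMDiffAt ((ho c).mem_nhds hxc)
    have h2 := ((hC c hc).2.contMDiffAt (c.open_target.mem_nhds (c.map_source hxc))).comp y h1
    refine h2.congr_of_eventuallyEq ?_
    filter_upwards [(ho c).mem_nhds hxc] with w hw
    change h.symm w = c.symm (c (h.symm w))
    rw [c.left_inv hw]

end Charts

/-! ### Level sets of regular values. -/

section LevelSets

variable {E : Type*} [NormedAddCommGroup E] [NormedSpace ℝ E] [FiniteDimensional ℝ E]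
  {H : Type*} [TopologicalSpace H] {I : ModelWithCorners ℝ E H} [I.Boundaryless]
  {M : Type*} [TopologicalSpace M] [ChartedSpace H M] [IsManifold I ∞ M]
  {F : Type*} [NormedAddCommGroup F] [NormedSpace ℝ F] [FiniteDimensional ℝ F]

/-- A submersion is, in suitable local coordinates, a linear projection. -/
theorem exists_straightening {J : M → F} (hJ : ContMDiff I 𝓘(ℝ, F) ∞ J) {x : M}
    (hs : Function.Surjective (mfderiv I 𝓘(ℝ, F) J x)) {d : ℕ}
    (hd : d + Module.finrank ℝ F = Module.finrank ℝ E) :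
    ∃ e : OpenPartialHomeomorph M (F × EuclideanSpace ℝ (Fin d)), x ∈ e.source ∧
      (∀ y ∈ e.source, (e y).1 = J y) ∧
      ContMDiffOn I 𝓘(ℝ, F × EuclideanSpace ℝ (Fin d)) ∞ e e.source ∧
      ContMDiffOn 𝓘(ℝ, F × EuclideanSpace ℝ (Fin d)) I ∞ e.symm e.target := by
  obtain ⟨Q, hQ⟩ := exists_bijective_prod (E := E) (F := F) (G := EuclideanSpace ℝ (Fin d))
    (T := (mfderiv I 𝓘(ℝ, F) J x : E →L[ℝ] F)) hs (by rw [finrank_euclideanSpace_fin]; exact hd)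
  let h : M → F × EuclideanSpace ℝ (Fin d) := fun y => (J y, Q (extChartAt I x y))
  have hsm : ∀ᶠ y in 𝓝 x, ContMDiffAt I 𝓘(ℝ, F × EuclideanSpace ℝ (Fin d)) ∞ h y := by
    filter_upwards [extChartAt_source_mem_nhds (I := I) x] with y hy
    exact (hJ y).prodMk_space (Q.contDiff.contMDiff.contMDiffAt.comp y
      (contMDiffAt_extChartAt' (by rwa [extChartAt_source] at hy)))
  have hder : (mfderiv I 𝓘(ℝ, F × EuclideanSpace ℝ (Fin d)) h x :
      E →L[ℝ] F × EuclideanSpace ℝ (Fin d)) = (mfderiv I 𝓘(ℝ, F) J x : E →L[ℝ] F).prod Q := by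
    have h2 : HasMFDerivAt I 𝓘(ℝ, E) (extChartAt I x) x (ContinuousLinearMap.id ℝ E) := by
      have := (mdifferentiableAt_extChartAt (I := I) (mem_chart_source H x)).hasMFDerivAt
      rw [mfderiv_extChartAt_self] at this
      exact this
    exact (hasMFDerivAt_prodMk_space ((hJ x).mdifferentiableAt (by simp)).hasMFDerivAt
      ((Q.hasMFDerivAt (x := extChartAt I x x)).comp x h2)).mfderiv
  obtain ⟨e, hxe, heq, hes, het⟩ := exists_localDiffeo hsm
    (show Function.Bijective (mfderiv I 𝓘(ℝ, F × EuclideanSpace ℝ (Fin d)) h x :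
      E →L[ℝ] F × EuclideanSpace ℝ (Fin d)) by rw [hder]; exact hQ)
  exact ⟨e, hxe, fun y hy => congrArg Prod.fst (heq hy), hes, het⟩

/-- The chart of a level set given by a straightening of the map. -/
def levelSetChart {J : M → F} {ν : F} {d : ℕ}
    (e : OpenPartialHomeomorph M (F × EuclideanSpace ℝ (Fin d)))
    (he : ∀ y ∈ e.source, (e y).1 = J y) (x : LevelSet (fun _ : Fin 1 => J) (fun _ => ν)) :
    OpenPartialHomeomorph (LevelSet (fun _ : Fin 1 => J) (fun _ => ν))
      (EuclideanSpace ℝ (Fin d)) where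
  toFun y := (e y.1).2
  -- The point `x` serves only as the value outside the target.
  invFun u := open scoped Classical in
    if h : (ν, u) ∈ e.target then
      ⟨e.symm (ν, u), fun _ => by
        change J (e.symm (ν, u)) = ν
        rw [← he _ (e.map_target h), e.right_inv h]⟩ else x
  source := {y | y.1 ∈ e.source}
  target := {u | (ν, u) ∈ e.target}
  map_source' y hy := by
    have h1 : (ν, (e y.1).2) = e y.1 := Prod.ext ((y.2 0).symm.trans (he _ hy).symm) rfl
    change (ν, (e y.1).2) ∈ e.target
    rw [h1]
    exact e.map_source hy
  map_target' u hu := by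
    change (ν, u) ∈ e.target at hu
    simp only [hu, dite_true]
    exact e.map_target hu
  left_inv' y hy := by
    have h1 : (ν, (e y.1).2) = e y.1 := Prod.ext ((y.2 0).symm.trans (he _ hy).symm) rfl
    have h2 : (ν, (e y.1).2) ∈ e.target := by
      rw [h1]
      exact e.map_source hy
    simp only [h2, dite_true]
    refine Subtype.ext ?_
    change e.symm (ν, (e y.1).2) = y.1
    rw [h1, e.left_inv hy]
  right_inv' u hu := by
    change (ν, u) ∈ e.target at hu
    simp only [hu, dite_true]
    rw [e.right_inv hu]
  open_source := e.open_source.preimage continuous_subtype_val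
  open_target := e.open_target.preimage (Continuous.prodMk_right ν)
  continuousOn_toFun := continuous_snd.comp_continuousOn
    (e.continuousOn.comp continuous_subtype_val.continuousOn fun _ hy => hy)
  continuousOn_invFun := by
    refine (IsEmbedding.subtypeVal (X := M)).isInducing.continuousOn_iff.2 ?_
    refine (e.continuousOn_symm.comp (Continuous.prodMk_right ν).continuousOn
      fun u hu => hu).congr fun u hu => ?_
    change (ν, u) ∈ e.target at hu
    simp only [Function.comp_apply, hu, dite_true]

omit [NormedSpace ℝ F] [FiniteDimensional ℝ F] in
theorem levelSetChart_symm_val {J : M → F} {ν : F} {d : ℕ}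
    (e : OpenPartialHomeomorph M (F × EuclideanSpace ℝ (Fin d)))
    (he : ∀ y ∈ e.source, (e y).1 = J y) (x : LevelSet (fun _ : Fin 1 => J) (fun _ => ν))
    {u : EuclideanSpace ℝ (Fin d)} (hu : u ∈ (levelSetChart e he x).target) :
    ((levelSetChart e he x).symm u).1 = e.symm (ν, u) :=
   congrArg Subtype.val (dif_pos hu)

/-- The level set of a regular value is an embedded submanifold. -/
theorem exists_manifold_levelSet {J : M → F} (hJ : ContMDiff I 𝓘(ℝ, F) ∞ J) {ν : F}
    (hν : IsRegularValue I J ν) {d : ℕ} (hd : LevelSet (fun _ : Fin 1 => J) (fun _ => ν) →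
      d + Module.finrank ℝ F = Module.finrank ℝ E) :
    ∃ (_ : ChartedSpace (EuclideanSpace ℝ (Fin d)) (LevelSet (fun _ : Fin 1 => J) (fun _ => ν)))
      (_ : IsManifold 𝓘(ℝ, EuclideanSpace ℝ (Fin d)) ∞
        (LevelSet (fun _ : Fin 1 => J) (fun _ => ν))),
      Manifold.IsSmoothEmbedding 𝓘(ℝ, EuclideanSpace ℝ (Fin d)) I ∞
        (Subtype.val : LevelSet (fun _ : Fin 1 => J) (fun _ => ν) → M) := by
  let N := LevelSet (fun _ : Fin 1 => J) (fun _ => ν)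
  -- Admitted charts extend locally to smooth maps `k` on `M` and have inverses that are smooth into
  -- `M`. A transition map is then `k` after such an inverse, with no reference to a structure on
  -- `N`.
  let Good : OpenPartialHomeomorph N (EuclideanSpace ℝ (Fin d)) → Prop := fun c =>
    (∀ y ∈ c.source, ∃ k : M → EuclideanSpace ℝ (Fin d),
      ContMDiffAt I 𝓘(ℝ, EuclideanSpace ℝ (Fin d)) ∞ k y.1 ∧ ∀ᶠ z in 𝓝 y, c z = k z.1) ∧
    ContMDiffOn 𝓘(ℝ, EuclideanSpace ℝ (Fin d)) I ∞ (fun u => (c.symm u).1) c.target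
  have hx : ∀ x : N, ∃ c, Good c ∧ x ∈ c.source := fun x => by
    obtain ⟨e, hxe, hey, hes, het⟩ := exists_straightening hJ (hν x.1 (x.2 0)) (hd x)
    refine ⟨levelSetChart e hey x, ⟨fun y hy => ⟨fun z => (e z).2, ?_, ?_⟩, ?_⟩, hxe⟩
    · exact contDiff_snd.contMDiff.contMDiffAt.comp y.1
        (hes.contMDiffAt (e.open_source.mem_nhds hy))
    · exact Eventually.of_forall fun _ => rfl
    · refine ContMDiffOn.congr (f := fun u => e.symm (ν, u)) ?_ fun u hu =>
        levelSetChart_symm_val e hey x hu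
      exact het.comp (contDiff_prodMk_right ν).contMDiff.contMDiffOn fun u hu => hu
  obtain ⟨C, hM, hC⟩ := exists_chartedSpace_of_charts Good hx fun c c' hc hc' u hu hu' => by
    obtain ⟨k, hk, hkc⟩ := hc'.1 _ hu'
    rw [← contMDiffAt_iff_contDiffAt]
    have h1 := hc.2.contMDiffAt (c.open_target.mem_nhds hu)
    refine (ContMDiffAt.comp (g := k) u hk h1).congr_of_eventuallyEq ?_
    exact (c.continuousAt_symm hu).eventually hkc
  refine ⟨C, hM, ?_, IsEmbedding.subtypeVal⟩
  have hsm : ContMDiff 𝓘(ℝ, EuclideanSpace ℝ (Fin d)) I ∞ (Subtype.val : N → M) := fun x => by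
    obtain ⟨c, hc, hxc⟩ := hx x
    have h1 := (hC c hc).1.contMDiffAt (c.open_source.mem_nhds hxc)
    have h2 := (hc.2.contMDiffAt (c.open_target.mem_nhds (c.map_source hxc))).comp x h1
    refine h2.congr_of_eventuallyEq ?_
    filter_upwards [c.open_source.mem_nhds hxc] with w hw
    change w.1 = (c.symm (c w)).1
    rw [c.left_inv hw]
  have himm : Manifold.IsImmersionOfComplement F 𝓘(ℝ, EuclideanSpace ℝ (Fin d)) I ∞
      (Subtype.val : N → M) := fun x => by
    refine isImmersionAtOfComplement_of_injective (Eventually.of_forall fun y => hsm y) ?_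
      (by rw [finrank_euclideanSpace_fin]; exact hd x)
    obtain ⟨c, hc, hxc⟩ := hx x
    obtain ⟨k, hk, hkc⟩ := hc.1 x hxc
    -- Near `x` the chart is the restriction of `k`, so the derivative of `k` followed by that of
    -- `c.symm` is a left inverse of the derivative of the inclusion.
    refine Function.LeftInverse.injective (g := fun w => (mfderiv 𝓘(ℝ, EuclideanSpace ℝ (Fin d))
      𝓘(ℝ, EuclideanSpace ℝ (Fin d)) c.symm (c x) : EuclideanSpace ℝ (Fin d) →L[ℝ]
        EuclideanSpace ℝ (Fin d)) ((mfderiv I 𝓘(ℝ, EuclideanSpace ℝ (Fin d)) k x.1 : E →L[ℝ]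
          EuclideanSpace ℝ (Fin d)) w)) fun v => ?_
    have h1 := (hk.mdifferentiableAt (by simp)).hasMFDerivAt.comp x
      ((hsm x).mdifferentiableAt (by simp)).hasMFDerivAt
    have h2 : HasMFDerivAt 𝓘(ℝ, EuclideanSpace ℝ (Fin d)) 𝓘(ℝ, EuclideanSpace ℝ (Fin d)) c x _ :=
      h1.congr_of_eventuallyEq hkc
    have h3 := mfderiv_apply_of_rightInverse (I := 𝓘(ℝ, EuclideanSpace ℝ (Fin d)))
      (J := 𝓘(ℝ, EuclideanSpace ℝ (Fin d))) (f := c.symm) (σ := c) (q := x)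
      (((hC c hc).2.contMDiffAt (c.open_target.mem_nhds (c.map_source hxc))).mdifferentiableAt
        (by simp)) h2.mdifferentiableAt
      (by filter_upwards [c.open_source.mem_nhds hxc] with w hw using c.left_inv hw) v
    rw [h2.mfderiv] at h3
    exact h3
  exact himm.isImmersion

/-- The tangent space of a level set is the kernel of the derivative. -/
theorem range_mfderiv_levelSet {J : M → F} (hJ : ContMDiff I 𝓘(ℝ, F) ∞ J) {ν : F}
    (hν : IsRegularValue I J ν) {E' : Type*} [NormedAddCommGroup E'] [NormedSpace ℝ E']
    [ChartedSpace E' (LevelSet (fun _ : Fin 1 => J) (fun _ => ν))]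
    [IsManifold 𝓘(ℝ, E') ∞ (LevelSet (fun _ : Fin 1 => J) (fun _ => ν))]
    (hj : Manifold.IsSmoothEmbedding 𝓘(ℝ, E') I ∞
      (Subtype.val : LevelSet (fun _ : Fin 1 => J) (fun _ => ν) → M))
    (x : LevelSet (fun _ : Fin 1 => J) (fun _ => ν)) (v : E) :
    (∃ u : E', (mfderiv 𝓘(ℝ, E') I (Subtype.val :
      LevelSet (fun _ : Fin 1 => J) (fun _ => ν) → M) x : E' →L[ℝ] E) u = v) ↔
      (mfderiv I 𝓘(ℝ, F) J x.1 : E →L[ℝ] F) v = 0 := by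
  have hjs := hj.isImmersion.contMDiff
  have hjd := ((hjs x).mdifferentiableAt (by simp)).hasMFDerivAt
  have hJd := ((hJ x.1).mdifferentiableAt (by simp)).hasMFDerivAt
  constructor
  · rintro ⟨u, rfl⟩
    have h1 := hJd.comp x hjd
    have h2 : J ∘ (Subtype.val : LevelSet (fun _ : Fin 1 => J) (fun _ => ν) → M) =
      fun _ => ν := funext fun y => y.2 0
    rw [h2] at h1
    have h3 := hasMFDerivAt_unique h1 (hasMFDerivAt_const ν x)
    exact congrArg (fun T : E' →L[ℝ] F => T u) h3
  · intro hv
    have hs := hν x.1 (x.2 0)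
    obtain ⟨d, hd⟩ : ∃ d, d + Module.finrank ℝ F = Module.finrank ℝ E :=
      ⟨_, Nat.sub_add_cancel (LinearMap.finrank_le_finrank_of_surjective
        (f := (mfderiv I 𝓘(ℝ, F) J x.1 : E →L[ℝ] F).toLinearMap) hs)⟩
    obtain ⟨e, hxe, hey, hes, het⟩ := exists_straightening hJ hs hd
    set c := levelSetChart e hey x
    have hxc : x ∈ c.source := hxe
    -- The manifold structure on the level set is arbitrary here, so `c` need not be one of its
    -- charts. The map `c.symm` is smooth because its composition with the immersion is.
    have hτ : ContMDiffAt 𝓘(ℝ, EuclideanSpace ℝ (Fin d)) 𝓘(ℝ, E') ∞ c.symm (c x) := by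
      rw [ContMDiffAt.iff_comp_isImmersionAt (hj.isImmersion.isImmersionAt (c.symm (c x)))]
      refine ⟨c.continuousAt_symm (c.map_source hxc), ?_⟩
      have h1 : ContMDiffOn 𝓘(ℝ, EuclideanSpace ℝ (Fin d)) I ∞ (fun u => e.symm (ν, u)) c.target :=
        het.comp (contDiff_prodMk_right ν).contMDiff.contMDiffOn fun u hu => hu
      exact (h1.congr fun u hu => levelSetChart_symm_val e hey x hu).contMDiffAt
        (c.open_target.mem_nhds (c.map_source hxc))
    have hed := ((hes.contMDiffAt (e.open_source.mem_nhds hxe)).mdifferentiableAt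
      (by simp)).hasMFDerivAt
    have hed' := ((het.contMDiffAt (e.open_target.mem_nhds (e.map_source hxe))).mdifferentiableAt
      (by simp)).hasMFDerivAt
    set De : E →L[ℝ] F × EuclideanSpace ℝ (Fin d) :=
      mfderiv I 𝓘(ℝ, F × EuclideanSpace ℝ (Fin d)) e x.1
    set De' : F × EuclideanSpace ℝ (Fin d) →L[ℝ] E :=
      mfderiv 𝓘(ℝ, F × EuclideanSpace ℝ (Fin d)) I e.symm (e x.1)
    have hinv : De' (De v) = v :=
      mfderiv_apply_of_rightInverse (I := 𝓘(ℝ, F × EuclideanSpace ℝ (Fin d))) (J := I)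
        (f := e.symm) (σ := e) hed'.mdifferentiableAt hed.mdifferentiableAt
        (by filter_upwards [e.open_source.mem_nhds hxe] with w hw using e.left_inv hw) v
    -- In straightened coordinates `dJ v = 0` says that the first component vanishes; the second one
    -- is then the required direction in the level set.
    have hfst : (De v).1 = 0 := by
      have h1 : HasMFDerivAt I 𝓘(ℝ, F) (fun y => (e y).1) x.1
          ((ContinuousLinearMap.fst ℝ F (EuclideanSpace ℝ (Fin d))).comp De) :=
        ((ContinuousLinearMap.fst ℝ F (EuclideanSpace ℝ (Fin d))).hasMFDerivAt
          (x := e x.1)).comp x.1 hed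
      have h2 := hJd.congr_of_eventuallyEq (f₁ := fun y => (e y).1)
        (by filter_upwards [e.open_source.mem_nhds hxe] with w hw using hey w hw)
      have h3 := hasMFDerivAt_unique h1 h2
      exact (congrArg (fun T : E →L[ℝ] F => T v) h3).trans hv
    have hcomp := (hj.isImmersion.contMDiff (c.symm (c x))).mdifferentiableAt (by simp)
    have h1 := hcomp.hasMFDerivAt.comp (c x) (hτ.mdifferentiableAt (by simp)).hasMFDerivAt
    have hex : (ν, c x) = e x.1 := Prod.ext ((x.2 0).symm.trans (hey _ hxe).symm) rfl
    have h2 : HasMFDerivAt 𝓘(ℝ, EuclideanSpace ℝ (Fin d)) I (Subtype.val ∘ c.symm) (c x)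
        (De'.comp (ContinuousLinearMap.inr ℝ F (EuclideanSpace ℝ (Fin d)))) := by
      have h3 : HasMFDerivAt 𝓘(ℝ, EuclideanSpace ℝ (Fin d)) 𝓘(ℝ, F × EuclideanSpace ℝ (Fin d))
          (fun u => (ν, u)) (c x) (ContinuousLinearMap.inr ℝ F (EuclideanSpace ℝ (Fin d))) :=
        (hasFDerivAt_prodMk_right (𝕜 := ℝ) ν (c x)).hasMFDerivAt
      have h4 : HasMFDerivAt 𝓘(ℝ, F × EuclideanSpace ℝ (Fin d)) I e.symm (ν, c x) De' := by
        rw [hex]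
        exact hed'
      refine (h4.comp (c x) h3).congr_of_eventuallyEq ?_
      filter_upwards [c.open_target.mem_nhds (c.map_source hxc)] with u hu
      exact levelSetChart_symm_val e hey x hu
    have h5 := hasMFDerivAt_unique h1 h2
    have h6 := congrArg (fun T : EuclideanSpace ℝ (Fin d) →L[ℝ] E => T (De v).2) h5
    have h7 : ((0 : F), (De v).2) = De v := Prod.ext hfst.symm rfl
    change _ = De' (0, (De v).2) at h6
    rw [h7, hinv, c.left_inv hxc] at h6
    exact ⟨_, h6⟩

end LevelSets

/-! ### Slices for free and proper actions. -/

section Slice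

variable {EG : Type*} [NormedAddCommGroup EG] [NormedSpace ℝ EG] [FiniteDimensional ℝ EG]
  (G : Type*) [TopologicalSpace G] [ChartedSpace EG G] [Group G] [LieGroup 𝓘(ℝ, EG) ∞ G]
  {E : Type*} [NormedAddCommGroup E] [NormedSpace ℝ E] [FiniteDimensional ℝ E]
  {M : Type*} [TopologicalSpace M] [ChartedSpace E M] [IsManifold 𝓘(ℝ, E) ∞ M]
  [MulAction G M] [ContMDiffSMul 𝓘(ℝ, EG) 𝓘(ℝ, E) ∞ G M]

omit [FiniteDimensional ℝ EG] [FiniteDimensional ℝ E] [LieGroup 𝓘(ℝ, EG) ∞ G]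
  [IsManifold 𝓘(ℝ, E) ∞ M] in
theorem contMDiff_smul_point (x : M) :
    ContMDiff 𝓘(ℝ, EG) 𝓘(ℝ, E) ∞ (fun g : G => g • x) :=
  ContMDiff.smul contMDiff_id contMDiff_const

/-- The infinitesimal action at a point, i.e. the derivative of the orbit map. -/
def orbitDeriv (x : M) : EG →L[ℝ] E :=
  mfderiv 𝓘(ℝ, EG) 𝓘(ℝ, E) (fun g : G => g • x) 1

omit [FiniteDimensional ℝ EG] [FiniteDimensional ℝ E] [LieGroup 𝓘(ℝ, EG) ∞ G]
  [IsManifold 𝓘(ℝ, E) ∞ M] in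
theorem hasMFDerivAt_smul_point (x : M) :
    HasMFDerivAt 𝓘(ℝ, EG) 𝓘(ℝ, E) (fun g : G => g • x) 1 (orbitDeriv G x : EG →L[ℝ] E) :=
  ((contMDiff_smul_point G x 1).mdifferentiableAt (by simp)).hasMFDerivAt

/-- For a free and proper action, the group elements moving a point near `x` to a point near `x`
are close to the identity. -/
theorem eventually_smul_eq_mem {G X : Type*} [TopologicalSpace G] [Group G] [TopologicalSpace X]
    [MulAction G X] [ProperSMul G X] (hfree : ∀ (g : G) (x : X), g • x = x → g = 1) (x₀ : X)
    {P : G × X → Prop} (hP : ∀ᶠ p in 𝓝 (1, x₀), P p) :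
    ∀ᶠ p : X × X in 𝓝 (x₀, x₀), ∀ g : G, g • p.1 = p.2 → P (g, p.1) := by
  -- A closed map carries a property near a whole fibre to all nearby fibres, and freeness reduces
  -- the fibre over `(x₀, x₀)` to the point `(1, x₀)`.
  have hc := (ProperSMul.isProperMap_smul_pair (G := G) (X := X)).isClosedMap
  have h1 := hc.eventually_nhds_fiber (p := P) (x₀, x₀) (by
    rintro ⟨g, y⟩ hgy
    have h2 : (g • y, y) = (x₀, x₀) := hgy
    obtain ⟨h3, rfl⟩ := Prod.ext_iff.1 h2
    obtain rfl := hfree g _ h3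
    exact hP)
  have h2 : Tendsto (fun p : X × X => (p.2, p.1)) (𝓝 (x₀, x₀)) (𝓝 (x₀, x₀)) :=
    continuous_swap.continuousAt (x := (x₀, x₀))
  filter_upwards [h2.eventually h1] with p hp g hg
  exact hp (g, p.1) (by rw [mem_preimage, mem_singleton_iff, hg])

/-- A slice for a free and proper action at a point with injective infinitesimal action: a smooth
local map whose fibres are the intersections with the orbits. -/
theorem exists_slice [ProperSMul G M] (hfree : ∀ (g : G) (x : M), g • x = x → g = 1) (x₀ : M)
    (hinj : Function.Injective (orbitDeriv G x₀ : EG →L[ℝ] E)) {m : ℕ}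
    (hm : Module.finrank ℝ EG + m = Module.finrank ℝ E) :
    ∃ q : M → EuclideanSpace ℝ (Fin m),
      (∀ᶠ x in 𝓝 x₀, ContMDiffAt 𝓘(ℝ, E) 𝓘(ℝ, EuclideanSpace ℝ (Fin m)) ∞ q x ∧
        (Function.Injective (orbitDeriv G x : EG →L[ℝ] E) → ∀ v : E,
          (mfderiv 𝓘(ℝ, E) 𝓘(ℝ, EuclideanSpace ℝ (Fin m)) q x :
            E →L[ℝ] EuclideanSpace ℝ (Fin m)) v = 0 ↔ ∃ ξ : EG, orbitDeriv G x ξ = v)) ∧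
      ∀ᶠ p : M × M in 𝓝 (x₀, x₀), q p.1 = q p.2 ↔ ∃ g : G, g • p.1 = p.2 := by
  set V := EuclideanSpace ℝ (Fin m)
  obtain ⟨Q, hQ⟩ := exists_bijective_coprod (E := EG) (F := E) (G := V)
    (T := (orbitDeriv G x₀ : EG →L[ℝ] E)) hinj (by rw [finrank_euclideanSpace_fin]; exact hm)
  set φ := modelChart 𝓘(ℝ, E) x₀ with hφ
  have hφs : x₀ ∈ φ.source := by rw [modelChart_source]; exact mem_extChartAt_source _
  have hφt : φ x₀ ∈ φ.target := φ.map_source hφs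
  have hφsm : ∀ y ∈ φ.source, ContMDiffAt 𝓘(ℝ, E) 𝓘(ℝ, E) ∞ φ y := fun y hy =>
    (contMDiffOn_modelChart x₀).contMDiffAt (φ.open_source.mem_nhds hy)
  have hφsm' : ∀ y ∈ φ.target, ContMDiffAt 𝓘(ℝ, E) 𝓘(ℝ, E) ∞ φ.symm y := fun y hy =>
    (contMDiffOn_modelChart_symm x₀).contMDiffAt (φ.open_target.mem_nhds hy)
  -- An affine transversal to the orbit, in a chart. Moving it by group elements is a local
  -- diffeomorphism at `(1, 0)`; below, `k` is its local inverse and the slice is the `V`-component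
  -- of `k`.
  let ℓ : V → E := fun s => φ x₀ + Q s
  have hℓ : ContDiff ℝ ∞ ℓ := contDiff_const.add Q.contDiff
  have hℓ0 : ℓ 0 = φ x₀ := by simp [ℓ]
  let f₀ : G × V → M := fun p => p.1 • φ.symm (ℓ p.2)
  have hf₀0 : f₀ (1, 0) = x₀ := by
    change (1 : G) • φ.symm (ℓ 0) = x₀
    rw [one_smul, hℓ0, φ.left_inv hφs]
  have hf₀s : ∀ p : G × V, ℓ p.2 ∈ φ.target →
      ContMDiffAt (𝓘(ℝ, EG).prod 𝓘(ℝ, V)) 𝓘(ℝ, E) ∞ f₀ p := fun p hp => by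
    refine ContMDiffAt.smul contMDiffAt_fst ?_
    exact (hφsm' _ hp).comp p (hℓ.contMDiff.contMDiffAt.comp p contMDiffAt_snd)
  have hℓt : ∀ᶠ p : G × V in 𝓝 (1, 0), ℓ p.2 ∈ φ.target := by
    have h1 : ContinuousAt (fun p : G × V => ℓ p.2) (1, 0) :=
      (hℓ.continuous.comp continuous_snd).continuousAt
    exact h1.eventually (φ.open_target.mem_nhds (by
      change ℓ 0 ∈ φ.target
      rw [hℓ0]
      exact hφt))
  have hf₀c : ∀ᶠ p : G × V in 𝓝 (1, 0), f₀ p ∈ φ.source :=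
    (hf₀s _ hℓt.self_of_nhds).continuousAt.eventually
      (φ.open_source.mem_nhds (by rw [hf₀0]; exact hφs))
  let f : G × V → E := fun p => φ (f₀ p)
  have hfs : ∀ᶠ p : G × V in 𝓝 (1, 0),
      ContMDiffAt (𝓘(ℝ, EG).prod 𝓘(ℝ, V)) 𝓘(ℝ, E) ∞ f p := by
    filter_upwards [hℓt, hf₀c] with p hp hp'
    exact (hφsm _ hp').comp p (hf₀s p hp)
  have hfder : ∀ v : EG × V, (mfderiv (𝓘(ℝ, EG).prod 𝓘(ℝ, V)) 𝓘(ℝ, E) f (1, 0) :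
      EG × V →L[ℝ] E) v = (orbitDeriv G x₀ : EG →L[ℝ] E) v.1 + Q v.2 := fun v => by
    refine (mfderiv_prod_eq_add_apply (hfs.self_of_nhds.mdifferentiableAt (by simp))).trans ?_
    have h1 : HasMFDerivAt 𝓘(ℝ, EG) 𝓘(ℝ, E) (fun g : G => f (g, 0)) 1
        (orbitDeriv G x₀ : EG →L[ℝ] E) := by
      have h2 : (fun g : G => f (g, 0)) = φ ∘ fun g : G => g • x₀ := by
        funext g
        change φ (g • φ.symm (ℓ 0)) = φ (g • x₀)
        rw [hℓ0, φ.left_inv hφs]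
      rw [h2]
      have h3 : HasMFDerivAt 𝓘(ℝ, E) 𝓘(ℝ, E) φ ((1 : G) • x₀) (ContinuousLinearMap.id ℝ E) := by
        rw [one_smul]
        have := (mdifferentiableAt_extChartAt (I := 𝓘(ℝ, E)) (mem_chart_source E x₀)).hasMFDerivAt
        rw [mfderiv_extChartAt_self] at this
        exact this
      exact h3.comp (1 : G) (hasMFDerivAt_smul_point (EG := EG) G x₀)
    have h4 : HasMFDerivAt 𝓘(ℝ, V) 𝓘(ℝ, E) (fun s : V => f (1, s)) 0 Q := by
      have h5 : HasMFDerivAt 𝓘(ℝ, V) 𝓘(ℝ, E) ℓ 0 Q := (Q.hasFDerivAt.const_add _).hasMFDerivAt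
      refine h5.congr_of_eventuallyEq ?_
      filter_upwards [hℓ.continuous.continuousAt.eventually
        (φ.open_target.mem_nhds (by rw [hℓ0]; exact hφt))] with s hs
      change φ ((1 : G) • φ.symm (ℓ s)) = ℓ s
      rw [one_smul, φ.right_inv hs]
    rw [h1.mfderiv, h4.mfderiv]
    rfl
  have hb : Function.Bijective (mfderiv (𝓘(ℝ, EG).prod 𝓘(ℝ, V)) 𝓘(ℝ, E) f (1, 0)) := by
    have h1 : ⇑(mfderiv (𝓘(ℝ, EG).prod 𝓘(ℝ, V)) 𝓘(ℝ, E) f (1, 0) : EG × V →L[ℝ] E) =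
        ⇑((orbitDeriv G x₀ : EG →L[ℝ] E).coprod Q) := funext hfder
    exact h1 ▸ hQ
  obtain ⟨e, hxe, heq, hes, het⟩ := exists_localDiffeo hfs hb
  have hex : e (1, 0) = φ x₀ := by
    rw [heq hxe]
    change φ (f₀ (1, 0)) = _
    rw [hf₀0]
  have hxt : φ x₀ ∈ e.target := by
    rw [← hex]
    exact e.map_source hxe
  have hex' : e.symm (φ x₀) = (1, 0) := by rw [← hex, e.left_inv hxe]
  let k : M → G × V := fun x => e.symm (φ x)
  have hk0 : k x₀ = (1, 0) := hex'
  have hks : ∀ᶠ x in 𝓝 x₀, ContMDiffAt 𝓘(ℝ, E) (𝓘(ℝ, EG).prod 𝓘(ℝ, V)) ∞ k x := by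
    filter_upwards [φ.open_source.mem_nhds hφs,
      (φ.continuousAt hφs).eventually (e.open_target.mem_nhds hxt)] with x hx hx'
    exact (het.contMDiffAt (e.open_target.mem_nhds hx')).comp x (hφsm x hx)
  have hkc : ContinuousAt k x₀ := hks.self_of_nhds.continuousAt
  have hA : ∀ᶠ x in 𝓝 x₀, f₀ (k x) = x := by
    have h1 : ∀ᶠ p in 𝓝 (k x₀), f₀ p ∈ φ.source := by rwa [hk0]
    filter_upwards [φ.open_source.mem_nhds hφs, hkc.eventually h1,
      (φ.continuousAt hφs).eventually (e.open_target.mem_nhds hxt)] with x hx hx1 hx2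
    refine φ.injOn hx1 hx ?_
    change f (k x) = φ x
    rw [← heq (e.map_target hx2)]
    exact e.right_inv hx2
  -- For `g` near `1`, multiplying the `G`-coordinate by `g` stays inside the source of `e`, so `g •
  -- x` and `x` have the same transversal coordinate.
  have hB : ∀ᶠ p : G × M in 𝓝 (1, x₀), (k (p.1 • p.2)).2 = (k p.2).2 := by
    have h1 : ContinuousAt (fun p : G × M => (p.1 * (k p.2).1, (k p.2).2)) (1, x₀) := by
      have h2 : ContinuousAt (fun p : G × M => k p.2) (1, x₀) :=
        ContinuousAt.comp (f := Prod.snd) (g := k) hkc continuousAt_snd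
      have := topologicalGroup_of_lieGroup 𝓘(ℝ, EG) ∞ (G := G)
      exact (continuousAt_fst.mul (continuousAt_fst.comp h2)).prodMk (continuousAt_snd.comp h2)
    have h3 : ∀ᶠ p in 𝓝 ((1 : G) * (k x₀).1, (k x₀).2), p ∈ e.source := by
      rw [hk0, one_mul]
      exact e.open_source.mem_nhds hxe
    filter_upwards [h1.eventually h3, continuousAt_snd.eventually hA] with p hp hpA
    have h4 : f (p.1 * (k p.2).1, (k p.2).2) = φ (p.1 • p.2) := by
      conv_rhs => rw [← hpA]
      change φ ((p.1 * (k p.2).1) • _) = φ (p.1 • (k p.2).1 • _)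
      rw [mul_smul]
    rw [← heq hp] at h4
    change (e.symm (φ (p.1 • p.2))).2 = _
    rw [← h4, e.left_inv hp]
  -- Varying `s` with the `G`-coordinate of `x` fixed gives a section through `x`.
  have hsurj : ∀ᶠ x in 𝓝 x₀, Function.Surjective (mfderiv 𝓘(ℝ, E) 𝓘(ℝ, V) (fun y => (k y).2) x :
      E →L[ℝ] V) := by
    filter_upwards [hks, φ.open_source.mem_nhds hφs,
      (φ.continuousAt hφs).eventually (e.open_target.mem_nhds hxt)] with x hx hxs hxe
    have hks' : k x ∈ e.source := e.map_target hxe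
    have hek : e (k x) = φ x := e.right_inv hxe
    let τ : V → M := fun s => φ.symm (e ((k x).1, s))
    have hτx : τ (k x).2 = x := by
      change φ.symm (e (k x)) = x
      rw [hek, φ.left_inv hxs]
    have hc1 : ContMDiff 𝓘(ℝ, V) (𝓘(ℝ, EG).prod 𝓘(ℝ, V)) ∞ (fun s : V => ((k x).1, s)) :=
      contMDiff_const.prodMk contMDiff_id
    have hτ1 : ContMDiffAt 𝓘(ℝ, V) 𝓘(ℝ, E) ∞ (fun s : V => e ((k x).1, s)) (k x).2 :=
      ContMDiffAt.comp (g := e) (k x).2 (hes.contMDiffAt (e.open_source.mem_nhds hks')) (hc1 _)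
    have hφx : φ x ∈ φ.target := φ.map_source hxs
    have hτ : ContMDiffAt 𝓘(ℝ, V) 𝓘(ℝ, E) ∞ τ (k x).2 := by
      refine ContMDiffAt.comp (g := φ.symm) (k x).2 (hφsm' _ ?_) hτ1
      change e (k x) ∈ _
      rwa [hek]
    have hr : ∀ᶠ s in 𝓝 (k x).2, (k (τ s)).2 = s := by
      have h1 : ∀ᶠ u in 𝓝 (e ((k x).1, (k x).2)), u ∈ φ.target := by
        change ∀ᶠ u in 𝓝 (e (k x)), u ∈ φ.target
        rw [hek]
        exact φ.open_target.mem_nhds hφx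
      filter_upwards [hτ1.continuousAt.eventually h1,
        (hc1.continuous.continuousAt (x := (k x).2)).eventually
          (e.open_source.mem_nhds hks')] with s hs hs'
      change (e.symm (φ (φ.symm (e ((k x).1, s))))).2 = s
      rw [φ.right_inv hs, e.left_inv hs']
    have hq : MDifferentiableAt 𝓘(ℝ, E) 𝓘(ℝ, V) (fun y => (k y).2) x :=
      (contMDiffAt_snd.comp x hx).mdifferentiableAt (by simp)
    intro v
    have h := mfderiv_apply_of_rightInverse (I := 𝓘(ℝ, E)) (J := 𝓘(ℝ, V))
      (f := fun y => (k y).2) (σ := τ) (q := (k x).2) (by rwa [hτx])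
      (hτ.mdifferentiableAt (by simp)) hr v
    rw [hτx] at h
    exact ⟨_, h⟩
  refine ⟨fun x => (k x).2, ?_, ?_⟩
  · have hB2 : ∀ᶠ x in 𝓝 x₀, ∀ᶠ g : G in 𝓝 1, (k (g • x)).2 = (k x).2 :=
      ((continuous_swap.tendsto (x₀, (1 : G))).eventually hB).curry_nhds
    filter_upwards [hks, hsurj, hB2] with x hx hxs hxB
    have hq : ContMDiffAt 𝓘(ℝ, E) 𝓘(ℝ, V) ∞ (fun y => (k y).2) x := contMDiffAt_snd.comp x hx
    refine ⟨hq, fun hxi => ?_⟩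
    set D : E →L[ℝ] V := mfderiv 𝓘(ℝ, E) 𝓘(ℝ, V) (fun y => (k y).2) x with hD
    -- The slice map is locally constant along the orbit of `x`; equality then follows by counting
    -- dimensions.
    have hle : LinearMap.range (orbitDeriv G x : EG →L[ℝ] E).toLinearMap ≤
        LinearMap.ker D.toLinearMap := by
      rintro _ ⟨ξ, rfl⟩
      have h1 : HasMFDerivAt 𝓘(ℝ, EG) 𝓘(ℝ, V) ((fun y => (k y).2) ∘ fun g : G => g • x) 1
          (D.comp (orbitDeriv G x : EG →L[ℝ] E)) := by
        refine HasMFDerivAt.comp (1 : G) ?_ (hasMFDerivAt_smul_point G x)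
        rw [one_smul]
        exact (hq.mdifferentiableAt (by simp)).hasMFDerivAt
      have h2 := (hasMFDerivAt_const (I := 𝓘(ℝ, EG)) (I' := 𝓘(ℝ, V)) (k x).2
        (1 : G)).congr_of_eventuallyEq (f₁ := (fun y => (k y).2) ∘ fun g : G => g • x) hxB
      exact congrArg (fun T : EG →L[ℝ] V => T ξ) (hasMFDerivAt_unique h1 h2)
    have hdim : m + Module.finrank ℝ (LinearMap.ker D.toLinearMap) = Module.finrank ℝ E := by
      have h1 := D.toLinearMap.finrank_range_add_finrank_ker
      have h2 : LinearMap.range D.toLinearMap = ⊤ := LinearMap.range_eq_top.2 hxs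
      rw [h2, finrank_top, finrank_euclideanSpace_fin] at h1
      exact h1
    have hrange : Module.finrank ℝ (LinearMap.range (orbitDeriv G x : EG →L[ℝ] E).toLinearMap) =
        Module.finrank ℝ EG := LinearMap.finrank_range_of_inj hxi
    have heq := Submodule.eq_of_le_of_finrank_eq hle (by omega)
    intro v
    change v ∈ LinearMap.ker D.toLinearMap ↔ _
    rw [← heq]
    rfl
  · have hA2 : ∀ᶠ p : M × M in 𝓝 (x₀, x₀), f₀ (k p.1) = p.1 ∧ f₀ (k p.2) = p.2 :=
      ((continuous_fst.tendsto (x₀, x₀)).eventually hA).and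
        ((continuous_snd.tendsto (x₀, x₀)).eventually hA)
    -- Freeness and properness force any `g` relating two points near `x₀` into the range where `hB`
    -- applies.
    filter_upwards [hA2, eventually_smul_eq_mem hfree x₀ hB] with p hp hp'
    constructor
    · intro h
      refine ⟨(k p.2).1 * (k p.1).1⁻¹, ?_⟩
      calc ((k p.2).1 * (k p.1).1⁻¹) • p.1
          = ((k p.2).1 * (k p.1).1⁻¹) • (k p.1).1 • φ.symm (ℓ (k p.1).2) := congrArg _ hp.1.symm
        _ = (k p.2).1 • φ.symm (ℓ (k p.2).2) := by rw [smul_smul, inv_mul_cancel_right, h]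
        _ = p.2 := hp.2
    · rintro ⟨g, hg⟩
      rw [← hg]
      exact (hp' g hg).symm

end Slice

/-! ### Topology of the orbit space. -/

section OrbitTopology

variable {EG : Type*} [NormedAddCommGroup EG] [NormedSpace ℝ EG]
  {HG : Type*} [TopologicalSpace HG] {IG : ModelWithCorners ℝ EG HG}
  {G : Type*} [TopologicalSpace G] [ChartedSpace HG G] [Group G]
  {M : Type*} [MulAction G M] {k : ℕ}
  {J : Fin k → M → (EG →L[ℝ] ℝ)} {μ : Fin k → (EG →L[ℝ] ℝ)}

/-- Points of the level set of an equivariant map are related as soon as they are in the same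
orbit of the full group. -/
theorem orbitRel_iff (hJ : ∀ (g : G) (a : Fin k) (x : M), J a (g • x) = coAd IG g (J a x))
    (x y : LevelSet J μ) : orbitRel IG G J μ x y ↔ ∃ g : G, g • x.1 = y.1 := by
  refine ⟨fun ⟨g, _, h⟩ => ⟨g, h⟩, fun ⟨g, h⟩ => ⟨g, fun a => ?_, h⟩⟩
  rw [← x.2 a, ← hJ, h, y.2 a, x.2 a]

theorem orbitSpace_mk_eq_iff
    (hJ : ∀ (g : G) (a : Fin k) (x : M), J a (g • x) = coAd IG g (J a x)) (x y : LevelSet J μ) :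
    Quot.mk (orbitRel IG G J μ) x = Quot.mk (orbitRel IG G J μ) y ↔
      ∃ g : G, g • x.1 = y.1 := by
  rw [← orbitRel_iff hJ]
  refine Equivalence.quot_mk_eq_iff ⟨fun x => ?_, fun {x y} h => ?_, fun {x y z} h h' => ?_⟩ x y
  · exact (orbitRel_iff hJ _ _).2 ⟨1, one_smul _ _⟩
  · obtain ⟨g, hg⟩ := (orbitRel_iff hJ _ _).1 h
    exact (orbitRel_iff hJ _ _).2 ⟨g⁻¹, by rw [← hg, inv_smul_smul]⟩
  · obtain ⟨g, hg⟩ := (orbitRel_iff hJ _ _).1 h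
    obtain ⟨g', hg'⟩ := (orbitRel_iff hJ _ _).1 h'
    exact (orbitRel_iff hJ _ _).2 ⟨g' * g, by rw [mul_smul, hg, hg']⟩

variable [TopologicalSpace M]

/-- If `g` carries one point of the level set to another, then it fixes `μ`, so `g⁻¹` acts on the
whole level set and takes a neighbourhood of `y` into `U`. -/
theorem isOpenMap_orbitSpace_mk [ContinuousConstSMul G M]
    (hJ : ∀ (g : G) (a : Fin k) (x : M), J a (g • x) = coAd IG g (J a x)) :
    IsOpenMap (Quot.mk (orbitRel IG G J μ)) := by
  intro U hU
  change IsOpen (Quot.mk (orbitRel IG G J μ) ⁻¹' _)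
  rw [isOpen_iff_mem_nhds]
  rintro y ⟨x, hx, hxy⟩
  obtain ⟨g, hg⟩ := (orbitSpace_mk_eq_iff hJ x y).1 hxy
  have hgμ : ∀ a, coAd IG g (μ a) = μ a := fun a => by
    rw [← x.2 a, ← hJ, hg, y.2 a, x.2 a]
  have hgμ' : ∀ z : LevelSet J μ, ∀ a, J a (g⁻¹ • z.1) = μ a := fun z a => by
    have h1 : coAd IG g⁻¹ (μ a) = μ a := by
      rw [← y.2 a, ← hJ, ← hg, inv_smul_smul, x.2 a, hg, y.2 a]
    rw [hJ, z.2 a, h1]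
  let b : LevelSet J μ → LevelSet J μ := fun z => ⟨g⁻¹ • z.1, hgμ' z⟩
  have hb : Continuous b := (continuous_subtype_val.const_smul g⁻¹).subtype_mk _
  have hby : b y = x := Subtype.ext (by change g⁻¹ • y.1 = x.1; rw [← hg, inv_smul_smul])
  filter_upwards [hb.continuousAt.preimage_mem_nhds (hU.mem_nhds (by rwa [hby]))] with z hz
  exact ⟨b z, hz, (orbitSpace_mk_eq_iff hJ _ _).2 ⟨g, smul_inv_smul g z.1⟩⟩

/-- The orbit space maps injectively and continuously to the quotient of `M` by all of `G`, which is
Hausdorff by properness. -/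
theorem t2Space_orbitSpace [ProperSMul G M]
    (hJ : ∀ (g : G) (a : Fin k) (x : M), J a (g • x) = coAd IG g (J a x)) :
    T2Space (OrbitSpace IG G J μ) := by
  let s := MulAction.orbitRel G M
  let f : OrbitSpace IG G J μ → Quotient s := Quot.lift (fun x => Quotient.mk s x.1)
    fun x y h => by
      obtain ⟨g, hg⟩ := (orbitRel_iff hJ _ _).1 h
      exact Quotient.sound (s := s) ((MulAction.orbitRel_apply).2 ⟨g⁻¹, by
        change g⁻¹ • y.1 = x.1
        rw [← hg, inv_smul_smul]⟩)
  have hf : Continuous f := continuous_quot_lift _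
    ((continuous_quotient_mk' (s := s)).comp continuous_subtype_val)
  refine T2Space.of_injective_continuous (f := f) ?_ hf
  rintro ⟨x⟩ ⟨y⟩ h
  obtain ⟨g, hg⟩ := (MulAction.orbitRel_apply).1 (Quotient.exact (s := s) h)
  refine (orbitSpace_mk_eq_iff hJ x y).2 ⟨g⁻¹, ?_⟩
  change g • y.1 = x.1 at hg
  rw [← hg, inv_smul_smul]

theorem secondCountableTopology_orbitSpace [ContinuousConstSMul G M] [SecondCountableTopology M]
    (hJ : ∀ (g : G) (a : Fin k) (x : M), J a (g • x) = coAd IG g (J a x)) :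
    SecondCountableTopology (OrbitSpace IG G J μ) :=
  have : SecondCountableTopology (LevelSet J μ) :=
    TopologicalSpace.Subtype.secondCountableTopology {x | ∀ a, J a x = μ a}
  (isQuotientMap_quot_mk (r := orbitRel IG G J μ)).secondCountableTopology
    (isOpenMap_orbitSpace_mk hJ)

end OrbitTopology

/-! ### Orbit directions inside a level set. -/

section LevelGeometry

variable {EG : Type*} [NormedAddCommGroup EG] [NormedSpace ℝ EG] [FiniteDimensional ℝ EG]
  {G : Type*} [TopologicalSpace G] [ChartedSpace EG G] [Group G] [LieGroup 𝓘(ℝ, EG) ∞ G]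
  {E : Type*} [NormedAddCommGroup E] [NormedSpace ℝ E] [FiniteDimensional ℝ E]
  {M : Type*} [TopologicalSpace M] [ChartedSpace E M] [IsManifold 𝓘(ℝ, E) ∞ M]
  [MulAction G M] {w : Form 𝓘(ℝ, E) M 2} {l : Form 𝓘(ℝ, E) M 1} {J : M → (EG →L[ℝ] ℝ)}
  {ν : EG →L[ℝ] ℝ}

/-- The derivative of a map with values in the dual of the Lie algebra. -/
def momentumDeriv (J : M → (EG →L[ℝ] ℝ)) (x : M) : E →L[ℝ] EG →L[ℝ] ℝ :=
  mfderiv 𝓘(ℝ, E) 𝓘(ℝ, EG →L[ℝ] ℝ) J x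

omit [FiniteDimensional ℝ EG] [LieGroup 𝓘(ℝ, EG) ∞ G] [FiniteDimensional ℝ E]
  [IsManifold 𝓘(ℝ, E) ∞ M] in
-- The momentum identity with the evaluation at `ξ` taken out of the derivative: `dJ` is the
-- transpose of the infinitesimal action with respect to `w`.
theorem contract_eq (h : IsHamiltonianAction 𝓘(ℝ, EG) G (fun _ : Fin 1 => w) (fun _ => l)
    (fun _ => J)) (x : M) (ξ : EG) (v : E) :
    w x ![(orbitDeriv G x : EG →L[ℝ] E) ξ, v] =
      momentumDeriv J x v ξ := by
  refine (h.momentum.contract 0 ξ x v).trans ?_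
  have h1 := ((ContinuousLinearMap.apply ℝ ℝ ξ).hasMFDerivAt (x := J x)).comp x
    ((h.momentum.contMDiff 0 x).mdifferentiableAt (by simp)).hasMFDerivAt
  have h2 : HasMFDerivAt 𝓘(ℝ, E) 𝓘(ℝ, ℝ) (fun y : M => J y ξ) x _ := h1
  rw [h2.mfderiv]
  rfl

omit [FiniteDimensional ℝ EG] [LieGroup 𝓘(ℝ, EG) ∞ G] [FiniteDimensional ℝ E]
  [IsManifold 𝓘(ℝ, E) ∞ M] in
-- If `ξ` generates the zero vector at `x`, then `dJ(v)(ξ) = 0` for all `v`. As `dJ` is onto, every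
-- covector kills `ξ`.
theorem injective_orbitDeriv (h : IsHamiltonianAction 𝓘(ℝ, EG) G (fun _ : Fin 1 => w)
    (fun _ => l) (fun _ => J)) {x : M}
    (hs : Function.Surjective (mfderiv 𝓘(ℝ, E) 𝓘(ℝ, EG →L[ℝ] ℝ) J x)) :
    Function.Injective (orbitDeriv G x : EG →L[ℝ] E) := by
  rw [injective_iff_map_eq_zero]
  intro ξ hξ
  refine SeparatingDual.eq_zero_of_forall_dual_eq_zero (R := ℝ) fun f => ?_
  obtain ⟨v, rfl⟩ := hs f
  refine (contract_eq h x ξ v).symm.trans ?_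
  rw [hξ]
  exact (w x).map_coord_zero (m := ![0, v]) 0 rfl

variable (G) in
/-- The infinitesimal isotropy of `ν`. -/
def isotropyAlgebra (ν : EG →L[ℝ] ℝ) : Submodule ℝ EG :=
  LinearMap.ker (mfderiv 𝓘(ℝ, EG) 𝓘(ℝ, EG →L[ℝ] ℝ) (fun g : G => coAd 𝓘(ℝ, EG) g ν) 1 :
    EG →L[ℝ] EG →L[ℝ] ℝ).toLinearMap

omit [FiniteDimensional ℝ EG] [LieGroup 𝓘(ℝ, EG) ∞ G] [FiniteDimensional ℝ E]
  [IsManifold 𝓘(ℝ, E) ∞ M] in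
-- Differentiate `J (g • x) = coAd g ν` at `g = 1`.
theorem mfderiv_orbitDeriv_eq_zero_iff (h : IsHamiltonianAction 𝓘(ℝ, EG) G (fun _ : Fin 1 => w)
    (fun _ => l) (fun _ => J)) {x : M} (hx : J x = ν) (ξ : EG) :
    (mfderiv 𝓘(ℝ, E) 𝓘(ℝ, EG →L[ℝ] ℝ) J x : E →L[ℝ] EG →L[ℝ] ℝ)
      ((orbitDeriv G x : EG →L[ℝ] E) ξ) = 0 ↔ ξ ∈ isotropyAlgebra G ν := by
  have := h.smooth
  have h1 : HasMFDerivAt 𝓘(ℝ, EG) 𝓘(ℝ, EG →L[ℝ] ℝ) (J ∘ fun g : G => g • x) 1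
      ((mfderiv 𝓘(ℝ, E) 𝓘(ℝ, EG →L[ℝ] ℝ) J x : E →L[ℝ] EG →L[ℝ] ℝ).comp
        (orbitDeriv G x : EG →L[ℝ] E)) := by
    refine HasMFDerivAt.comp (1 : G) ?_ (hasMFDerivAt_smul_point G x)
    rw [one_smul]
    exact ((h.momentum.contMDiff 0 x).mdifferentiableAt (by simp)).hasMFDerivAt
  have h2 : (J ∘ fun g : G => g • x) = fun g : G => coAd 𝓘(ℝ, EG) g ν := by
    funext g
    rw [← hx]
    exact h.equivariant g 0 x
  rw [h2] at h1
  rw [isotropyAlgebra, h1.mfderiv]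
  rfl

variable {E' : Type*} [NormedAddCommGroup E'] [NormedSpace ℝ E'] [FiniteDimensional ℝ E']
  [ChartedSpace E' (LevelSet (fun _ : Fin 1 => J) (fun _ => ν))]
  [IsManifold 𝓘(ℝ, E') ∞ (LevelSet (fun _ : Fin 1 => J) (fun _ => ν))]

variable (E E') in
/-- The derivative of the inclusion of a level set. -/
def inclDeriv (x : LevelSet (fun _ : Fin 1 => J) (fun _ => ν)) : E' →L[ℝ] E :=
  mfderiv 𝓘(ℝ, E') 𝓘(ℝ, E) (Subtype.val : LevelSet (fun _ : Fin 1 => J) (fun _ => ν) → M) x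

variable (G E E') in
/-- The tangent space of the orbit of the isotropy group in a level set. -/
def orbitTangent (x : LevelSet (fun _ : Fin 1 => J) (fun _ => ν)) : Submodule ℝ E' :=
  (LinearMap.range (orbitDeriv G x.1 : EG →L[ℝ] E).toLinearMap).comap
    (inclDeriv E E' x).toLinearMap

omit [LieGroup 𝓘(ℝ, EG) ∞ G] [FiniteDimensional ℝ E'] in
-- A generator at `x` is tangent to the level set exactly when `dJ` kills it, that is, when `ξ` is
-- in the infinitesimal isotropy of `ν`. Both embeddings into the tangent space of `M` are
-- injective, so the dimension is independent of `x`, as constant rank requires.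
theorem finrank_orbitTangent (h : IsHamiltonianAction 𝓘(ℝ, EG) G (fun _ : Fin 1 => w)
    (fun _ => l) (fun _ => J)) (hν : IsRegularValue 𝓘(ℝ, E) J ν)
    (hj : Manifold.IsSmoothEmbedding 𝓘(ℝ, E') 𝓘(ℝ, E) ∞
      (Subtype.val : LevelSet (fun _ : Fin 1 => J) (fun _ => ν) → M))
    (x : LevelSet (fun _ : Fin 1 => J) (fun _ => ν)) :
    Module.finrank ℝ (orbitTangent G E E' x) = Module.finrank ℝ (isotropyAlgebra G ν) := by
  have hinj : Function.Injective (inclDeriv E E' x) := injective_mfderiv_of_isImmersionAt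
    (hj.isImmersion.isImmersionAt x) ((hj.isImmersion.contMDiff x).mdifferentiableAt (by simp))
  have hoinj := injective_orbitDeriv h (hν x.1 (x.2 0))
  have h1 : (orbitTangent G E E' x).map (inclDeriv E E' x).toLinearMap =
      (isotropyAlgebra G ν).map (orbitDeriv G x.1 : EG →L[ℝ] E).toLinearMap := by
    ext v
    constructor
    · rintro ⟨u, ⟨ξ, hξ⟩, rfl⟩
      refine ⟨ξ, ?_, hξ⟩
      change ξ ∈ isotropyAlgebra G ν
      rw [← mfderiv_orbitDeriv_eq_zero_iff h (x.2 0),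
        ← range_mfderiv_levelSet (h.momentum.contMDiff 0) hν hj]
      exact ⟨u, hξ.symm⟩
    · rintro ⟨ξ, hξ, rfl⟩
      have h2 := (mfderiv_orbitDeriv_eq_zero_iff h (x.2 0) ξ).2 hξ
      obtain ⟨u, hu⟩ := (range_mfderiv_levelSet (h.momentum.contMDiff 0) hν hj x _).2 h2
      exact ⟨u, ⟨ξ, hu.symm⟩, hu⟩
  have h2 := (Submodule.equivMapOfInjective (inclDeriv E E' x).toLinearMap hinj
    (orbitTangent G E E' x)).finrank_eq
  have h3 := (Submodule.equivMapOfInjective (orbitDeriv G x.1 : EG →L[ℝ] E).toLinearMap hoinj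
    (isotropyAlgebra G ν)).finrank_eq
  rw [h2, h3, h1]

/-- Locally, the orbits of the isotropy group in a level set are the fibres of a submersion. -/
theorem exists_levelSet_slice (h : IsHamiltonianAction 𝓘(ℝ, EG) G (fun _ : Fin 1 => w)
    (fun _ => l) (fun _ => J)) (hν : IsRegularValue 𝓘(ℝ, E) J ν)
    (hj : Manifold.IsSmoothEmbedding 𝓘(ℝ, E') 𝓘(ℝ, E) ∞
      (Subtype.val : LevelSet (fun _ : Fin 1 => J) (fun _ => ν) → M))
    {d : ℕ} (x₀ : LevelSet (fun _ : Fin 1 => J) (fun _ => ν))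
    (hd : d + Module.finrank ℝ (isotropyAlgebra G ν) = Module.finrank ℝ E') :
    ∃ r : LevelSet (fun _ : Fin 1 => J) (fun _ => ν) → EuclideanSpace ℝ (Fin d),
      (∀ᶠ x in 𝓝 x₀, ContMDiffAt 𝓘(ℝ, E') 𝓘(ℝ, EuclideanSpace ℝ (Fin d)) ∞ r x) ∧
      Function.Surjective (mfderiv 𝓘(ℝ, E') 𝓘(ℝ, EuclideanSpace ℝ (Fin d)) r x₀ :
        E' →L[ℝ] EuclideanSpace ℝ (Fin d)) ∧
      (∀ v : E', (mfderiv 𝓘(ℝ, E') 𝓘(ℝ, EuclideanSpace ℝ (Fin d)) r x₀ :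
        E' →L[ℝ] EuclideanSpace ℝ (Fin d)) v = 0 ↔ v ∈ orbitTangent G E E' x₀) ∧
      ∀ᶠ p : LevelSet (fun _ : Fin 1 => J) (fun _ => ν) × LevelSet (fun _ : Fin 1 => J)
        (fun _ => ν) in 𝓝 (x₀, x₀), r p.1 = r p.2 ↔ ∃ g : G, g • p.1.1 = p.2.1 := by
  have := h.smooth
  have := h.proper
  have hjs := hj.isImmersion.contMDiff
  have hoinj : ∀ x : LevelSet (fun _ : Fin 1 => J) (fun _ => ν),
      Function.Injective (orbitDeriv G x.1 : EG →L[ℝ] E) := fun x =>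
    injective_orbitDeriv h (hν x.1 (x.2 0))
  have hm := Nat.add_sub_cancel' (LinearMap.finrank_le_finrank_of_injective (hoinj x₀))
  set m := Module.finrank ℝ E - Module.finrank ℝ EG
  obtain ⟨q, hq, hqo⟩ := exists_slice G h.free x₀.1 (hoinj x₀) hm
  -- The slice of the full group, restricted to the level set. It need not be a submersion, but it
  -- has constant rank `d` near `x₀`, and `P ∘ f` will be a submersion with locally the same fibres.
  let f : LevelSet (fun _ : Fin 1 => J) (fun _ => ν) → EuclideanSpace ℝ (Fin m) := fun x => q x.1
  have hval : ContinuousAt (Subtype.val : LevelSet (fun _ : Fin 1 => J) (fun _ => ν) → M) x₀ :=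
    continuous_subtype_val.continuousAt
  have hfs : ∀ᶠ x in 𝓝 x₀, ContMDiffAt 𝓘(ℝ, E') 𝓘(ℝ, EuclideanSpace ℝ (Fin m)) ∞ f x := by
    filter_upwards [hval.eventually hq] with x hx
    exact hx.1.comp x (hjs x)
  have hker : ∀ᶠ x in 𝓝 x₀, ∀ v : E', (mfderiv 𝓘(ℝ, E') 𝓘(ℝ, EuclideanSpace ℝ (Fin m)) f x :
      E' →L[ℝ] EuclideanSpace ℝ (Fin m)) v = 0 ↔ v ∈ orbitTangent G E E' x := by
    filter_upwards [hval.eventually hq] with x hx v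
    have h1 : HasMFDerivAt 𝓘(ℝ, E') 𝓘(ℝ, EuclideanSpace ℝ (Fin m)) f x _ :=
      (hx.1.mdifferentiableAt (by simp)).hasMFDerivAt.comp x
        ((hjs x).mdifferentiableAt (by simp)).hasMFDerivAt
    rw [h1.mfderiv]
    exact hx.2 (hoinj x) (inclDeriv E E' x v)
  have hrank : ∀ᶠ x in 𝓝 x₀, Module.finrank ℝ (LinearMap.range
      (mfderiv 𝓘(ℝ, E') 𝓘(ℝ, EuclideanSpace ℝ (Fin m)) f x :
        E' →L[ℝ] EuclideanSpace ℝ (Fin m)).toLinearMap) = d := by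
    filter_upwards [hker] with x hx
    set D : E' →L[ℝ] EuclideanSpace ℝ (Fin m) :=
      mfderiv 𝓘(ℝ, E') 𝓘(ℝ, EuclideanSpace ℝ (Fin m)) f x
    have h1 := D.toLinearMap.finrank_range_add_finrank_ker
    have h2 : LinearMap.ker D.toLinearMap = orbitTangent G E E' x := Submodule.ext hx
    have h3 : Module.finrank ℝ (LinearMap.range D.toLinearMap) +
        Module.finrank ℝ (isotropyAlgebra G ν) = Module.finrank ℝ E' := by
      rw [← finrank_orbitTangent h hν hj x, ← h2]
      exact h1
    change Module.finrank ℝ (LinearMap.range D.toLinearMap) = d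
    omega
  obtain ⟨P, k, hPs, -, hk⟩ := exists_factorization_of_constant_rank hfs hrank
  have hPd : HasMFDerivAt 𝓘(ℝ, E') 𝓘(ℝ, EuclideanSpace ℝ (Fin d)) (fun x => P (f x)) x₀
      (P ∘L (mfderiv 𝓘(ℝ, E') 𝓘(ℝ, EuclideanSpace ℝ (Fin m)) f x₀ :
        E' →L[ℝ] EuclideanSpace ℝ (Fin m))) :=
    (P.hasMFDerivAt (x := f x₀)).comp x₀
      (hfs.self_of_nhds.mdifferentiableAt (by simp)).hasMFDerivAt
  refine ⟨fun x => P (f x), ?_, ?_, ?_, ?_⟩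
  · filter_upwards [hfs] with x hx
    exact P.contDiff.contMDiff.contMDiffAt.comp x hx
  · rw [hPd.mfderiv]
    exact hPs
  · rw [hPd.mfderiv]
    set D : E' →L[ℝ] EuclideanSpace ℝ (Fin m) :=
      mfderiv 𝓘(ℝ, E') 𝓘(ℝ, EuclideanSpace ℝ (Fin m)) f x₀
    have hle : orbitTangent G E E' x₀ ≤ LinearMap.ker (P ∘L D).toLinearMap := fun v hv => by
      have h1 : D v = 0 := (hker.self_of_nhds v).2 hv
      change P (D v) = 0
      rw [h1, map_zero]
    have hdim : d + Module.finrank ℝ (LinearMap.ker (P ∘L D).toLinearMap) =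
        Module.finrank ℝ E' := by
      have h1 := (P ∘L D).toLinearMap.finrank_range_add_finrank_ker
      have h2 : LinearMap.range (P ∘L D).toLinearMap = ⊤ := LinearMap.range_eq_top.2 hPs
      rw [h2, finrank_top, finrank_euclideanSpace_fin] at h1
      exact h1
    have heq := Submodule.eq_of_le_of_finrank_eq hle (by
      rw [finrank_orbitTangent h hν hj x₀]; omega)
    intro v
    rw [heq]
    rfl
  · have hval2 : ContinuousAt (fun p : LevelSet (fun _ : Fin 1 => J) (fun _ => ν) ×
        LevelSet (fun _ : Fin 1 => J) (fun _ => ν) => (p.1.1, p.2.1)) (x₀, x₀) := by fun_prop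
    filter_upwards [hval2.eventually hqo, (continuous_fst.tendsto (x₀, x₀)).eventually hk,
      (continuous_snd.tendsto (x₀, x₀)).eventually hk] with p hp hk1 hk2
    rw [← hp]
    change _ ↔ f p.1 = f p.2
    -- Since `f = k ∘ P ∘ f` near `x₀`, nothing is lost by passing from `f` to `P ∘ f`.
    exact ⟨fun h => by rw [hk1, hk2, h], fun h => by rw [h]⟩

end LevelGeometry

/-! ### The orbit space as a manifold. -/

section OrbitManifold

variable {EG : Type*} [NormedAddCommGroup EG] [NormedSpace ℝ EG]
  {G : Type*} [TopologicalSpace G] [ChartedSpace EG G] [Group G]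
  {E : Type*} [NormedAddCommGroup E] [NormedSpace ℝ E]
  {M : Type*} [TopologicalSpace M] [ChartedSpace E M]
  [MulAction G M] {w : Form 𝓘(ℝ, E) M 2} {l : Form 𝓘(ℝ, E) M 1} {J : M → (EG →L[ℝ] ℝ)}
  {ν : EG →L[ℝ] ℝ}

/-- The action of an element of the isotropy group on a level set. -/
def levelSetSMul (h : IsHamiltonianAction 𝓘(ℝ, EG) G (fun _ : Fin 1 => w) (fun _ => l)
    (fun _ => J)) (g : G) (hg : coAd 𝓘(ℝ, EG) g ν = ν)
    (y : LevelSet (fun _ : Fin 1 => J) (fun _ => ν)) :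
    LevelSet (fun _ : Fin 1 => J) (fun _ => ν) :=
  ⟨g • y.1, fun _ => (h.equivariant g 0 y.1).trans (by
    rw [show J y.1 = ν from y.2 0]
    exact hg)⟩

theorem coAd_eq_of_smul_eq (h : IsHamiltonianAction 𝓘(ℝ, EG) G (fun _ : Fin 1 => w) (fun _ => l)
    (fun _ => J)) {g : G} {x y : LevelSet (fun _ : Fin 1 => J) (fun _ => ν)}
    (hg : g • x.1 = y.1) : coAd 𝓘(ℝ, EG) g ν = ν := by
  have h1 : J (g • x.1) = coAd 𝓘(ℝ, EG) g (J x.1) := h.equivariant g 0 x.1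
  rw [hg, show J y.1 = ν from y.2 0, show J x.1 = ν from x.2 0] at h1
  exact h1.symm

variable {E' : Type*} [NormedAddCommGroup E'] [NormedSpace ℝ E']
  [ChartedSpace E' (LevelSet (fun _ : Fin 1 => J) (fun _ => ν))]
  [IsManifold 𝓘(ℝ, E') ∞ (LevelSet (fun _ : Fin 1 => J) (fun _ => ν))]

omit [IsManifold 𝓘(ℝ, E') ∞ (LevelSet (fun _ : Fin 1 => J) (fun _ => ν))] in
-- Smoothness into the level set can be tested after the immersion into `M`, where the map is the
-- action of `g`.
theorem contMDiff_levelSetSMul [IsManifold 𝓘(ℝ, E) ∞ M]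
    (h : IsHamiltonianAction 𝓘(ℝ, EG) G (fun _ : Fin 1 => w) (fun _ => l)
    (fun _ => J)) (hj : Manifold.IsSmoothEmbedding 𝓘(ℝ, E') 𝓘(ℝ, E) ∞
      (Subtype.val : LevelSet (fun _ : Fin 1 => J) (fun _ => ν) → M))
    (g : G) (hg : coAd 𝓘(ℝ, EG) g ν = ν) :
    ContMDiff 𝓘(ℝ, E') 𝓘(ℝ, E') ∞ (levelSetSMul (ν := ν) h g hg) := by
  have := h.smooth
  have h1 : ContMDiff 𝓘(ℝ, E) 𝓘(ℝ, E) ∞ (fun x : M => g • x) :=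
    ContMDiffSMul.contMDiff_const_smul (I := 𝓘(ℝ, EG)) g
  rw [ContMDiff.iff_comp_isImmersion hj.isImmersion]
  refine ⟨?_, h1.comp hj.isImmersion.contMDiff⟩
  exact (h1.continuous.comp continuous_subtype_val).subtype_mk _

/-- The chart of the orbit space given by a local slice `r` with a local section `σ`. -/
theorem exists_orbitSpace_chart [ContinuousConstSMul G M]
    (h : IsHamiltonianAction 𝓘(ℝ, EG) G (fun _ : Fin 1 => w) (fun _ => l) (fun _ => J))
    (x₁ : LevelSet (fun _ : Fin 1 => J) (fun _ => ν)) {V : Type*} [TopologicalSpace V] {r : LevelSet (fun _ : Fin 1 => J) (fun _ => ν) → V}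
    {σ : V → LevelSet (fun _ : Fin 1 => J) (fun _ => ν)}
    {U : Set (LevelSet (fun _ : Fin 1 => J) (fun _ => ν))} {W : Set V}
    (hU : IsOpen U) (hW : IsOpen W) (hrc : ContinuousOn r U) (hrU : MapsTo r U W)
    (hσc : ContinuousOn σ W) (hσU : MapsTo σ W U) (hrσ : ∀ u ∈ W, r (σ u) = u)
    (hr : ∀ x ∈ U, ∀ y ∈ U, r x = r y ↔ ∃ g : G, g • x.1 = y.1) :
    ∃ c : OpenPartialHomeomorph
        (OrbitSpace 𝓘(ℝ, EG) G (fun _ : Fin 1 => J) (fun _ => ν)) V,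
      c.source = Quot.mk _ '' U ∧ c.target = W ∧ (∀ x ∈ U, c (Quot.mk _ x) = r x) ∧
      ∀ u, c.symm u = Quot.mk _ (σ u) := by
  classical
  have hmk := orbitSpace_mk_eq_iff (μ := fun _ : Fin 1 => ν) h.equivariant
  -- The chart evaluates `r` at any representative in `U`; by `hr` the choice is irrelevant. The
  -- point `x₁` is used only outside the source.
  let pick : OrbitSpace 𝓘(ℝ, EG) G (fun _ : Fin 1 => J) (fun _ => ν) →
      LevelSet (fun _ : Fin 1 => J) (fun _ => ν) := fun p =>
    if hp : ∃ x ∈ U, Quot.mk _ x = p then hp.choose else x₁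
  have hpick : ∀ x ∈ U, r (pick (Quot.mk _ x)) = r x := fun x hx => by
    have hp : ∃ y ∈ U, Quot.mk (orbitRel 𝓘(ℝ, EG) G (fun _ : Fin 1 => J) (fun _ => ν)) y =
      Quot.mk _ x := ⟨x, hx, rfl⟩
    simp only [pick, dif_pos hp]
    exact (hr _ hp.choose_spec.1 _ hx).2 ((hmk _ _).1 hp.choose_spec.2)
  exact ⟨{
    toFun := fun p => r (pick p)
    invFun := fun u => Quot.mk _ (σ u)
    source := Quot.mk _ '' U
    target := W
    map_source' := by
      rintro _ ⟨x, hx, rfl⟩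
      rw [hpick x hx]
      exact hrU hx
    map_target' := fun u hu => ⟨σ u, hσU hu, rfl⟩
    left_inv' := by
      rintro _ ⟨x, hx, rfl⟩
      rw [hpick x hx]
      refine (hmk _ _).2 ((hr _ (hσU (hrU hx)) _ hx).1 (hrσ _ (hrU hx)))
    right_inv' := fun u hu => by rw [hpick _ (hσU hu), hrσ u hu]
    open_source := isOpenMap_orbitSpace_mk h.equivariant U hU
    open_target := hW
    continuousOn_toFun := by
      rintro _ ⟨x, hx, rfl⟩
      refine ContinuousAt.continuousWithinAt ?_
      have h1 : Tendsto (fun y => r (pick (Quot.mk _ y))) (𝓝 x) (𝓝 (r x)) :=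
        Tendsto.congr' (f₁ := r) (l₁ := 𝓝 x)
          (by filter_upwards [hU.mem_nhds hx] with y hy using (hpick y hy).symm)
          (hrc.continuousAt (hU.mem_nhds hx))
      have h2 := (isOpenMap_orbitSpace_mk (μ := fun _ : Fin 1 => ν) h.equivariant).nhds_le x
      have h3 : Tendsto (fun p => r (pick p)) (map (Quot.mk _) (𝓝 x)) (𝓝 (r x)) :=
        tendsto_map'_iff.2 h1
      change Tendsto _ _ (𝓝 (r (pick (Quot.mk _ x))))
      rw [hpick x hx]
      exact h3.mono_left h2
    continuousOn_invFun := continuous_quot_mk.comp_continuousOn hσc }, rfl, rfl, hpick,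
      fun u => rfl⟩

variable [FiniteDimensional ℝ EG] [LieGroup 𝓘(ℝ, EG) ∞ G] [FiniteDimensional ℝ E]
  [IsManifold 𝓘(ℝ, E) ∞ M] [FiniteDimensional ℝ E']

/-- The orbit space of the level set of a regular value is a manifold, and the projection is a
submersion. -/
theorem exists_manifold_orbitSpace
    (h : IsHamiltonianAction 𝓘(ℝ, EG) G (fun _ : Fin 1 => w) (fun _ => l) (fun _ => J))
    (hν : IsRegularValue 𝓘(ℝ, E) J ν)
    (hj : Manifold.IsSmoothEmbedding 𝓘(ℝ, E') 𝓘(ℝ, E) ∞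
      (Subtype.val : LevelSet (fun _ : Fin 1 => J) (fun _ => ν) → M)) {d : ℕ}
    (hd : LevelSet (fun _ : Fin 1 => J) (fun _ => ν) →
      d + Module.finrank ℝ (isotropyAlgebra G ν) = Module.finrank ℝ E') :
    ∃ (_ : ChartedSpace (EuclideanSpace ℝ (Fin d))
        (OrbitSpace 𝓘(ℝ, EG) G (fun _ : Fin 1 => J) (fun _ => ν)))
      (_ : IsManifold 𝓘(ℝ, EuclideanSpace ℝ (Fin d)) ∞
        (OrbitSpace 𝓘(ℝ, EG) G (fun _ : Fin 1 => J) (fun _ => ν))),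
      Manifold.IsSubmersion 𝓘(ℝ, E') 𝓘(ℝ, EuclideanSpace ℝ (Fin d)) ∞
        (Quot.mk (orbitRel 𝓘(ℝ, EG) G (fun _ : Fin 1 => J) (fun _ => ν))) := by
  have := h.smooth
  have hcs : ContinuousConstSMul G M := ⟨fun g =>
    (ContMDiffSMul.contMDiff_const_smul (I := 𝓘(ℝ, EG)) (I' := 𝓘(ℝ, E)) (n := ∞) g).continuous⟩
  set V := EuclideanSpace ℝ (Fin d)
  let N := LevelSet (fun _ : Fin 1 => J) (fun _ => ν)
  let R := orbitRel 𝓘(ℝ, EG) G (fun _ : Fin 1 => J) (fun _ => ν)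
  have hmk := orbitSpace_mk_eq_iff (μ := fun _ : Fin 1 => ν) h.equivariant
  -- Admitted charts are smooth after composition with the projection and have inverses that lift
  -- smoothly to the level set; transition maps are then smooth by lifting.
  let Good : OpenPartialHomeomorph (Quot R) V → Prop := fun c =>
    (∀ x : N, Quot.mk R x ∈ c.source →
      ContMDiffAt 𝓘(ℝ, E') 𝓘(ℝ, V) ∞ (fun y => c (Quot.mk R y)) x) ∧
    ∀ u ∈ c.target, ∃ σ : V → N, ContMDiffAt 𝓘(ℝ, V) 𝓘(ℝ, E') ∞ σ u ∧
      ∀ u', Quot.mk R (σ u') = c.symm u'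
  have hx : ∀ x₀ : N, ∃ c, Good c ∧ Quot.mk R x₀ ∈ c.source ∧
      Function.Surjective (mfderiv 𝓘(ℝ, E') 𝓘(ℝ, V) (fun y => c (Quot.mk R y)) x₀) := by
    intro x₀
    obtain ⟨r, hrs, hrd, -, hro⟩ := exists_levelSet_slice h hν hj x₀ (hd x₀)
    have hsub : Manifold.IsSubmersionAt 𝓘(ℝ, E') 𝓘(ℝ, V) ∞ r x₀ :=
      (isSubmersionAtOfComplement_of_surjective (F := EuclideanSpace ℝ
        (Fin (Module.finrank ℝ (isotropyAlgebra G ν)))) hrs hrd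
        (by rw [finrank_euclideanSpace_fin, finrank_euclideanSpace_fin, add_comm, hd x₀])
        ).isSubmersionAt
    obtain ⟨σ, hσx, hσ⟩ := exists_localSection hsub
    obtain ⟨U₁, hU₁, hU₁o, hxU₁⟩ := eventually_nhds_iff.1 hrs
    rw [nhds_prod_eq] at hro
    obtain ⟨U₂, hU₂n, hU₂⟩ := (eventually_prod_self_iff
      (r := fun a b : N => r a = r b ↔ ∃ g : G, g • a.1 = b.1)).1 hro
    set U := U₁ ∩ interior U₂
    have hUo : IsOpen U := hU₁o.inter isOpen_interior
    have hxU : x₀ ∈ U := ⟨hxU₁, mem_interior_iff_mem_nhds.2 hU₂n⟩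
    have hσU : ∀ᶠ u in 𝓝 (r x₀), σ u ∈ U :=
      hσ.self_of_nhds.2.continuousAt.eventually (hUo.mem_nhds (by rwa [hσx]))
    obtain ⟨W, hW, hWo, hxW⟩ := eventually_nhds_iff.1 (hσ.and hσU)
    have hrc : ContinuousOn r U := fun x hx =>
      (hU₁ x hx.1).continuousAt.continuousWithinAt
    obtain ⟨c, hcs, hct, hcr, hcσ⟩ := exists_orbitSpace_chart h x₀ (r := r) (σ := σ)
      (U := U ∩ r ⁻¹' W) (W := W) (hrc.isOpen_inter_preimage hUo hWo) hWo
      (hrc.mono inter_subset_left) (fun x hx => hx.2)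
      (fun u hu => (hW u hu).1.2.continuousAt.continuousWithinAt)
      (fun u hu => ⟨(hW u hu).2, by rw [mem_preimage, (hW u hu).1.1]; exact hu⟩)
      (fun u hu => (hW u hu).1.1)
      (fun x hx y hy => hU₂ x (interior_subset hx.1.2) y (interior_subset hy.1.2))
    have hU'o : IsOpen (U ∩ r ⁻¹' W) := hrc.isOpen_inter_preimage hUo hWo
    refine ⟨c, ⟨fun x hxc => ?_, fun u hu => ⟨σ, ?_, fun u' => (hcσ u').symm⟩⟩, ?_, ?_⟩
    -- The point `x` need not lie in `U`, but an isotropy element `g` moves it there, and near `x`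
    -- the chart is `r` after the action `b` of `g`.
    · rw [hcs] at hxc
      obtain ⟨y, hy, hyx⟩ := hxc
      obtain ⟨g, hg⟩ := (hmk x y).1 hyx.symm
      have hgν := coAd_eq_of_smul_eq h hg
      set b := levelSetSMul (ν := ν) h g hgν
      have hbs := contMDiff_levelSetSMul h hj g hgν
      have hbx : b x = y := Subtype.ext hg
      have h1 : ContMDiffAt 𝓘(ℝ, E') 𝓘(ℝ, V) ∞ (r ∘ b) x := by
        refine ContMDiffAt.comp x ?_ (hbs x)
        change ContMDiffAt 𝓘(ℝ, E') 𝓘(ℝ, V) ∞ r (b x)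
        rw [hbx]
        exact hU₁ y hy.1.1
      refine h1.congr_of_eventuallyEq ?_
      filter_upwards [hbs.continuous.continuousAt.eventually (hU'o.mem_nhds (x := b x)
        (by rwa [hbx]))] with z hz
      change c (Quot.mk R z) = r (b z)
      rw [← hcr _ hz]
      exact congrArg c ((hmk _ _).2 ⟨g, rfl⟩)
    · rw [hct] at hu
      exact (hW u hu).1.2
    · rw [hcs]
      exact ⟨x₀, ⟨hxU, hxW⟩, rfl⟩
    · have h1 : (fun y => c (Quot.mk R y)) =ᶠ[𝓝 x₀] r := by
        filter_upwards [hU'o.mem_nhds ⟨hxU, hxW⟩] with z hz using hcr z hz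
      rw [h1.mfderiv_eq]
      exact hrd
  obtain ⟨C, hM, hC⟩ := exists_chartedSpace_of_charts Good
    (by
      rintro ⟨x⟩
      obtain ⟨c, hc, hxc, -⟩ := hx x
      exact ⟨c, hc, hxc⟩)
    fun c c' hc hc' u hu hu' => by
      obtain ⟨σ, hσs, hσ⟩ := hc.2 u hu
      rw [← contMDiffAt_iff_contDiffAt]
      have h1 := hc'.1 (σ u) (by rwa [hσ u])
      refine (h1.comp u hσs).congr_of_eventuallyEq (Eventually.of_forall fun u' => ?_)
      change _ = c' (Quot.mk R (σ u'))
      rw [hσ u']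
  refine ⟨C, hM, ?_⟩
  have hπ : ∀ x : N, ∀ c, Good c → Quot.mk R x ∈ c.source →
      ((Quot.mk R : N → Quot R) =ᶠ[𝓝 x] fun y => c.symm (c (Quot.mk R y))) := by
    intro x c hc hxc
    have h1 : ContinuousAt (Quot.mk R : N → Quot R) x := continuous_quot_mk.continuousAt
    filter_upwards [h1.eventually (c.open_source.mem_nhds hxc)] with y hy
    exact (c.left_inv hy).symm
  have hsm : ContMDiff 𝓘(ℝ, E') 𝓘(ℝ, V) ∞ (Quot.mk R : N → Quot R) := fun x => by
    obtain ⟨c, hc, hxc, -⟩ := hx x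
    have h1 := ((hC c hc).2.contMDiffAt (c.open_target.mem_nhds (c.map_source hxc)))
    exact (ContMDiffAt.comp (g := c.symm) x h1 (hc.1 x hxc)).congr_of_eventuallyEq (hπ x c hc hxc)
  refine (show Manifold.IsSubmersionOfComplement (EuclideanSpace ℝ
        (Fin (Module.finrank ℝ (isotropyAlgebra G ν)))) 𝓘(ℝ, E') 𝓘(ℝ, V) ∞
        (Quot.mk R : N → Quot R) from fun x => ?_).isSubmersion
  refine isSubmersionAtOfComplement_of_surjective (Eventually.of_forall fun y => hsm y) ?_
    (by rw [finrank_euclideanSpace_fin, finrank_euclideanSpace_fin, add_comm, hd x])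
  obtain ⟨c, hc, hxc, hsurj⟩ := hx x
  have hcd := ((hC c hc).1.contMDiffAt (c.open_source.mem_nhds hxc)).mdifferentiableAt (by simp)
  have hcd' := ((hC c hc).2.contMDiffAt
    (c.open_target.mem_nhds (c.map_source hxc))).mdifferentiableAt (by simp)
  have h1 : HasMFDerivAt 𝓘(ℝ, E') 𝓘(ℝ, V) (Quot.mk R : N → Quot R) x _ :=
    (HasMFDerivAt.comp (g := c.symm) x hcd'.hasMFDerivAt
    ((hc.1 x hxc).mdifferentiableAt (by simp)).hasMFDerivAt).congr_of_eventuallyEq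
      (hπ x c hc hxc)
  have hsurj' : Function.Surjective (mfderiv 𝓘(ℝ, V) 𝓘(ℝ, V) c.symm (c (Quot.mk R x))) :=
    fun v => ⟨_, mfderiv_apply_of_rightInverse (I := 𝓘(ℝ, V)) (J := 𝓘(ℝ, V)) (f := c.symm) (σ := c)
      (q := Quot.mk R x) hcd' hcd
      (by filter_upwards [c.open_source.mem_nhds hxc] with w hw using c.left_inv hw) v⟩
  rw [h1.mfderiv]
  exact hsurj'.comp hsurj

/-- For any manifold structures on the level set and the orbit space, the kernel of the derivative
of the projection is the tangent space of the orbit. -/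
theorem mfderiv_orbitSpace_mk_eq_zero_iff
    (h : IsHamiltonianAction 𝓘(ℝ, EG) G (fun _ : Fin 1 => w) (fun _ => l) (fun _ => J))
    (hν : IsRegularValue 𝓘(ℝ, E) J ν)
    (hj : Manifold.IsSmoothEmbedding 𝓘(ℝ, E') 𝓘(ℝ, E) ∞
      (Subtype.val : LevelSet (fun _ : Fin 1 => J) (fun _ => ν) → M))
    {V : Type*} [NormedAddCommGroup V] [NormedSpace ℝ V]
    [ChartedSpace V (OrbitSpace 𝓘(ℝ, EG) G (fun _ : Fin 1 => J) (fun _ => ν))]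
    (hπ : Manifold.IsSubmersion 𝓘(ℝ, E') 𝓘(ℝ, V) ∞
        (Quot.mk (orbitRel 𝓘(ℝ, EG) G (fun _ : Fin 1 => J) (fun _ => ν))))
    (x : LevelSet (fun _ : Fin 1 => J) (fun _ => ν)) (v : E') :
    (mfderiv 𝓘(ℝ, E') 𝓘(ℝ, V) (Quot.mk (orbitRel 𝓘(ℝ, EG) G (fun _ : Fin 1 => J)
      (fun _ => ν))) x : E' →L[ℝ] V) v = 0 ↔ v ∈ orbitTangent G E E' x := by
  have hle := (orbitTangent G E E' x).finrank_le
  rw [finrank_orbitTangent h hν hj x] at hle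
  obtain ⟨r, hrs, hrd, hrk, hro⟩ := exists_levelSet_slice h hν hj x (Nat.sub_add_cancel hle)
  have hsub := (isSubmersionAtOfComplement_of_surjective (F := EuclideanSpace ℝ
      (Fin (Module.finrank ℝ (isotropyAlgebra G ν)))) hrs hrd
      (by rw [finrank_euclideanSpace_fin, finrank_euclideanSpace_fin]; omega)
      ).isSubmersionAt
  have hmk := orbitSpace_mk_eq_iff (μ := fun _ : Fin 1 => ν) h.equivariant
  have hrd' := hrs.self_of_nhds.mdifferentiableAt (n := ∞) (by simp)
  have hπd := (hπ.contMDiff x).mdifferentiableAt (by simp)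
  -- The submersions `r` and the projection have the same fibres near `x`, so each derivative
  -- vanishes on the kernel of the other.
  rw [← hrk]
  constructor
  · refine mfderiv_eq_zero_of_fiber (hπ.isSubmersionAt x) hπd hrd' ?_
    filter_upwards [hro] with p hp hp'
    exact hp.2 ((hmk _ _).1 hp')
  · refine mfderiv_eq_zero_of_fiber hsub hrd' hπd ?_
    filter_upwards [hro] with p hp hp'
    exact (hmk _ _).2 (hp.1 hp')

end OrbitManifold

/-! ### Invariance of closed one-forms vanishing on orbits. -/

section Invariance

variable {E : Type*} [NormedAddCommGroup E] [NormedSpace ℝ E]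
  {M : Type*} [TopologicalSpace M] [ChartedSpace E M] [IsManifold 𝓘(ℝ, E) ∞ M]

/-- A closed one-form has local primitives. -/
theorem Form.exists_primitive {α : Form 𝓘(ℝ, E) M 1} (hs : α.IsSmooth) (hc : α.IsClosed)
    (z : M) : ∃ f : M → ℝ, ∀ᶠ y in 𝓝 z, ∃ D : E →L[ℝ] ℝ,
      HasMFDerivAt 𝓘(ℝ, E) 𝓘(ℝ, ℝ) f y D ∧ ∀ v : E, D v = α y ![v] := by
  set φ := modelChart 𝓘(ℝ, E) z
  have hzs : z ∈ φ.source := by rw [modelChart_source]; exact mem_extChartAt_source _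
  have hzt : φ z ∈ φ.target := φ.map_source hzs
  have hsc := Form.smoothClosedAt_of_isSmooth_of_isClosed hs hc
  let a : E → E [⋀^Fin 1]→L[ℝ] ℝ := α.inChart z
  have ha : ∀ x ∈ φ.target, ContDiffAt ℝ ∞ a x ∧ extDeriv a x = 0 := fun x hx => by
    have h1 := hsc (φ.symm x) z (by
      have h2 := φ.map_target hx
      rwa [modelChart_source] at h2)
    have h2 : extChartAt 𝓘(ℝ, E) z (φ.symm x) = x := φ.right_inv hx
    rwa [h2] at h1
  obtain ⟨ε, hε, hball⟩ := Metric.isOpen_iff.1 φ.open_target _ hzt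
  let L := (ContinuousAlternatingMap.ofSubsingletonLIE (𝕜 := ℝ) (E := E) (F := ℝ) (0 : Fin 1)).symm
  let β : E → E →L[ℝ] ℝ := fun x => L (a x)
  have hβ : ∀ x v, β x v = a x ![v] := fun x v => by
    have h1 : (fun _ : Fin 1 => v) = ![v] := by
      funext i
      fin_cases i
      rfl
    rw [← h1]
    rfl
  have hβd : ∀ x ∈ φ.target, DifferentiableAt ℝ β x := fun x hx =>
    L.toContinuousLinearEquiv.differentiableAt.comp x ((ha x hx).1.differentiableAt (by simp))
  -- Closedness says that the derivative of `β` is symmetric, which gives a primitive on the convex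
  -- ball.
  have hsymm : ∀ x ∈ Metric.ball (φ z) ε, ∀ u v, fderiv ℝ β x u v = fderiv ℝ β x v u := by
    intro x hx u v
    have hxt := hball hx
    have h1 := extDeriv_apply ((ha x hxt).1.differentiableAt (by simp)) ![u, v]
    have h2 : ∀ p q, fderiv ℝ (fun y => a y ![p]) x q = fderiv ℝ β x q p := fun p q => by
      have h3 := ((ContinuousLinearMap.apply ℝ ℝ p).hasFDerivAt (x := β x)).comp x
        (hβd x hxt).hasFDerivAt
      have h4 : (fun y => a y ![p]) = (ContinuousLinearMap.apply ℝ ℝ p) ∘ β := by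
        funext y
        exact (hβ y p).symm
      rw [h4, h3.fderiv]
      rfl
    have h5 : (0 : Fin 2).removeNth ![u, v] = ![v] := by
      funext i
      fin_cases i
      rfl
    have h6 : (1 : Fin 2).removeNth ![u, v] = ![u] := by
      funext i
      fin_cases i
      rfl
    rw [(ha x hxt).2, Fin.sum_univ_two, h5, h6, h2, h2] at h1
    simp only [Fin.val_zero, pow_zero, one_smul,
      Fin.val_one, pow_one, neg_smul, Matrix.cons_val_zero, Matrix.cons_val_one] at h1
    have h7 : (0 : ℝ) = fderiv ℝ β x u v + -fderiv ℝ β x v u := h1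
    linarith
  obtain ⟨f, hf⟩ := (convex_ball (φ z) ε).exists_forall_hasFDerivAt_of_fderiv_symmetric
    Metric.isOpen_ball (fun x hx => (hβd x (hball hx)).differentiableWithinAt) hsymm
  refine ⟨f ∘ φ, ?_⟩
  filter_upwards [φ.open_source.mem_nhds hzs,
    (φ.continuousAt hzs).eventually (Metric.ball_mem_nhds _ hε)] with y hy hyb
  have hφd := ((contMDiffOn_modelChart z).contMDiffAt
    (φ.open_source.mem_nhds hy)).mdifferentiableAt (n := ∞) (by simp)
  have hφd' := ((contMDiffOn_modelChart_symm z).contMDiffAt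
    (φ.open_target.mem_nhds (φ.map_source hy))).mdifferentiableAt (n := ∞) (by simp)
  refine ⟨_, (hf _ hyb).hasMFDerivAt.comp y hφd.hasMFDerivAt, fun v => ?_⟩
  refine (hβ _ _).trans ?_
  have h1 : ∀ p, p = y → ∀ u : E, (α p : E [⋀^Fin 1]→L[ℝ] ℝ) ![u] = α y ![u] := by
    rintro p rfl u
    rfl
  have h2 := mfderiv_apply_of_rightInverse (I := 𝓘(ℝ, E)) (J := 𝓘(ℝ, E)) (f := φ.symm) (σ := φ)
    (q := y) hφd' hφd (by filter_upwards [φ.open_source.mem_nhds hy] with w hw using φ.left_inv hw) v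
  have h3 : a (φ y) = (α (φ.symm (φ y)) : E [⋀^Fin 1]→L[ℝ] ℝ).compContinuousLinearMap
      (mfderiv 𝓘(ℝ, E) 𝓘(ℝ, E) φ.symm (φ y)) := by
    change (α (φ.symm (φ y)) : E [⋀^Fin 1]→L[ℝ] ℝ).compContinuousLinearMap
      (mfderivWithin 𝓘(ℝ, E) 𝓘(ℝ, E) φ.symm (range 𝓘(ℝ, E)) (φ y)) = _
    rw [ModelWithCorners.range_eq_univ, mfderivWithin_univ]
  rw [h3]
  refine Eq.trans ?_ (h1 _ (φ.left_inv hy) v)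
  refine congrArg (α (φ.symm (φ y)) : E [⋀^Fin 1]→L[ℝ] ℝ) ?_
  funext i
  fin_cases i
  exact h2

variable {EG : Type*} [NormedAddCommGroup EG] [NormedSpace ℝ EG]
  {G : Type*} [TopologicalSpace G] [ChartedSpace EG G] [Group G] [LieGroup 𝓘(ℝ, EG) ∞ G]
  [MulAction G M] [ContMDiffSMul 𝓘(ℝ, EG) 𝓘(ℝ, E) ∞ G M]

omit [IsManifold 𝓘(ℝ, E) ∞ M] in
/-- The derivative of an orbit map takes values in the image of the infinitesimal action. -/
theorem exists_mfderiv_smul_point (g : G) (y : M) (ζ : EG) : ∃ ξ : EG,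
    (mfderiv 𝓘(ℝ, EG) 𝓘(ℝ, E) (fun g : G => g • y) g : EG →L[ℝ] E) ζ =
      (orbitDeriv G (g • y) : EG →L[ℝ] E) ξ := by
  -- Right translation by `g⁻¹` turns the orbit map of `y` near `g` into the orbit map of `g • y`
  -- near `1`.
  have h1 : ContMDiff 𝓘(ℝ, EG) 𝓘(ℝ, EG) ∞ (fun k : G => k * g⁻¹) :=
    contMDiff_id.mul contMDiff_const
  have h2 : HasMFDerivAt 𝓘(ℝ, EG) 𝓘(ℝ, E) (fun k : G => k • (g • y)) (g * g⁻¹)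
      (orbitDeriv G (g • y) : EG →L[ℝ] E) := by
    rw [mul_inv_cancel]
    exact hasMFDerivAt_smul_point G (g • y)
  have h3 := HasMFDerivAt.comp g h2 ((h1 g).mdifferentiableAt (by simp)).hasMFDerivAt
  have h4 : (fun k : G => k • (g • y)) ∘ (fun k : G => k * g⁻¹) = fun k => k • y := by
    funext k
    change (k * g⁻¹) • g • y = k • y
    rw [smul_smul, inv_mul_cancel_right]
  rw [h4] at h3
  rw [h3.mfderiv]
  exact ⟨(mfderiv 𝓘(ℝ, EG) 𝓘(ℝ, EG) (fun k : G => k * g⁻¹) g : EG →L[ℝ] EG) ζ, rfl⟩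

/-- A closed one-form vanishing on the orbits of a connected group is invariant. -/
theorem Form.pullback_smul_eq [ConnectedSpace G] {α : Form 𝓘(ℝ, E) M 1} (hs : α.IsSmooth)
    (hc : α.IsClosed) (h0 : ∀ (x : M) (ξ : EG), α x ![(orbitDeriv G x : EG →L[ℝ] E) ξ] = 0)
    (g : G) : α.pullback (I' := 𝓘(ℝ, E)) (fun x : M => g • x) = α := by
  have hsm : ∀ g : G, ContMDiff 𝓘(ℝ, E) 𝓘(ℝ, E) ∞ (fun x : M => g • x) := fun g =>
    ContMDiffSMul.contMDiff_const_smul (I := 𝓘(ℝ, EG)) g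
  funext x
  ext v'
  obtain ⟨v, rfl⟩ : ∃ v : E, v' = ![v] := ⟨v' 0, by
    funext i
    fin_cases i
    rfl⟩
  -- The value of the pulled back form on `v`, as a function of `g`. It is locally constant, hence
  -- constant on the connected group.
  let F : G → ℝ := fun g => α (g • x)
    ![(mfderiv 𝓘(ℝ, E) 𝓘(ℝ, E) (fun y : M => g • y) x : E →L[ℝ] E) v]
  have hF : IsLocallyConstant F := by
    rw [IsLocallyConstant.iff_eventually_eq]
    intro g₀
    obtain ⟨f, hf⟩ := Form.exists_primitive hs hc (g₀ • x)
    set ψ := modelChart 𝓘(ℝ, EG) g₀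
    have hψs : g₀ ∈ ψ.source := by rw [modelChart_source]; exact mem_extChartAt_source _
    have hψt : ψ g₀ ∈ ψ.target := ψ.map_source hψs
    have hψsm : ∀ u ∈ ψ.target, ContMDiffAt 𝓘(ℝ, EG) 𝓘(ℝ, EG) ∞ ψ.symm u := fun u hu =>
      (contMDiffOn_modelChart_symm g₀).contMDiffAt (ψ.open_target.mem_nhds hu)
    have hcont : ContinuousAt (fun p : EG × M => ψ.symm p.1 • p.2) (ψ g₀, x) := by
      have h1 : ContMDiff (𝓘(ℝ, EG).prod 𝓘(ℝ, E)) 𝓘(ℝ, E) ∞ (fun p : G × M => p.1 • p.2) :=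
        ContMDiff.smul contMDiff_fst contMDiff_snd
      have h2 : ContinuousAt (fun p : EG × M => (ψ.symm p.1, p.2)) (ψ g₀, x) :=
        (ContinuousAt.comp (g := ψ.symm) (f := Prod.fst) (ψ.continuousAt_symm hψt)
          continuousAt_fst).prodMk continuousAt_snd
      exact h1.continuous.continuousAt.comp h2
    have hev : ∀ᶠ p : EG × M in 𝓝 (ψ g₀, x), p.1 ∈ ψ.target ∧ ∃ D : E →L[ℝ] ℝ,
        HasMFDerivAt 𝓘(ℝ, E) 𝓘(ℝ, ℝ) f (ψ.symm p.1 • p.2) D ∧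
          ∀ v : E, D v = α (ψ.symm p.1 • p.2) ![v] := by
      have h1 : ∀ᶠ y in 𝓝 (ψ.symm (ψ g₀) • x), ∃ D : E →L[ℝ] ℝ,
          HasMFDerivAt 𝓘(ℝ, E) 𝓘(ℝ, ℝ) f y D ∧ ∀ v : E, D v = α y ![v] := by
        rwa [ψ.left_inv hψs]
      exact ((continuous_fst.tendsto (ψ g₀, x)).eventually
        (ψ.open_target.mem_nhds hψt)).and (hcont.eventually h1)
    obtain ⟨B, hB, W, hW, hBW⟩ := mem_nhds_prod_iff.1 hev
    obtain ⟨ε, hε, hball⟩ := Metric.mem_nhds_iff.1 hB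
    -- For a primitive `f` of `α`, the derivative of `f (g • y)` in `g` is `α` on an orbit
    -- direction, hence zero. So for `g` near `g₀` the functions `y ↦ f (g • y)` agree near `x`, and
    -- their differentials at `x` are the pulled back forms.
    have hconst : ∀ u ∈ Metric.ball (ψ g₀) ε, ∀ y ∈ W,
        f (ψ.symm u • y) = f (ψ.symm (ψ g₀) • y) := fun u hu y hy => by
      have hd : ∀ u ∈ Metric.ball (ψ g₀) ε,
          HasFDerivAt (fun u => f (ψ.symm u • y)) (0 : EG →L[ℝ] ℝ) u := fun u hu => by
        obtain ⟨hut, D, hD, hDα⟩ := hBW (mk_mem_prod (hball hu) hy)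
        have h1 : HasMFDerivAt 𝓘(ℝ, EG) 𝓘(ℝ, EG) ψ.symm u _ :=
          ((hψsm u hut).mdifferentiableAt (by simp)).hasMFDerivAt
        have h2 := HasMFDerivAt.comp (g := fun g : G => g • y) u
          ((contMDiff_smul_point (E := E) G y (ψ.symm u)).mdifferentiableAt (by simp)).hasMFDerivAt h1
        have h3 : HasMFDerivAt 𝓘(ℝ, EG) 𝓘(ℝ, ℝ) (fun u => f (ψ.symm u • y)) u _ :=
          HasMFDerivAt.comp (g := f) u hD h2
        have h4 := h3.hasFDerivAt
        refine h4.congr_fderiv ?_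
        ext ζ
        obtain ⟨ξ, hξ⟩ := exists_mfderiv_smul_point (EG := EG) (E := E) (ψ.symm u) y
          ((mfderiv 𝓘(ℝ, EG) 𝓘(ℝ, EG) ψ.symm u : EG →L[ℝ] EG) ζ)
        change D ((mfderiv 𝓘(ℝ, EG) 𝓘(ℝ, E) (fun g : G => g • y) (ψ.symm u) : EG →L[ℝ] E)
          ((mfderiv 𝓘(ℝ, EG) 𝓘(ℝ, EG) ψ.symm u : EG →L[ℝ] EG) ζ)) = 0
        rw [hξ, hDα, h0]
      exact (convex_ball (ψ g₀) ε).is_const_of_fderivWithin_eq_zero (𝕜 := ℝ)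
        (f := fun u => f (ψ.symm u • y))
        (fun u hu => (hd u hu).differentiableAt.differentiableWithinAt)
        (fun u hu => by
          rw [fderivWithin_of_isOpen Metric.isOpen_ball hu]
          exact (hd u hu).fderiv) hu (Metric.mem_ball_self hε)
    have hFu : ∀ u ∈ Metric.ball (ψ g₀) ε, ∃ D : E →L[ℝ] ℝ,
        HasMFDerivAt 𝓘(ℝ, E) 𝓘(ℝ, ℝ) (fun y => f (ψ.symm u • y)) x D ∧
          D v = F (ψ.symm u) := fun u hu => by
      obtain ⟨hut, D, hD, hDα⟩ := hBW (mk_mem_prod (hball hu) (mem_of_mem_nhds hW))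
      exact ⟨_, HasMFDerivAt.comp (g := f) x hD
        ((hsm (ψ.symm u) x).mdifferentiableAt (by simp)).hasMFDerivAt, hDα _⟩
    obtain ⟨D₀, hD₀, hD₀F⟩ := hFu _ (Metric.mem_ball_self hε)
    filter_upwards [ψ.open_source.mem_nhds hψs,
      (ψ.continuousAt hψs).eventually (Metric.ball_mem_nhds _ hε)] with g hg hgb
    obtain ⟨D, hD, hDF⟩ := hFu _ hgb
    have h1 := hasMFDerivAt_unique hD (hD₀.congr_of_eventuallyEq (by
      filter_upwards [hW] with y hy using hconst _ hgb y hy))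
    rw [ψ.left_inv hg] at hDF
    rw [ψ.left_inv hψs] at hD₀F
    rw [← hDF, ← hD₀F]
    exact congrArg (fun T : E →L[ℝ] ℝ => T v) h1
  have hF1 : F g = F 1 := hF.apply_eq_of_preconnectedSpace g 1
  have h2 : F 1 = α x ![v] := by
    have h3 : (fun y : M => (1 : G) • y) = id := funext fun y => one_smul _ _
    have h4 : ∀ p, p = x → ∀ u : E, (α p : E [⋀^Fin 1]→L[ℝ] ℝ) ![u] = α x ![u] := by
      rintro p rfl u
      rfl
    refine (h4 _ (one_smul G x) _).trans ?_
    rw [h3, mfderiv_id]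
    rfl
  refine Eq.trans ?_ (hF1.trans h2)
  refine congrArg (α (g • x) : E [⋀^Fin 1]→L[ℝ] ℝ) ?_
  funext i
  fin_cases i
  rfl

end Invariance

/-! ### Descent of forms along submersions. -/

section Descent

variable {E : Type*} [NormedAddCommGroup E] [NormedSpace ℝ E]
  {H : Type*} [TopologicalSpace H] {I : ModelWithCorners ℝ E H} [I.Boundaryless]
  {M : Type*} [TopologicalSpace M] [ChartedSpace H M] [IsManifold I ∞ M]
  {E' : Type*} [NormedAddCommGroup E'] [NormedSpace ℝ E']
  {H' : Type*} [TopologicalSpace H'] {J : ModelWithCorners ℝ E' H'} [J.Boundaryless]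
  {N : Type*} [TopologicalSpace N] [ChartedSpace H' N] [IsManifold J ∞ N]

/-- A form is smooth and closed if its pullback along a submersion is. -/
theorem Form.SmoothClosedAt.of_pullback {n : ℕ} {f : M → N} {x : M} {β : Form J N n}
    (hs : ContMDiff I J ∞ f) (hf : Manifold.IsSubmersionAt I J ∞ f x)
    (h : (β.pullback (I' := I) f).SmoothClosedAt x) : β.SmoothClosedAt (f x) := by
  obtain ⟨σ, hσx, hσ⟩ := exists_localSection hf
  -- Pulling back further along a local section recovers `β`.
  have h1 : ((β.pullback (I' := I) f).pullback (I' := J) σ).SmoothClosedAt (f x) := by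
    refine Form.SmoothClosedAt.pullback (hσ.mono fun q hq => hq.2) ?_
    rwa [hσx]
  refine h1.congr ?_
  filter_upwards [hσ.eventually_nhds] with q hq
  have h2 := Form.pullback_comp_apply (α := β) (f := f) (g := σ) (I' := I) (x := q)
    ((hs _).mdifferentiableAt (by simp)) (hq.self_of_nhds.2.mdifferentiableAt (by simp))
  exact (h2.trans ((Form.pullback_congr β (f := f ∘ σ) (g := fun p => p)
    (hq.mono fun p hp => hp.1)).trans (congrFun (Form.pullback_id β) q))).symm

omit [I.Boundaryless] [IsManifold I ∞ M] [J.Boundaryless] [IsManifold J ∞ N] in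
/-- A form is determined by its pullback along a map with surjective derivatives. -/
theorem Form.eq_of_pullback_eq {n : ℕ} {f : M → N} (hf : Function.Surjective f)
    (hs : ∀ x, Function.Surjective (mfderiv I J f x)) {α β : Form J N n}
    (h : α.pullback (I' := I) f = β.pullback (I' := I) f) : α = β := by
  funext y
  obtain ⟨x, rfl⟩ := hf y
  ext v
  choose u hu using fun i => hs x (v i)
  have h1 := congrArg (fun γ : TangentSpace I x [⋀^Fin n]→L[ℝ] ℝ => γ u) (congrFun h x)
  simp only [Form.pullback_apply] at h1
  have h2 : (fun i => mfderiv I J f x (u i)) = v := funext hu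
  rwa [h2] at h1

end Descent

/-! ### The reduced forms. -/

section ReducedForms

variable {EG : Type*} [NormedAddCommGroup EG] [NormedSpace ℝ EG] [FiniteDimensional ℝ EG]
  {G : Type*} [TopologicalSpace G] [ChartedSpace EG G] [Group G] [LieGroup 𝓘(ℝ, EG) ∞ G]
  {E : Type*} [NormedAddCommGroup E] [NormedSpace ℝ E] [FiniteDimensional ℝ E]
  {M : Type*} [TopologicalSpace M] [ChartedSpace E M] [IsManifold 𝓘(ℝ, E) ∞ M]
  [MulAction G M] {w : Form 𝓘(ℝ, E) M 2} {l : Form 𝓘(ℝ, E) M 1} {J : M → (EG →L[ℝ] ℝ)}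
  {ν : EG →L[ℝ] ℝ}
  {E' : Type*} [NormedAddCommGroup E'] [NormedSpace ℝ E'] [FiniteDimensional ℝ E']
  [ChartedSpace E' (LevelSet (fun _ : Fin 1 => J) (fun _ => ν))]
  [IsManifold 𝓘(ℝ, E') ∞ (LevelSet (fun _ : Fin 1 => J) (fun _ => ν))]
  {V : Type*} [NormedAddCommGroup V] [NormedSpace ℝ V]
  [ChartedSpace V (OrbitSpace 𝓘(ℝ, EG) G (fun _ : Fin 1 => J) (fun _ => ν))]

variable (G V E') in
/-- The derivative of the projection to the orbit space. -/
def projDeriv (x : LevelSet (fun _ : Fin 1 => J) (fun _ => ν)) : E' →L[ℝ] V :=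
  mfderiv 𝓘(ℝ, E') 𝓘(ℝ, V) (Quot.mk (orbitRel 𝓘(ℝ, EG) G (fun _ : Fin 1 => J) (fun _ => ν))) x

omit [FiniteDimensional ℝ EG] [LieGroup 𝓘(ℝ, EG) ∞ G]
  [FiniteDimensional ℝ E']
  [IsManifold 𝓘(ℝ, E') ∞ (LevelSet (fun _ : Fin 1 => J) (fun _ => ν))] in
theorem surjective_projDeriv
    (hπ : Manifold.IsSubmersion 𝓘(ℝ, E') 𝓘(ℝ, V) ∞
      (Quot.mk (orbitRel 𝓘(ℝ, EG) G (fun _ : Fin 1 => J) (fun _ => ν))))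
    (x : LevelSet (fun _ : Fin 1 => J) (fun _ => ν)) :
    Function.Surjective (projDeriv G E' V x) :=
  surjective_mfderiv_of_isSubmersionAt (hπ.isSubmersionAt x)
    ((hπ.contMDiff x).mdifferentiableAt (by simp))

variable (h : IsHamiltonianAction 𝓘(ℝ, EG) G (fun _ : Fin 1 => w) (fun _ => l) (fun _ => J))
  (hν : IsRegularValue 𝓘(ℝ, E) J ν)
  (hj : Manifold.IsSmoothEmbedding 𝓘(ℝ, E') 𝓘(ℝ, E) ∞
    (Subtype.val : LevelSet (fun _ : Fin 1 => J) (fun _ => ν) → M))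
  (hπ : Manifold.IsSubmersion 𝓘(ℝ, E') 𝓘(ℝ, V) ∞
    (Quot.mk (orbitRel 𝓘(ℝ, EG) G (fun _ : Fin 1 => J) (fun _ => ν))))

include h hν hj hπ

/-- The value of an invariant form, vanishing on the orbits, on tangent vectors to the level set
depends only on the projections of these vectors. -/
theorem form_eq_of_projDeriv_eq {n : ℕ} {α : Form 𝓘(ℝ, E) M n}
    (hinv : ∀ g : G, α.pullback (I' := 𝓘(ℝ, E)) (fun x : M => g • x) = α)
    (hker : ∀ (x : LevelSet (fun _ : Fin 1 => J) (fun _ => ν)) (v v' : Fin n → E'),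
      (∀ i, v i - v' i ∈ orbitTangent G E E' x) →
      α x.1 (fun i => inclDeriv E E' x (v i)) = α x.1 (fun i => inclDeriv E E' x (v' i)))
    {x y : LevelSet (fun _ : Fin 1 => J) (fun _ => ν)}
    (hxy : Quot.mk (orbitRel 𝓘(ℝ, EG) G (fun _ : Fin 1 => J) (fun _ => ν)) x = Quot.mk _ y)
    {v u : Fin n → E'} (hvu : ∀ i, projDeriv G E' V x (v i) = projDeriv G E' V y (u i)) :
    α x.1 (fun i => inclDeriv E E' x (v i)) = α y.1 (fun i => inclDeriv E E' y (u i)) := by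
  have := h.smooth
  have hmk := orbitSpace_mk_eq_iff (μ := fun _ : Fin 1 => ν) h.equivariant
  -- Move `y` to `x` by an isotropy element, with `B` transporting tangent vectors. Invariance
  -- accounts for the move. The remaining discrepancy is killed by the projection, hence is an orbit
  -- direction, and `hker` applies.
  obtain ⟨g, hg⟩ := (hmk y x).1 hxy.symm
  have hgν := coAd_eq_of_smul_eq h hg
  obtain rfl : levelSetSMul h g hgν y = x := Subtype.ext hg
  have hb := ((contMDiff_levelSetSMul h hj g hgν) y).mdifferentiableAt (n := ∞) (by simp)
  have hjd : ∀ x, HasMFDerivAt 𝓘(ℝ, E') 𝓘(ℝ, E)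
      (Subtype.val : LevelSet (fun _ : Fin 1 => J) (fun _ => ν) → M) x (inclDeriv E E' x) :=
    fun x => ((hj.isImmersion.contMDiff x).mdifferentiableAt (by simp)).hasMFDerivAt
  have hπd : ∀ x, HasMFDerivAt 𝓘(ℝ, E') 𝓘(ℝ, V)
      (Quot.mk (orbitRel 𝓘(ℝ, EG) G (fun _ : Fin 1 => J) (fun _ => ν))) x (projDeriv G E' V x) :=
    fun x => ((hπ.contMDiff x).mdifferentiableAt (by simp)).hasMFDerivAt
  set B : E' →L[ℝ] E' := mfderiv 𝓘(ℝ, E') 𝓘(ℝ, E') (levelSetSMul h g hgν) y with hB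
  have hB1 : ∀ u : E', projDeriv G E' V (levelSetSMul h g hgν y) (B u) = projDeriv G E' V y u := by
    intro u
    have h1 := (hπd (levelSetSMul h g hgν y)).comp y hb.hasMFDerivAt
    have h2 : Quot.mk (orbitRel 𝓘(ℝ, EG) G (fun _ : Fin 1 => J) (fun _ => ν)) ∘
        levelSetSMul h g hgν = Quot.mk _ := funext fun z => ((hmk _ _).2 ⟨g, rfl⟩).symm
    rw [h2] at h1
    exact congrArg (fun T : E' →L[ℝ] V => T u) (hasMFDerivAt_unique h1 (hπd y))
  have hg' : MDifferentiableAt 𝓘(ℝ, E) 𝓘(ℝ, E) (fun x : M => g • x) y.1 :=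
    ((ContMDiffSMul.contMDiff_const_smul (I := 𝓘(ℝ, EG)) (n := ∞) g) y.1).mdifferentiableAt
      (by simp)
  have hB2 : ∀ u : E', inclDeriv E E' (levelSetSMul h g hgν y) (B u) =
      (mfderiv 𝓘(ℝ, E) 𝓘(ℝ, E) (fun x : M => g • x) y.1 : E →L[ℝ] E) (inclDeriv E E' y u) := by
    intro u
    have h1 := (hjd (levelSetSMul h g hgν y)).comp y hb.hasMFDerivAt
    have h2 := hg'.hasMFDerivAt.comp y (hjd y)
    exact congrArg (fun T : E' →L[ℝ] E => T u) (hasMFDerivAt_unique h1 h2)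
  have h1 : α (levelSetSMul h g hgν y).1
      (fun i => inclDeriv E E' (levelSetSMul h g hgν y) (v i)) =
      α (levelSetSMul h g hgν y).1
        (fun i => inclDeriv E E' (levelSetSMul h g hgν y) (B (u i))) := by
    refine hker _ _ _ fun i => ?_
    rw [← mfderiv_orbitSpace_mk_eq_zero_iff h hν hj hπ]
    refine (map_sub (projDeriv G E' V (levelSetSMul h g hgν y)) (v i) (B (u i))).trans ?_
    rw [hB1, hvu, sub_self]
    rfl
  rw [h1]
  have h2 := congrArg (fun γ : E [⋀^Fin n]→L[ℝ] ℝ => γ fun i => inclDeriv E E' y (u i))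
    (congrFun (hinv g) y.1)
  refine Eq.trans ?_ h2
  simp only [hB2]
  rfl

/-- Invariant forms vanishing on the orbits descend to the orbit space. -/
theorem exists_reducedForm [FiniteDimensional ℝ V] {n : ℕ} {α : Form 𝓘(ℝ, E) M n}
    (hinv : ∀ g : G, α.pullback (I' := 𝓘(ℝ, E)) (fun x : M => g • x) = α)
    (hker : ∀ (x : LevelSet (fun _ : Fin 1 => J) (fun _ => ν)) (v v' : Fin n → E'),
      (∀ i, v i - v' i ∈ orbitTangent G E E' x) →
      α x.1 (fun i => inclDeriv E E' x (v i)) = α x.1 (fun i => inclDeriv E E' x (v' i))) :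
    ∃ β : Form 𝓘(ℝ, V) (OrbitSpace 𝓘(ℝ, EG) G (fun _ : Fin 1 => J) (fun _ => ν)) n,
      β.pullback (I' := 𝓘(ℝ, E')) (Quot.mk _) =
        α.pullback (Subtype.val : LevelSet (fun _ : Fin 1 => J) (fun _ => ν) → M) := by
  -- The value at `p` uses the representative `p.out` and a linear section of the derivative there.
  -- These choices do not matter, and no smoothness is claimed: it is deduced afterwards from local
  -- sections.
  choose s hs using fun x : LevelSet (fun _ : Fin 1 => J) (fun _ => ν) =>
    (projDeriv G E' V x).toLinearMap.exists_rightInverse_of_surjective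
      (LinearMap.range_eq_top.2 (surjective_projDeriv hπ x))
  let s' : LevelSet (fun _ : Fin 1 => J) (fun _ => ν) → V →L[ℝ] E' := fun x =>
    LinearMap.toContinuousLinearMap (s x)
  let β' : OrbitSpace 𝓘(ℝ, EG) G (fun _ : Fin 1 => J) (fun _ => ν) → V [⋀^Fin n]→L[ℝ] ℝ :=
    fun p => (α p.out.1 : E [⋀^Fin n]→L[ℝ] ℝ).compContinuousLinearMap
      ((inclDeriv E E' p.out).comp (s' p.out))
  let β : Form 𝓘(ℝ, V) (OrbitSpace 𝓘(ℝ, EG) G (fun _ : Fin 1 => J) (fun _ => ν)) n := β'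
  refine ⟨β, funext fun x => ?_⟩
  ext v
  refine (form_eq_of_projDeriv_eq h hν hj hπ hinv hker (x := x)
    (y := Quot.out (Quot.mk (orbitRel 𝓘(ℝ, EG) G (fun _ : Fin 1 => J) (fun _ => ν)) x))
    (Quot.out_eq _).symm (v := v) (u := fun i => s (Quot.out (Quot.mk _ x)) (projDeriv G E' V x (v i)))
    fun i => ?_).symm
  exact (LinearMap.congr_fun (hs (Quot.out (Quot.mk _ x))) (projDeriv G E' V x (v i))).symm

omit hπ hj [LieGroup 𝓘(ℝ, EG) ∞ G] [FiniteDimensional ℝ E'] in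
-- Contracting with an orbit direction gives `d⟨J, ξ⟩`, which vanishes on `ker dJ`.
theorem twoForm_orbitDeriv_inclDeriv
    (hj : Manifold.IsSmoothEmbedding 𝓘(ℝ, E') 𝓘(ℝ, E) ∞
      (Subtype.val : LevelSet (fun _ : Fin 1 => J) (fun _ => ν) → M))
    (x : LevelSet (fun _ : Fin 1 => J) (fun _ => ν)) (v u : E')
    (hv : v ∈ orbitTangent G E E' x) :
    w x.1 ![inclDeriv E E' x v, inclDeriv E E' x u] = 0 := by
  obtain ⟨ξ, hξ⟩ := hv
  have h1 : momentumDeriv J x.1 (inclDeriv E E' x u) = 0 :=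
    (range_mfderiv_levelSet (h.momentum.contMDiff 0) hν hj x _).1 ⟨u, rfl⟩
  have h2 := contract_eq h x.1 ξ (inclDeriv E E' x u)
  rw [h1] at h2
  have h3 : (orbitDeriv G x.1 : EG →L[ℝ] E) ξ = inclDeriv E E' x v := hξ
  rw [h3] at h2
  exact h2

theorem exists_reducedTwoForm [FiniteDimensional ℝ V] :
    ∃ β : Form 𝓘(ℝ, V) (OrbitSpace 𝓘(ℝ, EG) G (fun _ : Fin 1 => J) (fun _ => ν)) 2,
      β.pullback (I' := 𝓘(ℝ, E')) (Quot.mk _) =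
        w.pullback (Subtype.val : LevelSet (fun _ : Fin 1 => J) (fun _ => ν) → M) := by
  refine exists_reducedForm h hν hj hπ (fun g => h.action.pullback_eq g 0) fun x v v' hv => ?_
  have hd : ∀ u : Fin 2 → E', (fun i => inclDeriv E E' x (u i)) =
      ![inclDeriv E E' x (u 0), inclDeriv E E' x (u 1)] := fun u => by
    funext i
    fin_cases i <;> rfl
  let W : E [⋀^Fin 2]→L[ℝ] ℝ := w x.1
  let B : E →ₗ[ℝ] E →ₗ[ℝ] ℝ := formBilin W
  have hw : ∀ a b : E, W ![a, b] = B a b := fun a b => rfl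
  have h0 : ∀ a ∈ orbitTangent G E E' x, ∀ b, B (inclDeriv E E' x a) (inclDeriv E E' x b) = 0 :=
    fun a ha b => twoForm_orbitDeriv_inclDeriv h hν hj x a b ha
  have h0' : ∀ a ∈ orbitTangent G E E' x, ∀ b, B (inclDeriv E E' x b) (inclDeriv E E' x a) = 0 :=
    fun a ha b => by
      rw [← hw, twoForm_swap, hw, h0 a ha, neg_zero]
  have h1 := h0 _ (hv 0) (v 1)
  have h2 := h0' _ (hv 1) (v' 0)
  rw [map_sub, map_sub, LinearMap.sub_apply] at h1
  rw [map_sub, map_sub] at h2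
  change W _ = W _
  rw [hd, hd, hw, hw]
  linarith

/-- Invariance is not part of the definition of the action for one-forms; it comes from closedness
and connectedness. -/
theorem exists_reducedOneForm [FiniteDimensional ℝ V] [ConnectedSpace G] (hs : l.IsSmooth) (hc : l.IsClosed) :
    ∃ β : Form 𝓘(ℝ, V) (OrbitSpace 𝓘(ℝ, EG) G (fun _ : Fin 1 => J) (fun _ => ν)) 1,
      β.pullback (I' := 𝓘(ℝ, E')) (Quot.mk _) =
        l.pullback (Subtype.val : LevelSet (fun _ : Fin 1 => J) (fun _ => ν) → M) := by
  have := h.smooth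
  have hl : ∀ (x : M) (ξ : EG), l x ![(orbitDeriv G x : EG →L[ℝ] E) ξ] = 0 := fun x ξ =>
    h.action.generator_eq_zero ξ 0 x
  refine exists_reducedForm h hν hj hπ (Form.pullback_smul_eq hs hc hl) fun x v v' hv => ?_
  have hd : ∀ u : Fin 1 → E', (fun i => inclDeriv E E' x (u i)) =
      ![inclDeriv E E' x (u 0)] := fun u => by
    funext i
    fin_cases i
    rfl
  obtain ⟨ξ, hξ⟩ := hv 0
  have h1 : (orbitDeriv G x.1 : EG →L[ℝ] E) ξ = inclDeriv E E' x (v 0 - v' 0) := hξ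
  have h2 := hl x.1 ξ
  rw [h1] at h2
  let L : E [⋀^Fin 1]→L[ℝ] ℝ := l x.1
  have h3 : formLin L (inclDeriv E E' x (v 0 - v' 0)) = 0 := h2
  rw [map_sub, map_sub, sub_eq_zero] at h3
  change L _ = L _
  rw [hd, hd]
  exact h3

/-- The reduced forms form a cosymplectic structure. -/
theorem isCosymplectic_reduced [FiniteDimensional ℝ V]
    [IsManifold 𝓘(ℝ, V) ∞ (OrbitSpace 𝓘(ℝ, EG) G (fun _ : Fin 1 => J) (fun _ => ν))]
    (hw : IsCosymplectic w l)
    {β : Form 𝓘(ℝ, V) (OrbitSpace 𝓘(ℝ, EG) G (fun _ : Fin 1 => J) (fun _ => ν)) 2}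
    {γ : Form 𝓘(ℝ, V) (OrbitSpace 𝓘(ℝ, EG) G (fun _ : Fin 1 => J) (fun _ => ν)) 1}
    (hβ : β.pullback (I' := 𝓘(ℝ, E')) (Quot.mk _) =
      w.pullback (Subtype.val : LevelSet (fun _ : Fin 1 => J) (fun _ => ν) → M))
    (hγ : γ.pullback (I' := 𝓘(ℝ, E')) (Quot.mk _) =
      l.pullback (Subtype.val : LevelSet (fun _ : Fin 1 => J) (fun _ => ν) → M)) :
    IsCosymplectic β γ := by
  have hjs := hj.isImmersion.contMDiff
  have hβs : ∀ p, β.SmoothClosedAt p := by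
    rintro ⟨x⟩
    refine Form.SmoothClosedAt.of_pullback hπ.contMDiff (hπ.isSubmersionAt x) ?_
    rw [hβ]
    exact Form.SmoothClosedAt.pullback (Eventually.of_forall fun y => hjs y)
      (Form.smoothClosedAt_of_isSmooth_of_isClosed hw.smooth_two hw.closed_two _)
  have hγs : ∀ p, γ.SmoothClosedAt p := by
    rintro ⟨x⟩
    refine Form.SmoothClosedAt.of_pullback hπ.contMDiff (hπ.isSubmersionAt x) ?_
    rw [hγ]
    exact Form.SmoothClosedAt.pullback (Eventually.of_forall fun y => hjs y)
      (Form.smoothClosedAt_of_isSmooth_of_isClosed hw.smooth_one hw.closed_one _)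
  refine ⟨Form.isSmooth_of_smoothClosedAt hβs, Form.isSmooth_of_smoothClosedAt hγs,
    Form.isClosed_of_smoothClosedAt hβs, Form.isClosed_of_smoothClosedAt hγs, ?_⟩
  rintro ⟨x⟩
  let W : E [⋀^Fin 2]→L[ℝ] ℝ := w x.1
  let L : E [⋀^Fin 1]→L[ℝ] ℝ := l x.1
  let β' : V [⋀^Fin 2]→L[ℝ] ℝ := β (Quot.mk _ x)
  let γ' : V [⋀^Fin 1]→L[ℝ] ℝ := γ (Quot.mk _ x)
  change ∃ n : ℕ, Module.finrank ℝ V = 2 * n + 1 ∧ ∃ v : Fin (2 * n + 1) → V,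
    wedgePow γ' β' n v ≠ 0
  have hWL : ∃ n : ℕ, Module.finrank ℝ E = 2 * n + 1 ∧ ∃ v : Fin (2 * n + 1) → E,
    wedgePow L W n v ≠ 0 := hw.volume x.1
  obtain ⟨n, hn, v₀, hv₀⟩ := hWL
  have hker := formKer_inf_formKer_eq_bot hn hv₀
  obtain ⟨R, hR, hLR⟩ := exists_reeb hn hker
  rw [mem_formKer_two] at hR
  have hsurj := surjective_projDeriv (G := G) hπ x
  have hβ' : ∀ a b : E', β' ![projDeriv G E' V x a, projDeriv G E' V x b] =
      W ![inclDeriv E E' x a, inclDeriv E E' x b] := fun a b => by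
    have h1 := congrArg (fun δ : E' [⋀^Fin 2]→L[ℝ] ℝ => δ ![a, b]) (congrFun hβ x)
    refine Eq.trans (congrArg β' ?_) (h1.trans (congrArg W ?_)) <;>
    · funext i
      fin_cases i <;> rfl
  have hγ' : ∀ a : E', γ' ![projDeriv G E' V x a] = L ![inclDeriv E E' x a] := fun a => by
    have h1 := congrArg (fun δ : E' [⋀^Fin 1]→L[ℝ] ℝ => δ ![a]) (congrFun hγ x)
    refine Eq.trans (congrArg γ' ?_) (h1.trans (congrArg L ?_)) <;>
    · funext i
      fin_cases i
      rfl
  -- By the momentum identity `ker dJ` is the orthogonal of the orbit directions.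
  have htan : ∀ v : E, (∀ ξ : EG, W ![(orbitDeriv G x.1 : EG →L[ℝ] E) ξ, v] = 0) →
      ∃ b : E', inclDeriv E E' x b = v := fun v hv =>
    (range_mfderiv_levelSet (h.momentum.contMDiff 0) hν hj x v).2 (by
      change momentumDeriv J x.1 v = 0
      ext ξ
      exact (contract_eq h x.1 ξ v).symm.trans (hv ξ))
  -- A lift of a common kernel vector is killed by `L` and orthogonal to the orthogonal of the orbit
  -- directions. Hence it is an orbit direction and projects to zero.
  have hred : formKer β' ⊓ formKer γ' = ⊥ := by
    rw [eq_bot_iff]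
    rintro p ⟨hp1, hp2⟩
    rw [SetLike.mem_coe, mem_formKer_two] at hp1
    rw [SetLike.mem_coe, mem_formKer_one] at hp2
    obtain ⟨a, rfl⟩ := hsurj p
    have h1 := mem_of_orthogonal_orthogonal hker
      (LinearMap.range (orbitDeriv G x.1 : EG →L[ℝ] E).toLinearMap)
      (by
        rintro _ ⟨ξ, rfl⟩
        exact h.action.generator_eq_zero ξ 0 x.1) (u := inclDeriv E E' x a)
      (fun v hv => by
        obtain ⟨b, rfl⟩ := htan v fun ξ => hv _ ⟨ξ, rfl⟩
        rw [← hβ']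
        exact hp1 _) (by rw [← hγ']; exact hp2)
    exact (mfderiv_orbitSpace_mk_eq_zero_iff h hν hj hπ x a).2 h1
  -- The Reeb vector is orthogonal to everything, so it is tangent to the level set, and its
  -- projection is a Reeb vector of the reduced pair.
  obtain ⟨a, ha⟩ := htan R fun ξ => by rw [twoForm_swap, hR, neg_zero]
  refine exists_wedgePow_ne_zero hred (R := projDeriv G E' V x a) ?_ ?_
  · rw [mem_formKer_two]
    intro p
    obtain ⟨b, rfl⟩ := hsurj p
    rw [hβ', ha]
    exact hR _
  · rw [hγ', ha, hLR]

end ReducedForms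

/-! ### Cosymplectic reduction of one factor. -/

section SingleFactor

variable {EG : Type*} [NormedAddCommGroup EG] [NormedSpace ℝ EG] [FiniteDimensional ℝ EG]
  {G : Type*} [TopologicalSpace G] [ChartedSpace EG G] [Group G] [LieGroup 𝓘(ℝ, EG) ∞ G]
  {E : Type*} [NormedAddCommGroup E] [NormedSpace ℝ E] [FiniteDimensional ℝ E]
  {M : Type*} [TopologicalSpace M] [ChartedSpace E M] [IsManifold 𝓘(ℝ, E) ∞ M]
  [MulAction G M] {w : Form 𝓘(ℝ, E) M 2} {l : Form 𝓘(ℝ, E) M 1} {J : M → (EG →L[ℝ] ℝ)}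
  {ν : EG →L[ℝ] ℝ}

/-- Cosymplectic reduction: existence of the reduced space. -/
theorem nonempty_reducedSpace [ConnectedSpace G] [SecondCountableTopology M]
    (hw : IsCosymplectic w l)
    (h : IsHamiltonianAction 𝓘(ℝ, EG) G (fun _ : Fin 1 => w) (fun _ => l) (fun _ => J))
    (hν : IsRegularValue 𝓘(ℝ, E) J ν) :
    Nonempty (ReducedSpace 𝓘(ℝ, EG) G (fun _ : Fin 1 => w) (fun _ => l) (fun _ => J)
      (fun _ => ν)) := by
  have := h.smooth
  have := h.proper
  have : ContinuousConstSMul G M :=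
    ⟨fun g => (ContMDiffSMul.contMDiff_const_smul (I := 𝓘(ℝ, EG)) (I' := 𝓘(ℝ, E)) (n := ∞)
      g).continuous⟩
  have hJ := h.momentum.contMDiff 0
  -- The truncated difference is the true one as soon as the level set has a point; an empty level
  -- set imposes no condition.
  obtain ⟨_, _, hj⟩ := exists_manifold_levelSet hJ hν
    (d := Module.finrank ℝ E - Module.finrank ℝ (EG →L[ℝ] ℝ)) fun x =>
      Nat.sub_add_cancel (LinearMap.finrank_le_finrank_of_surjective
        (f := (momentumDeriv J x.1).toLinearMap) (hν x.1 (x.2 0)))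
  obtain ⟨_, _, hπ⟩ := exists_manifold_orbitSpace h hν hj
    (d := (Module.finrank ℝ E - Module.finrank ℝ (EG →L[ℝ] ℝ)) -
      Module.finrank ℝ (isotropyAlgebra G ν)) fun x => by
      rw [finrank_euclideanSpace_fin]
      refine Nat.sub_add_cancel ?_
      rw [← finrank_orbitTangent h hν hj x]
      exact (Submodule.finrank_le _).trans_eq finrank_euclideanSpace_fin
  obtain ⟨β, hβ⟩ := exists_reducedTwoForm h hν hj hπ
  obtain ⟨γ, hγ⟩ := exists_reducedOneForm h hν hj hπ hw.smooth_one hw.closed_one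
  have := t2Space_orbitSpace (IG := 𝓘(ℝ, EG)) (μ := fun _ : Fin 1 => ν) h.equivariant
  have := secondCountableTopology_orbitSpace (IG := 𝓘(ℝ, EG)) (μ := fun _ : Fin 1 => ν)
    h.equivariant
  exact ⟨{
    dimLevel := _
    dim := _
    embedding := hj
    submersion := hπ
    twoForm := fun _ => β
    oneForm := fun _ => γ
    pullback_twoForm := fun _ => hβ
    pullback_oneForm := fun _ => hγ }⟩

/-- Cosymplectic reduction: reduced spaces are cosymplectic. -/
theorem ReducedSpace.isCosymplectic (hw : IsCosymplectic w l)
    (h : IsHamiltonianAction 𝓘(ℝ, EG) G (fun _ : Fin 1 => w) (fun _ => l) (fun _ => J))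
    (hν : IsRegularValue 𝓘(ℝ, E) J ν)
    (R : ReducedSpace 𝓘(ℝ, EG) G (fun _ : Fin 1 => w) (fun _ => l) (fun _ => J)
      (fun _ => ν)) : IsCosymplectic (R.omega 0) (R.eta 0) :=
  letI := R.chartedLevel
  letI := R.charted
  have := R.isManifoldLevel
  have := R.isManifold
  isCosymplectic_reduced h hν R.embedding R.submersion hw (R.pullback_twoForm 0)
    (R.pullback_oneForm 0)

end SingleFactor

/-! ### Polycosymplectic linear algebra of a product. -/

section ProductLinearAlgebra

variable {k : ℕ} {V : Fin k → Type*} [∀ a, AddCommGroup (V a)] [∀ a, Module ℝ (V a)]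
  [∀ a, TopologicalSpace (V a)]
  {w : ∀ a, V a [⋀^Fin 2]→L[ℝ] ℝ} {l : ∀ a, V a [⋀^Fin 1]→L[ℝ] ℝ}
  {w' : Fin k → (∀ b, V b) [⋀^Fin 2]→L[ℝ] ℝ} {l' : Fin k → (∀ b, V b) [⋀^Fin 1]→L[ℝ] ℝ}

theorem mem_iInf_formKer_two_pi (hw : ∀ a u v, w' a ![u, v] = w a ![u a, v a])
    (u : ∀ b, V b) : u ∈ ⨅ a, formKer (w' a) ↔ ∀ a, u a ∈ formKer (w a) := by
  simp only [Submodule.mem_iInf, mem_formKer_two, hw]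
  exact forall_congr' fun a =>
    ⟨fun h v => by simpa using h (Pi.single a v), fun h v => h (v a)⟩

theorem mem_iInf_formKer_one_pi (hl : ∀ a u, l' a ![u] = l a ![u a])
    (u : ∀ b, V b) : u ∈ ⨅ a, formKer (l' a) ↔ ∀ a, u a ∈ formKer (l a) := by
  simp only [Submodule.mem_iInf, mem_formKer_one, hl]

theorem iInf_formKer_inf_pi (h : ∀ a, formKer (w a) ⊓ formKer (l a) = ⊥)
    (hw : ∀ a u v, w' a ![u, v] = w a ![u a, v a]) (hl : ∀ a u, l' a ![u] = l a ![u a]) :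
    (⨅ a, formKer (w' a)) ⊓ (⨅ a, formKer (l' a)) = ⊥ := by
  rw [eq_bot_iff]
  rintro u ⟨h1, h2⟩
  have h1 := (mem_iInf_formKer_two_pi hw u).1 h1
  have h2 := (mem_iInf_formKer_one_pi hl u).1 h2
  refine (Submodule.mem_bot ℝ).2 (funext fun a => ?_)
  have h3 : u a ∈ formKer (w a) ⊓ formKer (l a) := ⟨h1 a, h2 a⟩
  rwa [h a] at h3

/-- On the Reeb vectors, each placed in its own factor, the matrix of values is the identity. -/
theorem exists_wedgeOneForms_pi_ne_zero (hl : ∀ a u, l' a ![u] = l a ![u a])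
    {R : ∀ a, V a} (hlR : ∀ a, l a ![R a] = 1) :
    ∃ v : Fin k → ∀ b, V b, wedgeOneForms l' v ≠ 0 := by
  refine ⟨fun b => Pi.single b (R b), ?_⟩
  have h : (Matrix.of fun a b : Fin k => l' a ![Pi.single b (R b)]) = 1 := by
    ext a b
    rw [Matrix.of_apply, hl, Matrix.one_apply]
    split_ifs with hab
    · subst hab
      rw [Pi.single_eq_same, hlR]
    · rw [Pi.single_eq_of_ne hab]
      exact map_zero (formLin (l a))
  rw [wedgeOneForms, h, Matrix.det_one]
  exact one_ne_zero

/-- In each factor `ker w` is the line spanned by the Reeb vector, with `l` as coordinate: `l(u) R -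
u` lies in both kernels. Hence the common kernel is `ℝᵏ`. -/
theorem finrank_iInf_formKer_pi (h : ∀ a, formKer (w a) ⊓ formKer (l a) = ⊥)
    (hw : ∀ a u v, w' a ![u, v] = w a ![u a, v a])
    {R : ∀ a, V a} (hR : ∀ a, R a ∈ formKer (w a)) (hlR : ∀ a, l a ![R a] = 1) :
    Module.finrank ℝ (⨅ a, formKer (w' a) : Submodule ℝ (∀ b, V b)) = k := by
  have hmem := mem_iInf_formKer_two_pi hw
  let e : (⨅ a, formKer (w' a) : Submodule ℝ (∀ b, V b)) ≃ₗ[ℝ] (Fin k → ℝ) :=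
    { toFun := fun u a => formLin (l a) (u.1 a)
      map_add' := fun u v => funext fun a => map_add (formLin (l a)) _ _
      map_smul' := fun c u => funext fun a => map_smul (formLin (l a)) _ _
      invFun := fun c => ⟨fun a => c a • R a, (hmem _).2 fun a => Submodule.smul_mem _ _ (hR a)⟩
      left_inv := fun u => by
        refine Subtype.ext (funext fun a => ?_)
        have h1 : formLin (l a) (u.1 a) • R a - u.1 a ∈ formKer (w a) ⊓ formKer (l a) := by
          refine ⟨Submodule.sub_mem _ (Submodule.smul_mem _ _ (hR a)) ((hmem _).1 u.2 a), ?_⟩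
          rw [SetLike.mem_coe, mem_formKer_one, ← formLin_apply, map_sub, map_smul,
            formLin_apply (l a) (R a), hlR, smul_eq_mul, mul_one, sub_self]
        rw [h a] at h1
        exact sub_eq_zero.1 ((Submodule.mem_bot ℝ).1 h1)
      right_inv := fun c => funext fun a => by
        change formLin (l a) (c a • R a) = c a
        rw [map_smul, formLin_apply, hlR, smul_eq_mul, mul_one] }
  rw [e.finrank_eq, Module.finrank_fin_fun]

end ProductLinearAlgebra

/-! ### Forms on products of manifolds. -/

section ProductForms

variable {k : ℕ} {E : Fin k → Type*} [∀ a, NormedAddCommGroup (E a)] [∀ a, NormedSpace ℝ (E a)]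
  {H : Fin k → Type*} [∀ a, TopologicalSpace (H a)] {I : ∀ a, ModelWithCorners ℝ (E a) (H a)}
  {M : Fin k → Type*} [∀ a, TopologicalSpace (M a)] [∀ a, ChartedSpace (H a) (M a)]

theorem prodForm_apply {n : ℕ} (α : ∀ a, Form (I a) (M a) n) (a : Fin k) (x : ∀ b, M b)
    (v : Fin n → ∀ b, E b) :
    (prodForm α a x : (∀ b, E b) [⋀^Fin n]→L[ℝ] ℝ) v =
      (α a (x a) : E a [⋀^Fin n]→L[ℝ] ℝ) fun i => v i a := by
  rw [prodForm]
  change (α a (x a) : E a [⋀^Fin n]→L[ℝ] ℝ) (fun i =>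
    (mfderiv (ModelWithCorners.pi I) (I a) (fun x : ∀ b, M b => x a) x : (∀ b, E b) →L[ℝ] E a)
      (v i)) = _
  rw [mfderiv_apply]
  rfl

theorem prodForm_two_apply (α : ∀ a, Form (I a) (M a) 2) (a : Fin k) (x : ∀ b, M b)
    (u v : ∀ b, E b) :
    (prodForm α a x : (∀ b, E b) [⋀^Fin 2]→L[ℝ] ℝ) ![u, v] =
      (α a (x a) : E a [⋀^Fin 2]→L[ℝ] ℝ) ![u a, v a] := by
  refine (prodForm_apply α a x ![u, v]).trans
    (congrArg (α a (x a) : E a [⋀^Fin 2]→L[ℝ] ℝ) (funext fun i => ?_))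
  fin_cases i <;> rfl

theorem prodForm_one_apply (α : ∀ a, Form (I a) (M a) 1) (a : Fin k) (x : ∀ b, M b)
    (u : ∀ b, E b) :
    (prodForm α a x : (∀ b, E b) [⋀^Fin 1]→L[ℝ] ℝ) ![u] =
      (α a (x a) : E a [⋀^Fin 1]→L[ℝ] ℝ) ![u a] := by
  refine (prodForm_apply α a x ![u]).trans
    (congrArg (α a (x a) : E a [⋀^Fin 1]→L[ℝ] ℝ) (funext fun i => ?_))
  fin_cases i
  rfl

theorem exists_reeb_of_isCosymplectic {E : Type*} [NormedAddCommGroup E] [NormedSpace ℝ E]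
    {H : Type*} [TopologicalSpace H] {I : ModelWithCorners ℝ E H} {M : Type*}
    [TopologicalSpace M] [ChartedSpace H M] {w : Form I M 2} {l : Form I M 1}
    (h : IsCosymplectic w l) (x : M) :
    formKer (w x : E [⋀^Fin 2]→L[ℝ] ℝ) ⊓ formKer (l x : E [⋀^Fin 1]→L[ℝ] ℝ) = ⊥ ∧
      ∃ R ∈ formKer (w x : E [⋀^Fin 2]→L[ℝ] ℝ), (l x : E [⋀^Fin 1]→L[ℝ] ℝ) ![R] = 1 := by
  obtain ⟨n, hn, v, hv⟩ : ∃ n : ℕ, Module.finrank ℝ E = 2 * n + 1 ∧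
    ∃ v : Fin (2 * n + 1) → E, wedgePow (l x : E [⋀^Fin 1]→L[ℝ] ℝ) (w x) n v ≠ 0 := h.volume x
  have : FiniteDimensional ℝ E := Module.finite_of_finrank_pos (by omega)
  have h1 := formKer_inf_formKer_eq_bot (V := E) hn hv
  exact ⟨h1, exists_reeb (V := E) hn h1⟩

/-- A product of cosymplectic manifolds is polycosymplectic. -/
theorem isPolycosymplectic_prodForm [∀ a, (I a).Boundaryless] [∀ a, IsManifold (I a) ∞ (M a)]
    {w : ∀ a, Form (I a) (M a) 2} {l : ∀ a, Form (I a) (M a) 1}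
    (h : ∀ a, IsCosymplectic (w a) (l a)) : IsPolycosymplectic (prodForm w) (prodForm l) := by
  have hw : ∀ a x, (prodForm w a).SmoothClosedAt x := fun a x =>
    Form.SmoothClosedAt.pullback (Eventually.of_forall fun y => contMDiff_apply a y)
      (Form.smoothClosedAt_of_isSmooth_of_isClosed (h a).smooth_two (h a).closed_two _)
  have hl : ∀ a x, (prodForm l a).SmoothClosedAt x := fun a x =>
    Form.SmoothClosedAt.pullback (Eventually.of_forall fun y => contMDiff_apply a y)
      (Form.smoothClosedAt_of_isSmooth_of_isClosed (h a).smooth_one (h a).closed_one _)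
  choose hker R hR hlR using fun a x => exists_reeb_of_isCosymplectic (h a) x
  exact {
    smooth_two := fun a => Form.isSmooth_of_smoothClosedAt (hw a)
    smooth_one := fun a => Form.isSmooth_of_smoothClosedAt (hl a)
    closed_two := fun a => Form.isClosed_of_smoothClosedAt (hw a)
    closed_one := fun a => Form.isClosed_of_smoothClosedAt (hl a)
    wedge_ne_zero := fun x => exists_wedgeOneForms_pi_ne_zero
      (fun a u => prodForm_one_apply l a x u) fun a => hlR a (x a)
    ker_inf_ker := fun x => iInf_formKer_inf_pi (fun a => hker a (x a))
      (fun a u v => prodForm_two_apply w a x u v) fun a u => prodForm_one_apply l a x u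
    finrank_ker := fun x => finrank_iInf_formKer_pi (fun a => hker a (x a))
      (fun a u v => prodForm_two_apply w a x u v) (fun a => hR a (x a)) fun a => hlR a (x a) }

end ProductForms

/-! ### Product actions and momentum maps. -/

section ProductActions

variable {k : ℕ} {E : Fin k → Type*} [∀ a, NormedAddCommGroup (E a)] [∀ a, NormedSpace ℝ (E a)]
  {H : Fin k → Type*} [∀ a, TopologicalSpace (H a)] {I : ∀ a, ModelWithCorners ℝ (E a) (H a)}
  {M : Fin k → Type*} [∀ a, TopologicalSpace (M a)] [∀ a, ChartedSpace (H a) (M a)]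
  {EG : Fin k → Type*} [∀ a, NormedAddCommGroup (EG a)] [∀ a, NormedSpace ℝ (EG a)]
  {HG : Fin k → Type*} [∀ a, TopologicalSpace (HG a)]
  {IG : ∀ a, ModelWithCorners ℝ (EG a) (HG a)}
  {G : Fin k → Type*} [∀ a, TopologicalSpace (G a)] [∀ a, ChartedSpace (HG a) (G a)]
  [∀ a, Group (G a)]

/-- Conjugation in the product group is componentwise; differentiate at the identity. -/
theorem Ad_pi_apply [∀ a, LieGroup (IG a) ∞ (G a)] (g : ∀ a, G a) (ξ : ∀ a, EG a) (a : Fin k) :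
    Ad (ModelWithCorners.pi IG) g ξ a = Ad (IG a) (g a) (ξ a) := by
  have := lieGroup_pi (I := IG) (n := ∞) (G := G)
  have hd : MDifferentiableAt (ModelWithCorners.pi IG) (ModelWithCorners.pi IG)
      (fun h : ∀ a, G a => g * h * g⁻¹) 1 :=
    (((contMDiff_const.mul contMDiff_id).mul contMDiff_const : ContMDiff (ModelWithCorners.pi IG)
      (ModelWithCorners.pi IG) ∞ fun h : ∀ a, G a => g * h * g⁻¹) 1).mdifferentiableAt (by simp)
  have hda : MDifferentiableAt (IG a) (IG a) (fun h : G a => g a * h * (g a)⁻¹)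
      ((1 : ∀ a, G a) a) :=
    (((contMDiff_const.mul contMDiff_id).mul contMDiff_const : ContMDiff (IG a) (IG a) ∞
      fun h : G a => g a * h * (g a)⁻¹) _).mdifferentiableAt (by simp)
  have h1 := hda.hasMFDerivAt.comp (1 : ∀ a, G a) (hasMFDerivAt_apply (I := IG) a 1)
  exact (mfderiv_pi_apply hd ξ a).trans
    (congrArg (fun T : (∀ b, EG b) →L[ℝ] EG a => T ξ) h1.mfderiv)

theorem coAd_prodCovector [∀ a, LieGroup (IG a) ∞ (G a)] (g : ∀ a, G a)
    (ν : ∀ a, EG a →L[ℝ] ℝ) (a : Fin k) :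
    coAd (ModelWithCorners.pi IG) g (prodCovector ν a) =
      prodCovector (fun b => coAd (IG b) (g b) (ν b)) a := by
  ext ξ
  exact congrArg (ν a) (Ad_pi_apply g⁻¹ ξ a)

variable [∀ a, MulAction (G a) (M a)]

theorem generator_pi_apply (h : ∀ a, ContMDiffSMul (IG a) (I a) ∞ (G a) (M a))
    (ξ : ∀ a, EG a) (x : ∀ a, M a) (a : Fin k) :
    (generator (ModelWithCorners.pi IG) (∀ a, G a) (ModelWithCorners.pi I) ξ x : ∀ a, E a) a =
      generator (IG a) (G a) (I a) (ξ a) (x a) := by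
  have := contMDiffSMul_pi h
  have hd : MDifferentiableAt (ModelWithCorners.pi IG) (ModelWithCorners.pi I)
      (fun g : ∀ a, G a => g • x) 1 :=
    ((contMDiff_id.smul contMDiff_const : ContMDiff (ModelWithCorners.pi IG)
      (ModelWithCorners.pi I) ∞ fun g : ∀ a, G a => g • x) 1).mdifferentiableAt (by simp)
  have hda : MDifferentiableAt (IG a) (I a) (fun g : G a => g • x a) ((1 : ∀ a, G a) a) :=
    ((contMDiff_id.smul contMDiff_const : ContMDiff (IG a) (I a) ∞
      fun g : G a => g • x a) _).mdifferentiableAt (by simp)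
  have h1 := hda.hasMFDerivAt.comp (1 : ∀ a, G a) (hasMFDerivAt_apply (I := IG) a 1)
  exact (mfderiv_pi_apply hd ξ a).trans
    (congrArg (fun T : (∀ b, EG b) →L[ℝ] E a => T ξ) h1.mfderiv)

/-- The projection intertwines the action of `g` with that of `g a`. -/
theorem pullback_smul_prodForm (h : ∀ a, ContMDiffSMul (IG a) (I a) ∞ (G a) (M a)) {n : ℕ}
    {α : ∀ a, Form (I a) (M a) n}
    (hα : ∀ a (g : G a), (α a).pullback (I' := I a) (fun x : M a => g • x) = α a)
    (g : ∀ a, G a) (a : Fin k) :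
    (prodForm α a).pullback (I' := ModelWithCorners.pi I) (fun x : ∀ b, M b => g • x) =
      prodForm α a := by
  have := contMDiffSMul_pi h
  have hg : ContMDiff (ModelWithCorners.pi I) (ModelWithCorners.pi I) ∞
      (fun x : ∀ b, M b => g • x) :=
    ContMDiffSMul.contMDiff_const_smul (I := ModelWithCorners.pi IG) g
  have hga : ContMDiff (I a) (I a) ∞ (fun x : M a => g a • x) :=
    ContMDiffSMul.contMDiff_const_smul (I := IG a) (g a)
  have hp : ContMDiff (ModelWithCorners.pi I) (I a) ∞ (fun x : ∀ b, M b => x a) :=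
    contMDiff_apply a
  calc (prodForm α a).pullback (I' := ModelWithCorners.pi I) (fun x : ∀ b, M b => g • x)
      = (α a).pullback ((fun x : ∀ b, M b => x a) ∘ fun x : ∀ b, M b => g • x) :=
        (α a).pullback_comp (fun y => (hp y).mdifferentiableAt (by simp))
          fun y => (hg y).mdifferentiableAt (by simp)
    _ = ((α a).pullback (I' := I a) (fun x : M a => g a • x)).pullback
          (fun x : ∀ b, M b => x a) :=
        ((α a).pullback_comp (f := fun x : M a => g a • x) (g := fun x : ∀ b, M b => x a)
          (fun y => (hga y).mdifferentiableAt (by simp))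
          fun y => (hp y).mdifferentiableAt (by simp)).symm
    _ = prodForm α a := by rw [hα, prodForm]

/-- A product of Hamiltonian actions on cosymplectic manifolds is a Hamiltonian polycosymplectic
action. -/
theorem isHamiltonianAction_prod [∀ a, LieGroup (IG a) ∞ (G a)]
    {w : ∀ a, Form (I a) (M a) 2} {l : ∀ a, Form (I a) (M a) 1}
    {J : ∀ a, M a → (EG a →L[ℝ] ℝ)}
    (h : ∀ a, IsHamiltonianAction (IG a) (G a) (fun _ : Fin 1 => w a) (fun _ => l a)
      (fun _ => J a)) :
    IsHamiltonianAction (ModelWithCorners.pi IG) (∀ a, G a) (prodForm w) (prodForm l)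
      (prodMomentum J) where
  smooth := contMDiffSMul_pi fun a => (h a).smooth
  free g x hx := funext fun a => (h a).free (g a) (x a) (congrFun hx a)
  proper := properSMul_pi fun a => (h a).proper
  action :=
    { pullback_eq := pullback_smul_prodForm (fun a => (h a).smooth)
        fun a g => (h a).action.pullback_eq g 0
      generator_eq_zero := fun ξ a x =>
        (prodForm_one_apply l a x _).trans (by
          rw [generator_pi_apply fun a => (h a).smooth]
          exact (h a).action.generator_eq_zero (ξ a) 0 (x a)) }
  momentum :=
    { contMDiff := fun a =>
        ((((ContinuousLinearMap.compL ℝ (∀ b, EG b) (EG a) ℝ).flip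
          (ContinuousLinearMap.proj a)).contMDiff.comp
            ((h a).momentum.contMDiff 0)).comp (contMDiff_apply a) :)
      contract := fun a ξ x v => by
        have hJ : MDifferentiableAt (I a) 𝓘(ℝ, ℝ) (fun y : M a => J a y (ξ a)) (x a) :=
          (((ContinuousLinearMap.apply ℝ ℝ (ξ a)).contMDiff.comp
            ((h a).momentum.contMDiff 0) : ContMDiff (I a) 𝓘(ℝ, ℝ) ∞
              fun y : M a => J a y (ξ a)) _).mdifferentiableAt (by simp)
        have h1 := hJ.hasMFDerivAt.comp x (hasMFDerivAt_apply (I := I) a x)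
        refine (prodForm_two_apply w a x _ v).trans ?_
        rw [generator_pi_apply fun a => (h a).smooth]
        exact ((h a).momentum.contract 0 (ξ a) (x a) ((v : ∀ b, E b) a)).trans
          (congrArg (fun T : (∀ b, E b) →L[ℝ] ℝ => T v) h1.mfderiv).symm }
  equivariant g a x := by
    refine Eq.trans ?_ (coAd_prodCovector g (fun b => J b (x b)) a).symm
    have h1 : (fun b => coAd (IG b) (g b) (J b (x b))) = fun b => J b ((g • x) b) :=
      funext fun b => ((h b).equivariant (g b) 0 (x b)).symm
    rw [h1, prodMomentum]

end ProductActions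

/-! ### Submersions and immersions recognised by sections and retractions. -/

section Criteria

variable {E : Type*} [NormedAddCommGroup E] [NormedSpace ℝ E] [FiniteDimensional ℝ E]
  {H : Type*} [TopologicalSpace H] {I : ModelWithCorners ℝ E H} [I.Boundaryless]
  {M : Type*} [TopologicalSpace M] [ChartedSpace H M] [IsManifold I ∞ M]
  {E' : Type*} [NormedAddCommGroup E'] [NormedSpace ℝ E'] [FiniteDimensional ℝ E']
  {H' : Type*} [TopologicalSpace H'] {J : ModelWithCorners ℝ E' H'} [J.Boundaryless]
  {N : Type*} [TopologicalSpace N] [ChartedSpace H' N] [IsManifold J ∞ N] {f : M → N}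

/-- A smooth map with smooth local sections through every point is a submersion. -/
theorem isSubmersion_of_localSection (hf : ContMDiff I J ∞ f)
    (h : ∀ x, ∃ σ : N → M, σ (f x) = x ∧ ContMDiffAt J I ∞ σ (f x) ∧
      ∀ᶠ q in 𝓝 (f x), f (σ q) = q) : Manifold.IsSubmersion I J ∞ f := by
  have hs : ∀ x, Function.Surjective (mfderiv I J f x) := fun x v => by
    obtain ⟨σ, hσx, hσs, hσ⟩ := h x
    have h1 := mfderiv_apply_of_rightInverse (I := I) (J := J) (f := f) (σ := σ) (q := f x)
      (by rw [hσx]; exact (hf x).mdifferentiableAt (by simp)) (hσs.mdifferentiableAt (by simp))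
      hσ v
    rw [hσx] at h1
    exact ⟨_, h1⟩
  let F := EuclideanSpace ℝ (Fin (Module.finrank ℝ E - Module.finrank ℝ E'))
  refine (show Manifold.IsSubmersionOfComplement F I J ∞ f from fun x => ?_).isSubmersion
  refine isSubmersionAtOfComplement_of_surjective (Eventually.of_forall fun y => hf y) (hs x) ?_
  rw [finrank_euclideanSpace_fin]
  exact Nat.sub_add_cancel (LinearMap.finrank_le_finrank_of_surjective
    (f := (mfderiv I J f x : E →L[ℝ] E').toLinearMap) (hs x))

/-- A smooth map with smooth local retractions at every point is an immersion. -/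
theorem isImmersion_of_localRetraction (hf : ContMDiff I J ∞ f)
    (h : ∀ x, ∃ ρ : N → M, ContMDiffAt J I ∞ ρ (f x) ∧ ∀ᶠ y in 𝓝 x, ρ (f y) = y) :
    Manifold.IsImmersion I J ∞ f := by
  have hs : ∀ x, Function.Injective (mfderiv I J f x) := fun x => by
    obtain ⟨ρ, hρs, hρ⟩ := h x
    exact Function.LeftInverse.injective (g := mfderiv J I ρ (f x)) fun v =>
      mfderiv_apply_of_rightInverse (I := J) (J := I) (f := ρ) (σ := f)
        (hρs.mdifferentiableAt (by simp)) ((hf x).mdifferentiableAt (by simp)) hρ v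
  let F := EuclideanSpace ℝ (Fin (Module.finrank ℝ E' - Module.finrank ℝ E))
  refine (show Manifold.IsImmersionOfComplement F I J ∞ f from fun x => ?_).isImmersion
  refine isImmersionAtOfComplement_of_injective (Eventually.of_forall fun y => hf y) (hs x) ?_
  rw [finrank_euclideanSpace_fin]
  exact Nat.add_sub_cancel' (LinearMap.finrank_le_finrank_of_injective
    (f := (mfderiv I J f x : E →L[ℝ] E').toLinearMap) (hs x))

omit [FiniteDimensional ℝ E] [FiniteDimensional ℝ E'] [IsManifold I ∞ M] [J.Boundaryless]
  [IsManifold J ∞ N] in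
/-- A map out of the target of a surjective submersion is smooth if its composition with the
submersion is. -/
theorem contMDiff_of_comp_isSubmersion {E'' : Type*} [NormedAddCommGroup E''] [NormedSpace ℝ E'']
    {H'' : Type*} [TopologicalSpace H''] {I'' : ModelWithCorners ℝ E'' H''}
    {P : Type*} [TopologicalSpace P] [ChartedSpace H'' P] {g : N → P}
    (hf : Manifold.IsSubmersion I J ∞ f) (hs : Function.Surjective f)
    (hg : ContMDiff I I'' ∞ fun x => g (f x)) : ContMDiff J I'' ∞ g := by
  intro y
  obtain ⟨x, rfl⟩ := hs y
  obtain ⟨σ, hσx, hσ⟩ := exists_localSection (hf.isSubmersionAt x)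
  refine ((hg (σ (f x))).comp (f x) hσ.self_of_nhds.2).congr_of_eventuallyEq ?_
  filter_upwards [hσ] with q hq
  change g q = g (f (σ q))
  rw [hq.1]

end Criteria

section PiMap

variable {ι : Type*} [Fintype ι] {E : ι → Type*} [∀ a, NormedAddCommGroup (E a)]
  [∀ a, NormedSpace ℝ (E a)] [∀ a, FiniteDimensional ℝ (E a)]
  {H : ι → Type*} [∀ a, TopologicalSpace (H a)]
  {I : ∀ a, ModelWithCorners ℝ (E a) (H a)} [∀ a, (I a).Boundaryless]
  {M : ι → Type*} [∀ a, TopologicalSpace (M a)] [∀ a, ChartedSpace (H a) (M a)]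
  [∀ a, IsManifold (I a) ∞ (M a)]
  {E' : ι → Type*} [∀ a, NormedAddCommGroup (E' a)]
  [∀ a, NormedSpace ℝ (E' a)] [∀ a, FiniteDimensional ℝ (E' a)]
  {H' : ι → Type*} [∀ a, TopologicalSpace (H' a)]
  {I' : ∀ a, ModelWithCorners ℝ (E' a) (H' a)} [∀ a, (I' a).Boundaryless]
  {N : ι → Type*} [∀ a, TopologicalSpace (N a)] [∀ a, ChartedSpace (H' a) (N a)]
  [∀ a, IsManifold (I' a) ∞ (N a)] {f : ∀ a, M a → N a}

/-- A product of submersions is a submersion. -/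
theorem isSubmersion_pi (hf : ∀ a, Manifold.IsSubmersion (I a) (I' a) ∞ (f a)) :
    Manifold.IsSubmersion (ModelWithCorners.pi I) (ModelWithCorners.pi I') ∞
      (fun (x : ∀ a, M a) a => f a (x a)) := by
  refine isSubmersion_of_localSection
    (contMDiff_pi.2 fun a => (hf a).contMDiff.comp (contMDiff_apply a)) fun x => ?_
  choose σ hσx hσ using fun a => exists_localSection ((hf a).isSubmersionAt (x a))
  refine ⟨fun q a => σ a (q a), funext hσx, contMDiffAt_pi.2 fun a =>
    (hσ a).self_of_nhds.2.comp (fun a => f a (x a)) (contMDiff_apply a _), ?_⟩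
  have h : ∀ a, ∀ᶠ q in 𝓝 (fun a => f a (x a)), f a (σ a (q a)) = q a := fun a =>
    ((continuous_apply a).tendsto (fun a => f a (x a))).eventually ((hσ a).mono fun q hq => hq.1)
  exact (eventually_all.2 h).mono fun q hq => funext hq

/-- A product of immersions is an immersion. -/
theorem isImmersion_pi (hf : ∀ a, Manifold.IsImmersion (I a) (I' a) ∞ (f a)) :
    Manifold.IsImmersion (ModelWithCorners.pi I) (ModelWithCorners.pi I') ∞
      (fun (x : ∀ a, M a) a => f a (x a)) := by
  refine isImmersion_of_localRetraction
    (contMDiff_pi.2 fun a => (hf a).contMDiff.comp (contMDiff_apply a)) fun x => ?_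
  choose ρ hρs hρ using fun a => exists_localRetraction ((hf a).isImmersionAt (x a))
  refine ⟨fun q a => ρ a (q a), contMDiffAt_pi.2 fun a =>
    (hρs a).comp (fun a => f a (x a)) (contMDiff_apply a _), ?_⟩
  have h : ∀ a, ∀ᶠ y : ∀ a, M a in 𝓝 x, ρ a (f a (y a)) = y a := fun a =>
    ((continuous_apply a).tendsto x).eventually (hρ a)
  exact (eventually_all.2 h).mono fun q hq => funext hq

end PiMap

/-! ### Level sets and orbit spaces of a product. -/

section ProductSpaces

variable {k : ℕ} {F : Fin k → Type*} [∀ a, NormedAddCommGroup (F a)] [∀ a, NormedSpace ℝ (F a)]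
  {HG : Fin k → Type*} [∀ a, TopologicalSpace (HG a)]
  {IG : ∀ a, ModelWithCorners ℝ (F a) (HG a)}
  {G : Fin k → Type*} [∀ a, TopologicalSpace (G a)] [∀ a, ChartedSpace (HG a) (G a)]
  [∀ a, Group (G a)]
  {M : Fin k → Type*} [∀ a, TopologicalSpace (M a)] [∀ a, MulAction (G a) (M a)]
  {J : ∀ a, M a → (F a →L[ℝ] ℝ)} {ν : ∀ a, F a →L[ℝ] ℝ}

variable (J ν) in
/-- The level set of the product momentum map is the product of the level sets. -/
def levelSetHomeomorph : LevelSet (prodMomentum J) (prodCovector ν) ≃ₜ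
    ∀ a, LevelSet (fun _ : Fin 1 => J a) (fun _ => ν a) where
  toFun x a := x.component a
  invFun p := ⟨fun a => (p a).1, fun a =>
    congrArg (fun c => prodCovector c a) (funext fun b => (p b).2 0)⟩
  left_inv _ := rfl
  right_inv _ := rfl
  continuous_toFun := continuous_pi fun a =>
    ((continuous_apply a).comp continuous_subtype_val).subtype_mk _
  continuous_invFun :=
    (continuous_pi fun a => continuous_subtype_val.comp (continuous_apply a)).subtype_mk _

/-- Orbits of the product group are products of orbits, so the induced map is bijective. It is open
because a finite product of the open projections is open. -/
theorem exists_orbitSpaceHomeomorph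
    (hc : ∀ a, ContinuousConstSMul (G a) (M a))
    (hJ : ∀ a (g : G a) (x : M a), J a (g • x) = coAd (IG a) g (J a x))
    (hJ' : ∀ (g : ∀ a, G a) (a : Fin k) (x : ∀ a, M a), prodMomentum J a (g • x) =
      coAd (ModelWithCorners.pi IG) g (prodMomentum J a x)) :
    ∃ φ : OrbitSpace (ModelWithCorners.pi IG) (∀ a, G a) (prodMomentum J) (prodCovector ν) ≃ₜ
      ∀ a, OrbitSpace (IG a) (G a) (fun _ : Fin 1 => J a) (fun _ => ν a),
      ∀ x, φ (Quot.mk _ x) = fun a => Quot.mk _ (x.component a) := by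
  have h1 := orbitSpace_mk_eq_iff (μ := prodCovector ν) hJ'
  have h2 := fun a => orbitSpace_mk_eq_iff (k := 1) (J := fun _ => J a) (μ := fun _ => ν a)
    (fun g _ => hJ a g)
  let π : ∀ a, LevelSet (fun _ : Fin 1 => J a) (fun _ => ν a) →
    OrbitSpace (IG a) (G a) (fun _ : Fin 1 => J a) (fun _ => ν a) := fun a => Quot.mk _
  have hπo : IsOpenMap (Pi.map π) := IsOpenMap.piMap
    (fun a => isOpenMap_orbitSpace_mk (k := 1) (J := fun _ => J a) (fun g _ => hJ a g))
    (Eventually.of_forall fun a => Quot.mk_surjective)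
  let f : OrbitSpace (ModelWithCorners.pi IG) (∀ a, G a) (prodMomentum J) (prodCovector ν) →
      ∀ a, OrbitSpace (IG a) (G a) (fun _ : Fin 1 => J a) (fun _ => ν a) :=
    Quot.lift (fun x => Pi.map π (levelSetHomeomorph J ν x)) fun x y hxy => by
      obtain ⟨g, hg⟩ := (h1 x y).1 (Quot.sound hxy)
      exact funext fun a => (h2 a _ _).2 ⟨g a, congrFun hg a⟩
  have hfc : Continuous f := continuous_quot_lift _
    ((continuous_pi fun a => continuous_quot_mk.comp (continuous_apply a)).comp
      (levelSetHomeomorph J ν).continuous)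
  have hfo : IsOpenMap f := fun U hU => by
    have h3 : f '' U = Pi.map π '' (levelSetHomeomorph J ν '' (Quot.mk _ ⁻¹' U)) := by
      rw [← image_comp]
      ext p
      constructor
      · rintro ⟨⟨x⟩, hx, rfl⟩
        exact ⟨x, hx, rfl⟩
      · rintro ⟨x, hx, rfl⟩
        exact ⟨_, hx, rfl⟩
    rw [h3]
    exact hπo _ ((levelSetHomeomorph J ν).isOpenMap _ (hU.preimage continuous_quot_mk))
  have hfb : Function.Bijective f := by
    constructor
    · rintro ⟨x⟩ ⟨y⟩ hxy
      choose g hg using fun a => (h2 a (x.component a) (y.component a)).1 (congrFun hxy a)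
      exact (h1 x y).2 ⟨g, funext hg⟩
    · intro p
      refine ⟨Quot.mk _ ((levelSetHomeomorph J ν).symm fun a => (p a).out), ?_⟩
      exact funext fun a => (p a).out_eq
  exact ⟨(Equiv.ofBijective f hfb).toHomeomorphOfContinuousOpen hfc hfo, fun x => rfl⟩

end ProductSpaces

/-! ### Pullback of polycosymplectic structures. -/

section PullbackLinearAlgebra

variable {k : ℕ} {V V' : Type*} [AddCommGroup V] [Module ℝ V] [TopologicalSpace V]
  [AddCommGroup V'] [Module ℝ V'] [TopologicalSpace V'] (A : V' ≃ₗ[ℝ] V)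
  {w : Fin k → V [⋀^Fin 2]→L[ℝ] ℝ} {l : Fin k → V [⋀^Fin 1]→L[ℝ] ℝ}
  {w' : Fin k → V' [⋀^Fin 2]→L[ℝ] ℝ} {l' : Fin k → V' [⋀^Fin 1]→L[ℝ] ℝ}

theorem mem_iInf_formKer_two_comp (hw : ∀ a u v, w' a ![u, v] = w a ![A u, A v]) (u : V') :
    u ∈ ⨅ a, formKer (w' a) ↔ A u ∈ ⨅ a, formKer (w a) := by
  simp only [Submodule.mem_iInf, mem_formKer_two, hw]
  refine forall_congr' fun a => ⟨fun h v => ?_, fun h v => h (A v)⟩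
  obtain ⟨v, rfl⟩ := A.surjective v
  exact h v

theorem mem_iInf_formKer_one_comp (hl : ∀ a u, l' a ![u] = l a ![A u]) (u : V') :
    u ∈ ⨅ a, formKer (l' a) ↔ A u ∈ ⨅ a, formKer (l a) := by
  simp only [Submodule.mem_iInf, mem_formKer_one, hl]

theorem iInf_formKer_inf_comp (hw : ∀ a u v, w' a ![u, v] = w a ![A u, A v])
    (hl : ∀ a u, l' a ![u] = l a ![A u])
    (h : (⨅ a, formKer (w a)) ⊓ (⨅ a, formKer (l a)) = ⊥) :
    (⨅ a, formKer (w' a)) ⊓ (⨅ a, formKer (l' a)) = ⊥ := by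
  rw [eq_bot_iff]
  rintro u ⟨h1, h2⟩
  have h3 : A u ∈ (⨅ a, formKer (w a)) ⊓ (⨅ a, formKer (l a)) :=
    ⟨(mem_iInf_formKer_two_comp A hw u).1 h1, (mem_iInf_formKer_one_comp A hl u).1 h2⟩
  rw [h] at h3
  exact (Submodule.mem_bot ℝ).2 (A.map_eq_zero_iff.1 ((Submodule.mem_bot ℝ).1 h3))

theorem finrank_iInf_formKer_comp (hw : ∀ a u v, w' a ![u, v] = w a ![A u, A v]) :
    Module.finrank ℝ (⨅ a, formKer (w' a) : Submodule ℝ V') =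
      Module.finrank ℝ (⨅ a, formKer (w a) : Submodule ℝ V) := by
  have h : (⨅ a, formKer (w a) : Submodule ℝ V) =
      (⨅ a, formKer (w' a) : Submodule ℝ V').map A.toLinearMap := by
    ext u
    constructor
    · intro hu
      exact ⟨A.symm u, (mem_iInf_formKer_two_comp A hw _).2 (by rwa [A.apply_symm_apply]),
        A.apply_symm_apply u⟩
    · rintro ⟨u, hu, rfl⟩
      exact (mem_iInf_formKer_two_comp A hw u).1 hu
  rw [h]
  exact (LinearEquiv.finrank_map_eq A _).symm

theorem exists_wedgeOneForms_comp_ne_zero (hl : ∀ a u, l' a ![u] = l a ![A u])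
    (h : ∃ v, wedgeOneForms l v ≠ 0) : ∃ v, wedgeOneForms l' v ≠ 0 := by
  obtain ⟨v, hv⟩ := h
  refine ⟨fun b => A.symm (v b), ?_⟩
  simpa only [wedgeOneForms, hl, A.apply_symm_apply] using hv

end PullbackLinearAlgebra

section PullbackStructure

variable {E : Type*} [NormedAddCommGroup E] [NormedSpace ℝ E]
  {H : Type*} [TopologicalSpace H] {I : ModelWithCorners ℝ E H} [I.Boundaryless]
  {M : Type*} [TopologicalSpace M] [ChartedSpace H M] [IsManifold I ∞ M]
  {E' : Type*} [NormedAddCommGroup E'] [NormedSpace ℝ E']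
  {H' : Type*} [TopologicalSpace H'] {I' : ModelWithCorners ℝ E' H'} [I'.Boundaryless]
  {N : Type*} [TopologicalSpace N] [ChartedSpace H' N] [IsManifold I' ∞ N] {k : ℕ}

/-- The pullback of a polycosymplectic structure along a local diffeomorphism. -/
theorem IsPolycosymplectic.pullback {w : Fin k → Form I M 2} {l : Fin k → Form I M 1}
    (h : IsPolycosymplectic w l) {f : N → M} (hf : ContMDiff I' I ∞ f)
    (hd : ∀ x, Function.Bijective (mfderiv I' I f x)) :
    IsPolycosymplectic (fun a => (w a).pullback (I' := I') f)
      (fun a => (l a).pullback (I' := I') f) := by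
  have hw : ∀ a x, ((w a).pullback (I' := I') f).SmoothClosedAt x := fun a x =>
    Form.SmoothClosedAt.pullback (Eventually.of_forall fun y => hf y)
      (Form.smoothClosedAt_of_isSmooth_of_isClosed (h.smooth_two a) (h.closed_two a) _)
  have hl : ∀ a x, ((l a).pullback (I' := I') f).SmoothClosedAt x := fun a x =>
    Form.SmoothClosedAt.pullback (Eventually.of_forall fun y => hf y)
      (Form.smoothClosedAt_of_isSmooth_of_isClosed (h.smooth_one a) (h.closed_one a) _)
  let A : N → E' ≃ₗ[ℝ] E := fun x =>
    LinearEquiv.ofBijective (mfderiv I' I f x : E' →L[ℝ] E).toLinearMap (hd x)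
  have hA : ∀ (x : N) (a : Fin k) (u v : E'),
      ((w a).pullback (I' := I') f x : E' [⋀^Fin 2]→L[ℝ] ℝ) ![u, v] =
        (w a (f x) : E [⋀^Fin 2]→L[ℝ] ℝ) ![A x u, A x v] := fun x a u v => by
    refine congrArg (w a (f x) : E [⋀^Fin 2]→L[ℝ] ℝ) (funext fun i => ?_)
    fin_cases i <;> rfl
  have hB : ∀ (x : N) (a : Fin k) (u : E'),
      ((l a).pullback (I' := I') f x : E' [⋀^Fin 1]→L[ℝ] ℝ) ![u] =
        (l a (f x) : E [⋀^Fin 1]→L[ℝ] ℝ) ![A x u] := fun x a u => by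
    refine congrArg (l a (f x) : E [⋀^Fin 1]→L[ℝ] ℝ) (funext fun i => ?_)
    fin_cases i
    rfl
  exact {
    smooth_two := fun a => Form.isSmooth_of_smoothClosedAt (hw a)
    smooth_one := fun a => Form.isSmooth_of_smoothClosedAt (hl a)
    closed_two := fun a => Form.isClosed_of_smoothClosedAt (hw a)
    closed_one := fun a => Form.isClosed_of_smoothClosedAt (hl a)
    wedge_ne_zero := fun x => exists_wedgeOneForms_comp_ne_zero (A x) (hB x)
      (h.wedge_ne_zero (f x))
    ker_inf_ker := fun x => iInf_formKer_inf_comp (A x) (hA x) (hB x) (h.ker_inf_ker (f x))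
    finrank_ker := fun x => (finrank_iInf_formKer_comp (A x) (hA x)).trans (h.finrank_ker (f x)) }

end PullbackStructure

section PullbackProduct

variable {k n : ℕ} {E : Fin k → Type*} [∀ a, NormedAddCommGroup (E a)] [∀ a, NormedSpace ℝ (E a)]
  {H : Fin k → Type*} [∀ a, TopologicalSpace (H a)] {I : ∀ a, ModelWithCorners ℝ (E a) (H a)}
  {M : Fin k → Type*} [∀ a, TopologicalSpace (M a)] [∀ a, ChartedSpace (H a) (M a)]
  {EN : Fin k → Type*} [∀ a, NormedAddCommGroup (EN a)] [∀ a, NormedSpace ℝ (EN a)]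
  {HN : Fin k → Type*} [∀ a, TopologicalSpace (HN a)] {IN : ∀ a, ModelWithCorners ℝ (EN a) (HN a)}
  {N : Fin k → Type*} [∀ a, TopologicalSpace (N a)] [∀ a, ChartedSpace (HN a) (N a)]
  {EB : Fin k → Type*} [∀ a, NormedAddCommGroup (EB a)] [∀ a, NormedSpace ℝ (EB a)]
  {HB : Fin k → Type*} [∀ a, TopologicalSpace (HB a)] {IB : ∀ a, ModelWithCorners ℝ (EB a) (HB a)}
  {B : Fin k → Type*} [∀ a, TopologicalSpace (B a)] [∀ a, ChartedSpace (HB a) (B a)]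
  {E' : Type*} [NormedAddCommGroup E'] [NormedSpace ℝ E']
  {H' : Type*} [TopologicalSpace H'] {I' : ModelWithCorners ℝ E' H'}
  {N' : Type*} [TopologicalSpace N'] [ChartedSpace H' N']
  {E'' : Type*} [NormedAddCommGroup E''] [NormedSpace ℝ E'']
  {H'' : Type*} [TopologicalSpace H''] {I'' : ModelWithCorners ℝ E'' H''}
  {B' : Type*} [TopologicalSpace B'] [ChartedSpace H'' B']

/-- Compatibility of pullbacks of forms on products with a product of reductions. -/
theorem pullback_prodForm_of_commute {α : ∀ a, Form (I a) (M a) n} {β : ∀ a, Form (IB a) (B a) n}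
    {j : ∀ a, N a → M a} {p : ∀ a, N a → B a} (hj : ∀ a, MDifferentiable (IN a) (I a) (j a))
    (hp : ∀ a, MDifferentiable (IN a) (IB a) (p a))
    (h : ∀ a, (β a).pullback (I' := IN a) (p a) = (α a).pullback (j a))
    {c : N' → ∀ a, N a} (hc : MDifferentiable I' (ModelWithCorners.pi IN) c)
    {q : N' → B'} (hq : MDifferentiable I' I'' q)
    {φ : B' → ∀ a, B a} (hφ : MDifferentiable I'' (ModelWithCorners.pi IB) φ)
    {i : N' → ∀ a, M a} (hi : MDifferentiable I' (ModelWithCorners.pi I) i)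
    (hφq : ∀ x, φ (q x) = fun a => p a (c x a)) (hij : ∀ x, i x = fun a => j a (c x a))
    (a : Fin k) :
    ((prodForm β a).pullback (I' := I'') φ).pullback (I' := I') q = (prodForm α a).pullback i := by
  have hca : MDifferentiable I' (IN a) fun x => c x a := fun x => mdifferentiableAt_pi.1 (hc x) a
  have happ : MDifferentiable (ModelWithCorners.pi IB) (IB a) fun x : ∀ b, B b => x a :=
    fun x => (hasMFDerivAt_apply a x).mdifferentiableAt
  have happ' : MDifferentiable (ModelWithCorners.pi I) (I a) fun x : ∀ b, M b => x a :=
    fun x => (hasMFDerivAt_apply a x).mdifferentiableAt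
  -- Both sides are the pullbacks, along the `a`-th component of `c`, of the two sides of the
  -- identity for one factor.
  have e1 : (fun x : ∀ b, B b => x a) ∘ φ ∘ q = p a ∘ fun x => c x a :=
    funext fun x => congrFun (hφq x) a
  have e2 : (fun x : ∀ b, M b => x a) ∘ i = j a ∘ fun x => c x a :=
    funext fun x => congrFun (hij x) a
  rw [Form.pullback_comp _ hφ hq, prodForm, prodForm, Form.pullback_comp _ happ (hφ.comp hq),
    Form.pullback_comp _ happ' hi, e1, e2, ← Form.pullback_comp _ (hp a) hca,
    ← Form.pullback_comp _ (hj a) hca, h]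

end PullbackProduct

/-! ### Transport along diffeomorphisms. -/

section Transport

variable {E : Type*} [NormedAddCommGroup E] [NormedSpace ℝ E] [FiniteDimensional ℝ E]
  {H : Type*} [TopologicalSpace H] {I : ModelWithCorners ℝ E H} [I.Boundaryless]
  {M : Type*} [TopologicalSpace M] [ChartedSpace H M] [IsManifold I ∞ M]
  {E' : Type*} [NormedAddCommGroup E'] [NormedSpace ℝ E'] [FiniteDimensional ℝ E']
  {H' : Type*} [TopologicalSpace H'] {J : ModelWithCorners ℝ E' H'} [J.Boundaryless]
  {N : Type*} [TopologicalSpace N] [ChartedSpace H' N] [IsManifold J ∞ N]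
  {F : Type*} [NormedAddCommGroup F] [NormedSpace ℝ F] [FiniteDimensional ℝ F]
  {K : Type*} [TopologicalSpace K] {IX : ModelWithCorners ℝ F K} [IX.Boundaryless]
  {X : Type*} [TopologicalSpace X] [ChartedSpace K X] [IsManifold IX ∞ X]
  {F' : Type*} [NormedAddCommGroup F'] [NormedSpace ℝ F'] [FiniteDimensional ℝ F']
  {K' : Type*} [TopologicalSpace K'] {IY : ModelWithCorners ℝ F' K'} [IY.Boundaryless]
  {Y : Type*} [TopologicalSpace Y] [ChartedSpace K' Y] [IsManifold IY ∞ Y] {f : M → N}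

omit [FiniteDimensional ℝ E] [IsManifold I ∞ M] in
theorem isImmersion_comp_homeomorph (hf : Manifold.IsImmersion I J ∞ f) (h : X ≃ₜ M)
    (hh : ContMDiff IX I ∞ h) (hh' : ContMDiff I IX ∞ h.symm) :
    Manifold.IsImmersion IX J ∞ fun x => f (h x) := by
  refine isImmersion_of_localRetraction (hf.contMDiff.comp hh) fun x => ?_
  obtain ⟨ρ, hρs, hρ⟩ := exists_localRetraction (hf.isImmersionAt (h x))
  refine ⟨fun q => h.symm (ρ q), (hh' _).comp _ hρs, ?_⟩
  have h1 : ∀ᶠ y in 𝓝 x, ρ (f (h y)) = h y := (h.continuous.tendsto x).eventually hρ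
  filter_upwards [h1] with y hy
  rw [hy, h.symm_apply_apply]

omit [FiniteDimensional ℝ E] [IsManifold I ∞ M] [FiniteDimensional ℝ E'] [J.Boundaryless]
  [IsManifold J ∞ N] in
theorem isSubmersion_comp_homeomorph (hf : Manifold.IsSubmersion I J ∞ f) (h : X ≃ₜ M)
    (hh : ContMDiff IX I ∞ h) (hh' : ContMDiff I IX ∞ h.symm) (φ : Y ≃ₜ N)
    (hφ : ContMDiff IY J ∞ φ) (hφ' : ContMDiff J IY ∞ φ.symm) {g : X → Y}
    (hg : ∀ x, φ (g x) = f (h x)) : Manifold.IsSubmersion IX IY ∞ g := by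
  have hg' : ∀ x, g x = φ.symm (f (h x)) := fun x => by rw [← hg, φ.symm_apply_apply]
  have hgs : ContMDiff IX IY ∞ g :=
    (hφ'.comp (hf.contMDiff.comp hh)).congr hg'
  refine isSubmersion_of_localSection hgs fun x => ?_
  obtain ⟨σ, hσx, hσ⟩ := exists_localSection (hf.isSubmersionAt (h x))
  rw [← hg] at hσx hσ
  refine ⟨fun y => h.symm (σ (φ y)), ?_, (hh' _).comp _
    (ContMDiffAt.comp (g x) hσ.self_of_nhds.2 (hφ _)), ?_⟩
  · change h.symm (σ (φ (g x))) = x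
    rw [hσx, h.symm_apply_apply]
  · have h1 : ∀ᶠ y in 𝓝 (g x), f (σ (φ y)) = φ y :=
      (φ.continuous.tendsto (g x)).eventually (hσ.mono fun q hq => hq.1)
    filter_upwards [h1] with y hy
    rw [hg', h.apply_symm_apply, hy, φ.symm_apply_apply]

end Transport

/-! ### Reduced spaces of the product. -/

section Main

variable {k : ℕ} {EG : Fin k → Type*} [∀ a, NormedAddCommGroup (EG a)]
  [∀ a, NormedSpace ℝ (EG a)]
  {G : Fin k → Type*} [∀ a, TopologicalSpace (G a)] [∀ a, ChartedSpace (EG a) (G a)]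
  [∀ a, Group (G a)] [∀ a, LieGroup 𝓘(ℝ, EG a) ∞ (G a)]
  {E : Fin k → Type*} [∀ a, NormedAddCommGroup (E a)] [∀ a, NormedSpace ℝ (E a)]
  [∀ a, FiniteDimensional ℝ (E a)]
  {M : Fin k → Type*} [∀ a, TopologicalSpace (M a)] [∀ a, ChartedSpace (E a) (M a)]
  [∀ a, IsManifold 𝓘(ℝ, E a) ∞ (M a)] [∀ a, MulAction (G a) (M a)]
  {w : ∀ a, Form 𝓘(ℝ, E a) (M a) 2} {l : ∀ a, Form 𝓘(ℝ, E a) (M a) 1}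
  {J : ∀ a, M a → (EG a →L[ℝ] ℝ)} {ν : ∀ a, EG a →L[ℝ] ℝ}

instance isManifold_carrier (a : Fin k) (R : ∀ a, ReducedSpace 𝓘(ℝ, EG a) (G a)
    (fun _ : Fin 1 => w a) (fun _ => l a) (fun _ => J a) (fun _ => ν a)) :
    IsManifold (R a).model ∞ (R a).Carrier := (R a).isManifold

omit [∀ a, FiniteDimensional ℝ (E a)] [∀ a, IsManifold 𝓘(ℝ, E a) ∞ (M a)] in
theorem exists_reducedSpaceHomeomorph
    (h : ∀ a, IsHamiltonianAction 𝓘(ℝ, EG a) (G a)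
      (fun _ : Fin 1 => w a) (fun _ => l a) (fun _ => J a))
    (R : ∀ a, ReducedSpace 𝓘(ℝ, EG a) (G a)
      (fun _ : Fin 1 => w a) (fun _ => l a) (fun _ => J a) (fun _ => ν a)) :
    ∃ φ : OrbitSpace (ModelWithCorners.pi fun a => 𝓘(ℝ, EG a)) (∀ a, G a) (prodMomentum J)
      (prodCovector ν) ≃ₜ ∀ a, (R a).Carrier,
      ∀ x, φ (Quot.mk _ x) = fun a => (R a).proj (x.component a) :=
  exists_orbitSpaceHomeomorph
    (fun a => have := (h a).smooth
      ⟨fun g => (ContMDiffSMul.contMDiff_const_smul (I := 𝓘(ℝ, EG a)) (I' := 𝓘(ℝ, E a)) (n := ∞)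
        g).continuous⟩)
    (fun a g x => (h a).equivariant g 0 x) (isHamiltonianAction_prod h).equivariant

/-- The product of reduced spaces is a reduced space of the product. -/
theorem nonempty_reducedSpace_prod [∀ a, SecondCountableTopology (M a)]
    (h : ∀ a, IsHamiltonianAction 𝓘(ℝ, EG a) (G a)
      (fun _ : Fin 1 => w a) (fun _ => l a) (fun _ => J a))
    (R : ∀ a, ReducedSpace 𝓘(ℝ, EG a) (G a)
      (fun _ : Fin 1 => w a) (fun _ => l a) (fun _ => J a) (fun _ => ν a)) :
    Nonempty (ReducedSpace (ModelWithCorners.pi fun a => 𝓘(ℝ, EG a)) (∀ a, G a)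
      (prodForm w) (prodForm l) (prodMomentum J) (prodCovector ν)) := by
  let cL : ∀ a, ChartedSpace (EuclideanSpace ℝ (Fin (R a).dimLevel))
    (LevelSet (fun _ : Fin 1 => J a) (fun _ => ν a)) := fun a => (R a).chartedLevel
  have mL : ∀ a, IsManifold 𝓘(ℝ, EuclideanSpace ℝ (Fin (R a).dimLevel)) ∞
    (LevelSet (fun _ : Fin 1 => J a) (fun _ => ν a)) := fun a => (R a).isManifoldLevel
  have hR := isHamiltonianAction_prod h
  obtain ⟨φ, hφ⟩ := exists_reducedSpaceHomeomorph h R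
  -- A reduced space must be modelled on a standard Euclidean space, so the product structure is
  -- carried over to one of the same dimension.
  obtain ⟨_, _, hh, hh'⟩ := exists_chartedSpace_of_homeomorph
    (I := ModelWithCorners.pi fun a => 𝓘(ℝ, EuclideanSpace ℝ (Fin (R a).dimLevel)))
    (E := EuclideanSpace ℝ (Fin (Module.finrank ℝ
      (∀ a, EuclideanSpace ℝ (Fin (R a).dimLevel))))) (levelSetHomeomorph J ν)
    finrank_euclideanSpace_fin.symm
  obtain ⟨_, _, hφs, hφs'⟩ := exists_chartedSpace_of_homeomorph
    (I := ModelWithCorners.pi fun a => (R a).model)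
    (E := EuclideanSpace ℝ (Fin (Module.finrank ℝ
      (∀ a, EuclideanSpace ℝ (Fin (R a).dim))))) φ
    finrank_euclideanSpace_fin.symm
  have hj := fun a => (R a).embedding.isImmersion
  have hπ : ∀ a, Manifold.IsSubmersion 𝓘(ℝ, EuclideanSpace ℝ (Fin (R a).dimLevel)) (R a).model ∞
    (R a).proj := fun a => (R a).submersion
  have hJ := isImmersion_comp_homeomorph (isImmersion_pi hj) (levelSetHomeomorph J ν) hh hh'
  have hP := isSubmersion_comp_homeomorph (isSubmersion_pi hπ) (levelSetHomeomorph J ν) hh hh'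
    φ hφs hφs' hφ
  have := hR.proper
  have := hR.smooth
  have : ContinuousConstSMul (∀ a, G a) (∀ a, M a) :=
    ⟨fun g => (ContMDiffSMul.contMDiff_const_smul (I := ModelWithCorners.pi fun a => 𝓘(ℝ, EG a))
      (I' := ModelWithCorners.pi fun a => 𝓘(ℝ, E a)) (n := ∞) g).continuous⟩
  have := t2Space_orbitSpace (μ := prodCovector ν) hR.equivariant
  have := secondCountableTopology_orbitSpace (μ := prodCovector ν) hR.equivariant
  exact ⟨{
    dimLevel := _
    dim := _
    embedding := ⟨hJ, IsEmbedding.subtypeVal⟩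
    submersion := hP
    twoForm := fun a => (prodForm (fun b => (R b).omega 0) a).pullback φ
    oneForm := fun a => (prodForm (fun b => (R b).eta 0) a).pullback φ
    pullback_twoForm := pullback_prodForm_of_commute
      (fun a => (hj a).contMDiff.mdifferentiable (by simp))
      (fun a => (hπ a).contMDiff.mdifferentiable (by simp)) (fun a => (R a).pullback_twoForm 0)
      (hh.mdifferentiable (by simp)) (hP.contMDiff.mdifferentiable (by simp))
      (hφs.mdifferentiable (by simp)) (hJ.contMDiff.mdifferentiable (by simp)) hφ fun x => rfl
    pullback_oneForm := pullback_prodForm_of_commute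
      (fun a => (hj a).contMDiff.mdifferentiable (by simp))
      (fun a => (hπ a).contMDiff.mdifferentiable (by simp)) (fun a => (R a).pullback_oneForm 0)
      (hh.mdifferentiable (by simp)) (hP.contMDiff.mdifferentiable (by simp))
      (hφs.mdifferentiable (by simp)) (hJ.contMDiff.mdifferentiable (by simp)) hφ fun x => rfl }⟩

end Main

section Identification

variable {k : ℕ} {EG : Fin k → Type*} [∀ a, NormedAddCommGroup (EG a)]
  [∀ a, NormedSpace ℝ (EG a)]
  {G : Fin k → Type*} [∀ a, TopologicalSpace (G a)] [∀ a, ChartedSpace (EG a) (G a)]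
  [∀ a, Group (G a)] [∀ a, LieGroup 𝓘(ℝ, EG a) ∞ (G a)]
  {E : Fin k → Type*} [∀ a, NormedAddCommGroup (E a)] [∀ a, NormedSpace ℝ (E a)]
  {M : Fin k → Type*} [∀ a, TopologicalSpace (M a)] [∀ a, ChartedSpace (E a) (M a)]
  [∀ a, MulAction (G a) (M a)]
  {w : ∀ a, Form 𝓘(ℝ, E a) (M a) 2} {l : ∀ a, Form 𝓘(ℝ, E a) (M a) 1}
  {J : ∀ a, M a → (EG a →L[ℝ] ℝ)} {ν : ∀ a, EG a →L[ℝ] ℝ}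

/-- The reduced space of the product is the product of the reduced spaces. -/
theorem exists_reducedSpaceDiffeomorph
    (h : ∀ a, IsHamiltonianAction 𝓘(ℝ, EG a) (G a)
      (fun _ : Fin 1 => w a) (fun _ => l a) (fun _ => J a))
    (R : ∀ a, ReducedSpace 𝓘(ℝ, EG a) (G a)
      (fun _ : Fin 1 => w a) (fun _ => l a) (fun _ => J a) (fun _ => ν a))
    (S : ReducedSpace (ModelWithCorners.pi fun a => 𝓘(ℝ, EG a)) (∀ a, G a)
      (prodForm w) (prodForm l) (prodMomentum J) (prodCovector ν)) :
    ∃ φ : S.Carrier ≃ₘ^∞⟮S.model, ModelWithCorners.pi fun a => (R a).model⟯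
        (∀ a, (R a).Carrier),
      (∀ x, φ (S.proj x) = fun a => (R a).proj (x.component a)) ∧
      ∀ a, (prodForm (fun b => (R b).omega 0) a).pullback φ = S.omega a ∧
        (prodForm (fun b => (R b).eta 0) a).pullback φ = S.eta a := by
  let cL : ∀ a, ChartedSpace (EuclideanSpace ℝ (Fin (R a).dimLevel))
    (LevelSet (fun _ : Fin 1 => J a) (fun _ => ν a)) := fun a => (R a).chartedLevel
  have mL : ∀ a, IsManifold 𝓘(ℝ, EuclideanSpace ℝ (Fin (R a).dimLevel)) ∞
    (LevelSet (fun _ : Fin 1 => J a) (fun _ => ν a)) := fun a => (R a).isManifoldLevel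
  let cS := S.chartedLevel
  have mS := S.isManifoldLevel
  have mS' : IsManifold S.model ∞ S.Carrier := S.isManifold
  have hj := fun a => (R a).embedding.isImmersion
  have hπ : ∀ a, Manifold.IsSubmersion 𝓘(ℝ, EuclideanSpace ℝ (Fin (R a).dimLevel)) (R a).model ∞
    (R a).proj := fun a => (R a).submersion
  have hJ := S.embedding.isImmersion
  have hP : Manifold.IsSubmersion 𝓘(ℝ, EuclideanSpace ℝ (Fin S.dimLevel)) S.model ∞ S.proj :=
    S.submersion
  obtain ⟨φ₀, hφ₀⟩ := exists_reducedSpaceHomeomorph h R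
  let φ : S.Carrier ≃ₜ ∀ a, (R a).Carrier := φ₀
  have hφ : ∀ x, φ (S.proj x) = fun a => (R a).proj (x.component a) := hφ₀
  -- The structures in `R` and `S` are unrelated. On level sets, smoothness of the comparison is
  -- tested after the immersions; on quotients, after composition with the surjective submersions.
  have hh : ContMDiff 𝓘(ℝ, EuclideanSpace ℝ (Fin S.dimLevel))
      (ModelWithCorners.pi fun a => 𝓘(ℝ, EuclideanSpace ℝ (Fin (R a).dimLevel))) ∞
      (levelSetHomeomorph J ν) := contMDiff_pi.2 fun a =>
    (ContMDiff.iff_comp_isImmersion (hj a)).2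
      ⟨(continuous_apply a).comp (levelSetHomeomorph J ν).continuous,
        (contMDiff_apply a).comp hJ.contMDiff⟩
  have hh' : ContMDiff (ModelWithCorners.pi fun a =>
      𝓘(ℝ, EuclideanSpace ℝ (Fin (R a).dimLevel))) 𝓘(ℝ, EuclideanSpace ℝ (Fin S.dimLevel)) ∞
      (levelSetHomeomorph J ν).symm :=
    (ContMDiff.iff_comp_isImmersion hJ).2
      ⟨(levelSetHomeomorph J ν).symm.continuous,
        contMDiff_pi.2 fun a => (hj a).contMDiff.comp (contMDiff_apply a)⟩
  have hφs : ContMDiff S.model (ModelWithCorners.pi fun a => (R a).model) ∞ φ :=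
    contMDiff_of_comp_isSubmersion hP Quot.mk_surjective (by
      simp only [hφ]
      exact contMDiff_pi.2 fun a => (hπ a).contMDiff.comp ((contMDiff_apply a).comp hh))
  have hφs' : ContMDiff (ModelWithCorners.pi fun a => (R a).model) S.model ∞ φ.symm := by
    refine contMDiff_of_comp_isSubmersion (isSubmersion_pi hπ)
      (fun p => ⟨fun a => (p a).out, funext fun a => (p a).out_eq⟩) ?_
    refine (hP.contMDiff.comp hh').congr fun p => ?_
    exact φ.symm_apply_eq.2 (hφ ((levelSetHomeomorph J ν).symm p)).symm
  have hsurj : ∀ x, Function.Surjective (mfderiv 𝓘(ℝ, EuclideanSpace ℝ (Fin S.dimLevel))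
      S.model S.proj x) := fun x =>
    surjective_mfderiv_of_isSubmersionAt (hP.isSubmersionAt x)
      ((hP.contMDiff x).mdifferentiableAt (by simp))
  have hproj : Function.Surjective S.proj := Quot.mk_surjective
  refine ⟨⟨φ.toEquiv, hφs, hφs'⟩, hφ, fun a => ⟨?_, ?_⟩⟩
  -- Forms on the quotient are determined by their pullbacks to the level set, where both are
  -- restrictions of the same form on the product.
  · refine Form.eq_of_pullback_eq hproj hsurj ?_
    exact (pullback_prodForm_of_commute
      (fun a => (hj a).contMDiff.mdifferentiable (by simp))
      (fun a => (hπ a).contMDiff.mdifferentiable (by simp)) (fun a => (R a).pullback_twoForm 0)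
      (hh.mdifferentiable (by simp)) (hP.contMDiff.mdifferentiable (by simp))
      (hφs.mdifferentiable (by simp)) (hJ.contMDiff.mdifferentiable (by simp)) hφ
      (fun x => rfl) a).trans (S.pullback_twoForm a).symm
  · refine Form.eq_of_pullback_eq hproj hsurj ?_
    exact (pullback_prodForm_of_commute
      (fun a => (hj a).contMDiff.mdifferentiable (by simp))
      (fun a => (hπ a).contMDiff.mdifferentiable (by simp)) (fun a => (R a).pullback_oneForm 0)
      (hh.mdifferentiable (by simp)) (hP.contMDiff.mdifferentiable (by simp))
      (hφs.mdifferentiable (by simp)) (hJ.contMDiff.mdifferentiable (by simp)) hφ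
      (fun x => rfl) a).trans (S.pullback_oneForm a).symm

end Identification

end Polycosymplectic

end

open Polycosymplectic in
theorem mainTheorem10 {k : ℕ}
    {EG : Fin k → Type*} [∀ a, NormedAddCommGroup (EG a)] [∀ a, NormedSpace ℝ (EG a)]
    [∀ a, FiniteDimensional ℝ (EG a)]
    {G : Fin k → Type*} [∀ a, TopologicalSpace (G a)] [∀ a, ChartedSpace (EG a) (G a)]
    [∀ a, Group (G a)] [∀ a, LieGroup 𝓘(ℝ, EG a) ∞ (G a)]
    [∀ a, T2Space (G a)] [∀ a, SecondCountableTopology (G a)] [∀ a, ConnectedSpace (G a)]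
    {E : Fin k → Type*} [∀ a, NormedAddCommGroup (E a)] [∀ a, NormedSpace ℝ (E a)]
    [∀ a, FiniteDimensional ℝ (E a)]
    {M : Fin k → Type*} [∀ a, TopologicalSpace (M a)] [∀ a, ChartedSpace (E a) (M a)]
    [∀ a, IsManifold 𝓘(ℝ, E a) ∞ (M a)]
    [∀ a, T2Space (M a)] [∀ a, SecondCountableTopology (M a)]
    [∀ a, MulAction (G a) (M a)]
    (Ω : ∀ a, Form 𝓘(ℝ, E a) (M a) 2) (l : ∀ a, Form 𝓘(ℝ, E a) (M a) 1)
    (hΩ : ∀ a, IsCosymplectic (Ω a) (l a))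
    (J : ∀ a, M a → (EG a →L[ℝ] ℝ))
    (hJ : ∀ a, IsHamiltonianAction 𝓘(ℝ, EG a) (G a)
      (fun _ : Fin 1 => Ω a) (fun _ => l a) (fun _ => J a))
    (ν : ∀ a, EG a →L[ℝ] ℝ) (hν : ∀ a, IsRegularValue 𝓘(ℝ, E a) (J a) (ν a)) :
    -- the product is a polycosymplectic manifold on which the product group acts
    IsManifold (ModelWithCorners.pi fun a => 𝓘(ℝ, E a)) ∞ (∀ a, M a) ∧
    LieGroup (ModelWithCorners.pi fun a => 𝓘(ℝ, EG a)) ∞ (∀ a, G a) ∧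
    IsPolycosymplectic (prodForm Ω) (prodForm l) ∧
    IsHamiltonianAction (ModelWithCorners.pi fun a => 𝓘(ℝ, EG a)) (∀ a, G a)
      (prodForm Ω) (prodForm l) (prodMomentum J) ∧
    -- the reduced spaces of the factors and of the product exist
    (∀ a, Nonempty (ReducedSpace 𝓘(ℝ, EG a) (G a)
      (fun _ : Fin 1 => Ω a) (fun _ => l a) (fun _ => J a) (fun _ => ν a))) ∧
    Nonempty (ReducedSpace (ModelWithCorners.pi fun a => 𝓘(ℝ, EG a)) (∀ a, G a)
      (prodForm Ω) (prodForm l) (prodMomentum J) (prodCovector ν)) ∧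
    -- and they are identified
    ∀ (R : ∀ a, ReducedSpace 𝓘(ℝ, EG a) (G a)
        (fun _ : Fin 1 => Ω a) (fun _ => l a) (fun _ => J a) (fun _ => ν a))
      (S : ReducedSpace (ModelWithCorners.pi fun a => 𝓘(ℝ, EG a)) (∀ a, G a)
        (prodForm Ω) (prodForm l) (prodMomentum J) (prodCovector ν)),
      (∀ a, IsCosymplectic ((R a).omega 0) ((R a).eta 0)) ∧
      IsPolycosymplectic S.omega S.eta ∧
      IsManifold (ModelWithCorners.pi fun a => (R a).model) ∞ (∀ a, (R a).Carrier) ∧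
      IsPolycosymplectic (prodForm fun a => (R a).omega 0) (prodForm fun a => (R a).eta 0) ∧
      ∃ φ : S.Carrier ≃ₘ^∞⟮S.model, ModelWithCorners.pi fun a => (R a).model⟯
          (∀ a, (R a).Carrier),
        (∀ x, φ (S.proj x) = fun a => (R a).proj (x.component a)) ∧
        ∀ a, (prodForm (fun b => (R b).omega 0) a).pullback φ = S.omega a ∧
          (prodForm (fun b => (R b).eta 0) a).pullback φ = S.eta a := by
  have hP := isPolycosymplectic_prodForm hΩ
  have hA := isHamiltonianAction_prod hJ
  have hR := fun a => nonempty_reducedSpace (hΩ a) (hJ a) (hν a)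
  refine ⟨isManifold_pi, lieGroup_pi, hP, hA, hR,
    nonempty_reducedSpace_prod hJ fun a => (hR a).some, fun R S => ?_⟩
  have hRc : ∀ a, IsCosymplectic ((R a).omega 0) ((R a).eta 0) := fun a =>
    (R a).isCosymplectic (hΩ a) (hJ a) (hν a)
  have : IsManifold S.model ∞ S.Carrier := S.isManifold
  have hRP := isPolycosymplectic_prodForm hRc
  obtain ⟨φ, hφ, hφf⟩ := exists_reducedSpaceDiffeomorph hJ R S
  -- The structure on `S` is the pullback of the product structure along the diffeomorphism, so it
  -- inherits the polycosymplectic conditions.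
  have hS := hRP.pullback φ.contMDiff fun x =>
    (φ.mfderivToContinuousLinearEquiv (by simp) x).bijective
  have h1 : (fun a => (prodForm (fun b => (R b).omega 0) a).pullback φ) = S.omega :=
    funext fun a => (hφf a).1
  have h2 : (fun a => (prodForm (fun b => (R b).eta 0) a).pullback φ) = S.eta :=
    funext fun a => (hφf a).2
  rw [h1, h2] at hS
  exact ⟨hRc, hS, isManifold_pi, hRP, φ, hφ, hφf⟩
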